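/- Let $B\subset\mathbb{R}^2$ be the open unit ball, let $0<z_0<z_1<\cdots$ be the increasing sequence of all $z>0$ such that $z^2$ is an eigenvalue of $-\Delta$ on $B$ with vanishing Dirichlet boundary conditions having a radial eigenfunction, and let $e_n$ be the corresponding real radial eigenfunctions, normalized in $L^2(B)$. Write $\widehat f(n)=\int_B f e_n\,dx$, $$P_Nf=\sum_{z_n\le N}\widehat f(n)\,e_n,\qquad (\sqrt{-\Delta})^{\sigma}f=\sum_n z_n^{\sigma}\widehat f(n)\,e_n .$$ Let $\mu_F$ be the law on $L^2(B;\mathbb{C})$ of the random series $\phi=\frac1\pi\sum_n\frac{g_n}{z_n}e_n$, where $(g_n)$ are independent complex Gaussians whose real and imaginary parts are independent, centered and of variance $v>0$ (fixed by the chosen normalization; $v=\frac12$ if $\mathbb{E}|g_n|^2=1$). Let $\alpha\ge 2$ be an even integer. For an integer $N\ge1$ and $\phi\in L^2(B;\mathbb{C})$ let $u_N=u_N^{(\phi)}$ be the global solution, with values in the span of $\{e_n: z_n\le N\}$, of the truncated defocusing nonlinear Schrödinger equation $$i\partial_tu_N+\Delta u_N-P_N(|u_N|^{\alpha}u_N)=0,\qquad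 u_N(0)=P_N\phi .$$ For $T>0$ put $$\|F\|_{L^p_xL^q_t}=\Big(\int_B\Big(\int_0^T|F(t,x)|^q\,dt\Big)^{p/q}dx\Big)^{1/p}.$$ Let $T>0$, $0\le\sigma<\frac12$, $2\le p<\frac2\sigma$ (that is, $2\le p<\infty$ if $\sigma=0$) and $0<q<\infty$. Then there are constants $C,c>0$, depending only on $\sigma,p,q,T,\alpha,v$, such that for every $N\ge1$ $$\mu_F\Big(\Big\{\phi:\big\|(\sqrt{-\Delta})^{\sigma}u_N^{(\phi)}\big\|_{L^p_xL^q_t}>\lambda\Big\}\Big)\le C\,e^{-\lambda^{c}}\quad\text{for all }\lambda>0,$$ and $$\mathbb{E}_{\mu_F}\Big[\big\|(\sqrt{-\Delta})^{\sigma}u_N^{(\phi)}\big\|_{L^p_xL^q_t}\Big]\le C .$$ -/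

import Mathlib

open MeasureTheory ProbabilityTheory Set
open scoped ENNReal NNReal

noncomputable section

/-- The plane `ℝ²` with its Euclidean norm. -/
abbrev Plane : Type := EuclideanSpace ℝ (Fin 2)

/-- The open unit ball `B = B₂` of the plane. -/
abbrev unitDisc : Set Plane := Metric.ball 0 1

/-- Lebesgue measure on the unit ball. -/
abbrev discMeasure : Measure Plane := volume.restrict unitDisc

/-- `f` is a radial (real) eigenfunction of `-Δ` on the unit ball with vanishing Dirichlet boundary
conditions and eigenvalue `ζ²`. Only the values of `f` on the closed ball matter. -/
structure IsRadialDirichletEigenfunction (ζ : ℝ) (f : Plane → ℝ) : Prop where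
  radial : ∀ x ∈ Metric.closedBall (0 : Plane) 1, ∀ y ∈ Metric.closedBall (0 : Plane) 1,
    ‖x‖ = ‖y‖ → f x = f y
  continuousOn : ContinuousOn f (Metric.closedBall 0 1)
  contDiffOn : ContDiffOn ℝ 2 f unitDisc
  boundary : ∀ x ∈ Metric.sphere (0 : Plane) 1, f x = 0
  equation : ∀ x ∈ unitDisc, -(Laplacian.laplacian f x) = ζ ^ 2 * f x
  nontrivial : ∃ x ∈ unitDisc, f x ≠ 0

/-- The increasing sequence `z` of all frequencies of the radial Dirichlet eigenfunctions of the
unit ball (the squares `z n ^ 2` are the radial eigenvalues, indexed from `0`), with the associated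
`L²`-normalized eigenfunctions `e n`, which are determined by this up to a sign. -/
structure RadialEigensystem where
  z : ℕ → ℝ
  e : ℕ → Plane → ℝ
  z_pos : ∀ n, 0 < z n
  z_strictMono : StrictMono z
  eigen : ∀ n, IsRadialDirichletEigenfunction (z n) (e n)
  normalized : ∀ n, ∫ x in unitDisc, (e n x) ^ 2 = 1
  exhaustive : ∀ (ζ : ℝ) (f : Plane → ℝ), 0 < ζ → IsRadialDirichletEigenfunction ζ f →
    ∃ n, z n = ζ

/-- The Hilbert space `L²(B; ℂ)`. -/
abbrev DiscL2 : Type := Lp ℂ 2 discMeasure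

instance : MeasurableSpace DiscL2 := borel DiscL2

instance : BorelSpace DiscL2 := ⟨rfl⟩

/-- The law of `X + i Y` with `X`, `Y` independent real centered Gaussians of variance `v`. -/
def complexGaussian (v : ℝ≥0) : Measure ℂ :=
  ((gaussianReal 0 v).prod (gaussianReal 0 v)).map (fun a : ℝ × ℝ => (⟨a.1, a.2⟩ : ℂ))

theorem measurable_complexMk : Measurable (fun a : ℝ × ℝ => (⟨a.1, a.2⟩ : ℂ)) :=
  Complex.measurableEquivRealProd.symm.measurable

instance (v : ℝ≥0) : IsProbabilityMeasure (complexGaussian v) :=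
  Measure.isProbabilityMeasure_map measurable_complexMk.aemeasurable

namespace RadialEigensystem

variable (S : RadialEigensystem)

theorem memLp_e (n : ℕ) : MemLp (fun x => (S.e n x : ℂ)) 2 discMeasure := by
  have hc : ContinuousOn (fun x => (S.e n x : ℂ)) (Metric.closedBall (0 : Plane) 1) :=
    Complex.continuous_ofReal.comp_continuousOn (S.eigen n).continuousOn
  obtain ⟨C, hC⟩ := (isCompact_closedBall (0 : Plane) 1).exists_bound_of_continuousOn hc
  have : IsFiniteMeasure discMeasure :=
    ⟨by rw [Measure.restrict_apply_univ]; exact measure_ball_lt_top⟩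
  refine MemLp.of_bound
    ((hc.mono Metric.ball_subset_closedBall).aestronglyMeasurable measurableSet_ball) C ?_
  exact (ae_restrict_iff' measurableSet_ball).2
    (Filter.Eventually.of_forall fun x hx => hC x (Metric.ball_subset_closedBall hx))

/-- The eigenfunction `e n` as an element of `L²(B; ℂ)`. -/
def eL2 (n : ℕ) : DiscL2 := (S.memLp_e n).toLp _

/-- The randomized function `φ = π⁻¹ ∑ₙ (gₙ / zₙ) eₙ`, the series being taken in `L²(B; ℂ)`. -/
def randomSeries (g : ℕ → ℂ) : DiscL2 :=
  ∑' n, (((1 / Real.pi : ℝ) : ℂ) * (g n / (S.z n : ℂ))) • S.eL2 n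

theorem measurable_randomSeries : Measurable S.randomSeries := by
  have : Fact ((2 : ℝ≥0∞) ≠ ∞) := ⟨by norm_num⟩
  unfold randomSeries
  refine Measurable.tsum fun n => ?_
  have h : Continuous fun c : ℂ => c • S.eL2 n := continuous_id.smul continuous_const
  exact h.measurable.comp (by fun_prop)

/-- The free measure `μ_F`: the law on `L²(B; ℂ)` of `φ = π⁻¹ ∑ₙ (gₙ / zₙ) eₙ`, where `(gₙ)` is a
sequence of independent complex Gaussians whose real and imaginary parts are independent, centered
and of variance `v`. -/
def freeMeasure (v : ℝ≥0) : Measure DiscL2 :=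
  (Measure.infinitePi fun _ : ℕ => complexGaussian v).map S.randomSeries

instance (v : ℝ≥0) : IsProbabilityMeasure (S.freeMeasure v) :=
  Measure.isProbabilityMeasure_map S.measurable_randomSeries.aemeasurable

/-- The Fourier coefficient `∫_B f eₙ dx`. -/
def coeff (f : Plane → ℂ) (n : ℕ) : ℂ := ∫ x in unitDisc, f x * (S.e n x : ℂ)

/-- The frequency truncation `P_N f = ∑_{zₙ ≤ N} f̂(n) eₙ` (a finite sum, since `zₙ → ∞`). -/
def trunc (N : ℕ) (f : Plane → ℂ) (x : Plane) : ℂ :=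
  ∑ᶠ (n : ℕ) (_ : S.z n ≤ (N : ℝ)), S.coeff f n * (S.e n x : ℂ)

/-- The operator `(√-Δ)^σ f = ∑ₙ zₙ^σ f̂(n) eₙ`. It is applied below only to functions in the range
of `P_N`, for which the sum is finite. -/
def fracLaplacian (σ : ℝ) (f : Plane → ℂ) (x : Plane) : ℂ :=
  ∑' n : ℕ, ((S.z n ^ σ : ℝ) : ℂ) * S.coeff f n * (S.e n x : ℂ)

/-- `u` is the global solution of the defocusing truncated equation
`i u_t + Δ u - P_N (|u|^α u) = 0`, `u(0) = P_N φ`, on the unit ball: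
at every time it lies in the span of the `eₙ` with `zₙ ≤ N` (so it satisfies the Dirichlet
condition), it is differentiable in time, and the equation holds at every point of the ball. -/
structure IsTruncatedSolution (α N : ℕ) (φ : Plane → ℂ) (u : ℝ → Plane → ℂ) : Prop where
  mem_span : ∀ t : ℝ, ∃ a : ℕ → ℂ, ∀ x ∈ unitDisc,
    u t x = ∑ᶠ (n : ℕ) (_ : S.z n ≤ (N : ℝ)), a n * (S.e n x : ℂ)
  differentiable : ∀ x ∈ unitDisc, Differentiable ℝ (fun t => u t x)
  equation : ∀ t : ℝ, ∀ x ∈ unitDisc,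
    Complex.I * deriv (fun s => u s x) t + Laplacian.laplacian (u t) x
      - S.trunc N (fun y => ((‖u t y‖ ^ α : ℝ) : ℂ) * u t y) x = 0
  initial : ∀ x ∈ unitDisc, u 0 x = S.trunc N φ x

end RadialEigensystem

/-- The mixed norm `‖F‖_{L^p_x L^q_t}` over `x ∈ B`, `t ∈ [0, T)`, with values in `[0, ∞]`
(the norm in `t` is taken first). -/
def mixedNorm (p q : ℝ≥0∞) (T : ℝ) (F : ℝ → Plane → ℂ) : ℝ≥0∞ :=
  eLpNorm (fun x => eLpNorm (fun t => F t x) q (volume.restrict (Ico 0 T))) p discMeasure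

end

/-! The truncated flow preserves a finite-dimensional Gibbs measure. The law of the solution at a
fixed time is therefore controlled by the Gaussian law of the data, and only a Gaussian moment
estimate at a single point (t, x) is left.

In the coefficients of `modes N` the equation is a Hamiltonian ODE on a space `ℂⁿ` that conserves
mass and energy. Its field is divergence free, so the flow does not increase Lebesgue measure
(`setLIntegral_flow_le`, `lintegral_flow_le`). The coefficients of φ have a density proportional to
exp(-(π²/v) · kinetic energy) (`prod_complexGaussianPDF`). The extra factor exp(-(π²/v) V), with V
the potential energy, makes this a function of the conserved energy. As this factor is at most 1,
the mean of a nonnegative f(u(t)) under the weighted law is at most the mean of f under the free law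
(`lintegral_flow_gibbsWeight_le`).

Under the free law (√-Δ)^σ φ(x) is Gaussian with variance of order ∑ zₙ^(2σ-2) eₙ(x)². The bound eₙ²
≲ zₙ^(1-θ)|x|^(-θ) and the linear growth of zₙ make this ≲ |x|^(-θ) as soon as θ > 2σ
(`exists_sum_fracMode_sq_le`), while |x|^(-θ/2) lies in L^p(B) when θp < 4. Such a θ in [0, 1]
exists because σ < 1/2 and pσ < 2. Factorial growth of the moments then gives an exponential tail of
the mixed norm under the weighted law (`exists_tail_fracField`).

The same estimate with σ = 0 and frozen time gives V a stretched exponential tail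
(`coeffLaw_lt_discPotential_le`). Undoing the weight costs at most e^K where (π²/v)V ≤ K. With K a
small multiple of λ this is absorbed by the exponential tail, and the complement is paid for by the
tail of V (`exists_tail_flow`). Integrating the tail bounds the expectation.

The facts needed about eigenfunctions (they are multiples of J₀(zₙ|x|), the size of J₀,
nondegeneracy and separation of its zeros) all come from monotone energies of Bessel's equation. -/

noncomputable section

/-! ### The Bessel function of order zero -/

/-- The Bessel function `J₀`, by its integral representation. -/
def besselJ (s : ℝ) : ℝ := Real.pi⁻¹ * ∫ θ in (0 : ℝ)..Real.pi, Real.cos (s * Real.sin θ)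

/-- The derivative of the Bessel function `J₀`. -/
def besselD (s : ℝ) : ℝ :=
  Real.pi⁻¹ * ∫ θ in (0 : ℝ)..Real.pi, -(Real.sin θ * Real.sin (s * Real.sin θ))

theorem hasDerivAt_integral_param {F F' : ℝ → ℝ → ℝ} {a b M : ℝ}
    (hF : ∀ s, Continuous (F s)) (hF' : ∀ s, Continuous (F' s))
    (hd : ∀ s θ, HasDerivAt (fun s => F s θ) (F' s θ) s) (hM : ∀ s θ, |F' s θ| ≤ M) (s : ℝ) :
    HasDerivAt (fun s => ∫ θ in a..b, F s θ) (∫ θ in a..b, F' s θ) s := by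
  refine (intervalIntegral.hasDerivAt_integral_of_dominated_loc_of_deriv_le
    (F := F) (F' := F') (x₀ := s) (s := Set.univ) (bound := fun _ => M) Filter.univ_mem ?_ ?_ ?_ ?_ ?_ ?_).2
  · exact Filter.Eventually.of_forall fun s => (hF s).aestronglyMeasurable
  · exact (hF s).intervalIntegrable _ _
  · exact (hF' s).aestronglyMeasurable
  · exact Filter.Eventually.of_forall fun θ _ s _ => hM s θ
  · exact intervalIntegrable_const
  · exact Filter.Eventually.of_forall fun θ _ s _ => hd s θ

theorem hasDerivAt_besselJ (s : ℝ) : HasDerivAt besselJ (besselD s) s := by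
  refine (hasDerivAt_integral_param (M := 1) (F := fun s θ => Real.cos (s * Real.sin θ))
    (F' := fun s θ => -(Real.sin θ * Real.sin (s * Real.sin θ)))
    (fun s => by fun_prop) (fun s => by fun_prop) (fun s θ => ?_) (fun s θ => ?_) s).const_mul _
  · have := ((hasDerivAt_id s).mul_const (Real.sin θ)).cos
    exact this.congr_deriv (by simp; try ring)
  · rw [abs_neg, abs_mul]
    exact mul_le_one₀ (Real.abs_sin_le_one _) (abs_nonneg _) (Real.abs_sin_le_one _)

/-- This is Bessel's equation J'' = -J'/s - J. Differentiating under the integral produces sin²θ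
cos(s sin θ); an integration by parts in θ relates its complement cos²θ cos(s sin θ) to J'. -/
theorem hasDerivAt_besselD {s : ℝ} (hs : s ≠ 0) :
    HasDerivAt besselD (-besselD s / s - besselJ s) s := by
  have h := (hasDerivAt_integral_param (a := 0) (b := Real.pi) (M := 1)
    (F := fun s θ => -(Real.sin θ * Real.sin (s * Real.sin θ)))
    (F' := fun s θ => -(Real.sin θ ^ 2 * Real.cos (s * Real.sin θ)))
    (fun s => by fun_prop) (fun s => by fun_prop) (fun s θ => ?_) (fun s θ => ?_) s).const_mul
      Real.pi⁻¹
  · refine h.congr_deriv ?_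
    -- The integrand is the θ-derivative of cos θ sin(s sin θ), which vanishes at both endpoints.
    have hI : ∫ θ in (0 : ℝ)..Real.pi, (s * (Real.cos θ ^ 2 * Real.cos (s * Real.sin θ))
        - Real.sin θ * Real.sin (s * Real.sin θ)) = 0 := by
      rw [intervalIntegral.integral_eq_sub_of_hasDerivAt
        (f := fun θ => Real.cos θ * Real.sin (s * Real.sin θ))]
      · simp
      · intro θ _
        have := (Real.hasDerivAt_cos θ).mul (((Real.hasDerivAt_sin θ).const_mul s).sin)
        exact this.congr_deriv (by ring)
      · exact Continuous.intervalIntegrable (by fun_prop) _ _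
    rw [intervalIntegral.integral_sub (Continuous.intervalIntegrable (by fun_prop) _ _)
      (Continuous.intervalIntegrable (by fun_prop) _ _), intervalIntegral.integral_const_mul] at hI
    have hc : ∫ θ in (0 : ℝ)..Real.pi, Real.cos θ ^ 2 * Real.cos (s * Real.sin θ) =
        (∫ θ in (0 : ℝ)..Real.pi, Real.cos (s * Real.sin θ)) +
          ∫ θ in (0 : ℝ)..Real.pi, -(Real.sin θ ^ 2 * Real.cos (s * Real.sin θ)) := by
      rw [← intervalIntegral.integral_add (Continuous.intervalIntegrable (by fun_prop) _ _)
        (Continuous.intervalIntegrable (by fun_prop) _ _)]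
      congr 1; ext θ; rw [Real.cos_sq']; ring
    unfold besselD besselJ
    rw [intervalIntegral.integral_neg (f := fun θ => Real.sin θ * Real.sin (s * Real.sin θ))]
    generalize (∫ θ in (0 : ℝ)..Real.pi, Real.cos θ ^ 2 * Real.cos (s * Real.sin θ)) = d at hI hc
    generalize (∫ θ in (0 : ℝ)..Real.pi, Real.cos (s * Real.sin θ)) = b at hc ⊢
    generalize (∫ θ in (0 : ℝ)..Real.pi, -(Real.sin θ ^ 2 * Real.cos (s * Real.sin θ))) = c
      at hc ⊢
    generalize (∫ θ in (0 : ℝ)..Real.pi, Real.sin θ * Real.sin (s * Real.sin θ)) = a at hI ⊢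
    field_simp
    linear_combination hI - s * hc
  · have := (((hasDerivAt_id s).mul_const (Real.sin θ)).sin.const_mul (Real.sin θ)).neg
    exact this.congr_deriv (by simp; try ring)
  · rw [abs_neg, abs_mul, abs_pow]
    exact mul_le_one₀ (pow_le_one₀ (abs_nonneg _) (Real.abs_sin_le_one _)) (abs_nonneg _)
      (Real.abs_cos_le_one _)

theorem besselJ_zero : besselJ 0 = 1 := by
  simp [besselJ, Real.pi_ne_zero]

theorem besselD_zero : besselD 0 = 0 := by simp [besselD]

theorem continuous_besselJ : Continuous besselJ :=
  continuous_iff_continuousAt.2 fun s => (hasDerivAt_besselJ s).continuousAt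

theorem continuous_besselD : Continuous besselD := by
  refine continuous_iff_continuousAt.2 fun s => ?_
  refine ((hasDerivAt_integral_param (M := 1)
    (F := fun s θ => -(Real.sin θ * Real.sin (s * Real.sin θ)))
    (F' := fun s θ => -(Real.sin θ ^ 2 * Real.cos (s * Real.sin θ)))
    (fun s => by fun_prop) (fun s => by fun_prop) (fun s θ => ?_) (fun s θ => ?_) s).const_mul
      Real.pi⁻¹).continuousAt
  · have := (((hasDerivAt_id s).mul_const (Real.sin θ)).sin.const_mul (Real.sin θ)).neg
    exact this.congr_deriv (by simp; try ring)
  · rw [abs_neg, abs_mul, abs_pow]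
    exact mul_le_one₀ (pow_le_one₀ (abs_nonneg _) (Real.abs_sin_le_one _)) (abs_nonneg _)
      (Real.abs_cos_le_one _)

/-- On this range s sin θ stays in [0, 1], where the cosine is positive. Hence every positive zero
exceeds 1, and the energy estimates below may start at s = 1. -/
theorem besselJ_pos {s : ℝ} (hs0 : 0 ≤ s) (hs1 : s ≤ 1) : 0 < besselJ s := by
  unfold besselJ
  refine mul_pos (inv_pos.2 Real.pi_pos) ?_
  refine intervalIntegral.intervalIntegral_pos_of_pos_on
    (Continuous.intervalIntegrable (by fun_prop) _ _) (fun θ hθ => ?_) Real.pi_pos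
  have h0 := Real.sin_nonneg_of_nonneg_of_le_pi hθ.1.le hθ.2.le
  have h1 := Real.sin_le_one θ
  apply Real.cos_pos_of_mem_Ioo
  constructor <;> nlinarith [Real.pi_gt_three]

/-- The energy `J² + J'²` of the Bessel equation decreases. -/
theorem antitoneOn_bessel_energy :
    AntitoneOn (fun s => besselJ s ^ 2 + besselD s ^ 2) (Ici 0) := by
  refine antitoneOn_of_hasDerivWithinAt_nonpos (f' := fun s => -2 * besselD s ^ 2 / s)
    (convex_Ici 0)
    ((continuous_besselJ.pow 2).add (continuous_besselD.pow 2)).continuousOn ?_ ?_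
  · intro s hs
    rw [interior_Ici, mem_Ioi] at hs
    have := ((hasDerivAt_besselJ s).pow 2).add ((hasDerivAt_besselD hs.ne').pow 2)
    refine (HasDerivAt.congr_deriv this ?_).hasDerivWithinAt
    field_simp; push_cast; ring
  · intro s hs
    rw [interior_Ici, mem_Ioi] at hs
    have : 0 ≤ besselD s ^ 2 / s := by positivity
    rw [mul_div_assoc]; linarith

theorem bessel_energy_le_one {s : ℝ} (hs : 0 ≤ s) : besselJ s ^ 2 + besselD s ^ 2 ≤ 1 := by
  have := antitoneOn_bessel_energy (mem_Ici.2 le_rfl) (mem_Ici.2 hs) hs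
  simpa [besselJ_zero, besselD_zero] using this

theorem besselJ_sq_le_one {s : ℝ} (hs : 0 ≤ s) : besselJ s ^ 2 ≤ 1 := by
  nlinarith [bessel_energy_le_one hs, sq_nonneg (besselD s)]

/-- `J₀(s)² = O(1/s)`, by monotonicity of the energy of `√s J₀(s)`. -/
theorem mul_besselJ_sq_le {s : ℝ} (hs : 0 ≤ s) : s * besselJ s ^ 2 ≤ 3 := by
  rcases le_total s 1 with h1 | h1
  · nlinarith [besselJ_sq_le_one hs]
  -- For w = √s J the equation reads w'' + (1 + 1/(4s²)) w = 0. The quantity is w'² + (1 + 1/(4s²))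
  -- w², which decreases because the coefficient does; its derivative is -w²/(2s³).
  have hanti : AntitoneOn (fun s => s * besselD s ^ 2 + besselD s * besselJ s
      + besselJ s ^ 2 / (2 * s) + s * besselJ s ^ 2) (Ici 1) := by
    refine antitoneOn_of_hasDerivWithinAt_nonpos (f' := fun s => -besselJ s ^ 2 / (2 * s ^ 2))
      (convex_Ici 1) ?_ ?_ ?_
    · refine ContinuousOn.add (ContinuousOn.add (Continuous.continuousOn ?_) ?_)
        (Continuous.continuousOn ?_)
      · exact (continuous_id.mul (continuous_besselD.pow 2)).add
          (continuous_besselD.mul continuous_besselJ)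
      · refine (continuous_besselJ.pow 2).continuousOn.div (by fun_prop) fun x hx => ?_
        have : (1 : ℝ) ≤ x := hx
        positivity
      · exact continuous_id.mul (continuous_besselJ.pow 2)
    · intro s hs
      rw [interior_Ici, mem_Ioi] at hs
      have h0 : s ≠ 0 := by positivity
      have hJ := hasDerivAt_besselJ s
      have hD := hasDerivAt_besselD h0
      have := ((((hasDerivAt_id s).mul (hD.pow 2)).add (hD.mul hJ)).add
        ((hJ.pow 2).div ((hasDerivAt_id s).const_mul 2) (by simpa using h0))).add
        ((hasDerivAt_id s).mul (hJ.pow 2))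
      refine (HasDerivAt.congr_deriv this ?_).hasDerivWithinAt
      simp only [id, Pi.pow_apply]
      field_simp; push_cast; ring
    · intro s _
      have : 0 ≤ besselJ s ^ 2 / (2 * s ^ 2) := by positivity
      rw [neg_div]; linarith
  have h := hanti (mem_Ici.2 le_rfl) (mem_Ici.2 h1) h1
  simp only [one_mul, mul_one] at h
  have hE := bessel_energy_le_one (zero_le_one' ℝ)
  -- All of the energy except s J² is nonnegative, by completing the square, so s J² is bounded by
  -- the energy at 1.
  have hpos : 0 ≤ s * besselD s ^ 2 + besselD s * besselJ s + besselJ s ^ 2 / (2 * s) := by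
    have : s * besselD s ^ 2 + besselD s * besselJ s + besselJ s ^ 2 / (2 * s) =
      s * (besselD s + besselJ s / (2 * s)) ^ 2 + besselJ s ^ 2 / (4 * s) := by
      field_simp; ring
    rw [this]; positivity
  nlinarith [sq_nonneg (besselJ 1 - besselD 1)]

/-- At the zeros of `J₀` the derivative is not smaller than `c / √s`. -/
theorem exists_le_mul_besselD_sq :
    ∃ c : ℝ, 0 < c ∧ ∀ s : ℝ, 1 ≤ s → besselJ s = 0 → c ≤ s * besselD s ^ 2 := by
  -- Again w = √s J. Here w'² + w² has derivative -w w'/(2s²) ≥ -(w² + w'²)/(4s²), and the factor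
  -- exp(-1/(4s)) compensates exactly: the derivative of the product is (w' - w)²/(4s²) times that
  -- factor.
  have hmono : MonotoneOn (fun s => (s * besselD s ^ 2 + besselD s * besselJ s
      + besselJ s ^ 2 / (4 * s) + s * besselJ s ^ 2) * Real.exp (-(1 / (4 * s)))) (Ici 1) := by
    refine monotoneOn_of_hasDerivWithinAt_nonneg
      (f' := fun s => (s / (4 * s ^ 2)) * ((besselD s - besselJ s + besselJ s / (2 * s)) ^ 2)
        * Real.exp (-(1 / (4 * s))))
      (convex_Ici 1) ?_ ?_ ?_
    · refine ContinuousOn.mul (ContinuousOn.add (ContinuousOn.add (Continuous.continuousOn ?_) ?_)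
        (Continuous.continuousOn ?_)) ?_
      · exact (continuous_id.mul (continuous_besselD.pow 2)).add
          (continuous_besselD.mul continuous_besselJ)
      · refine (continuous_besselJ.pow 2).continuousOn.div (by fun_prop) fun x hx => ?_
        have : (1 : ℝ) ≤ x := hx
        positivity
      · exact continuous_id.mul (continuous_besselJ.pow 2)
      · refine (ContinuousOn.neg (continuousOn_const.div (by fun_prop) fun x hx => ?_)).rexp
        have : (1 : ℝ) ≤ x := hx
        positivity
    · intro s hs
      rw [interior_Ici, mem_Ioi] at hs
      have h0 : s ≠ 0 := by positivity
      have hJ := hasDerivAt_besselJ s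
      have hD := hasDerivAt_besselD h0
      have := (((((hasDerivAt_id s).mul (hD.pow 2)).add (hD.mul hJ)).add
        ((hJ.pow 2).div ((hasDerivAt_id s).const_mul 4) (by simpa using h0))).add
        ((hasDerivAt_id s).mul (hJ.pow 2))).mul
        (((hasDerivAt_const s 1).div ((hasDerivAt_id s).const_mul 4) (by simpa using h0)).neg.exp)
      refine (HasDerivAt.congr_deriv this ?_).hasDerivWithinAt
      simp only [id, Pi.pow_apply, Pi.add_apply, Pi.mul_apply, Pi.div_apply, Pi.neg_apply, mul_one]
      generalize Real.exp (-(1 / (4 * s))) = A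
      field_simp; push_cast; ring
    · intro s hs
      rw [interior_Ici, mem_Ioi] at hs
      positivity
  -- The constant is a lower bound of the increasing quantity at s = 1, after dropping the square
  -- (J'(1) + J(1)/2)². At a zero of J the quantity reduces to at most s J'(s)².
  refine ⟨besselJ 1 ^ 2 * Real.exp (-(1 / 4)),
    by have := besselJ_pos zero_le_one le_rfl; positivity, fun s hs h0 => ?_⟩
  have h := hmono (mem_Ici.2 le_rfl) (mem_Ici.2 hs) hs
  simp only [h0, one_mul, mul_one] at h
  have hexp : Real.exp (-(1 / (4 * s))) ≤ 1 := by
    rw [Real.exp_le_one_iff]; have : 0 ≤ 1 / (4 * s) := by positivity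
    linarith
  have hq : besselJ 1 ^ 2 ≤ besselD 1 ^ 2 + besselD 1 * besselJ 1 + besselJ 1 ^ 2 / 4
      + besselJ 1 ^ 2 := by nlinarith [sq_nonneg (besselD 1 + besselJ 1 / 2)]
  have hs' : 0 ≤ s * besselD s ^ 2 := by positivity
  calc _ ≤ _ := mul_le_mul_of_nonneg_right hq (Real.exp_pos _).le
    _ ≤ _ := h
    _ ≤ s * besselD s ^ 2 := by
      have := mul_le_mul_of_nonneg_left hexp hs'
      simpa using this

/-- Distinct zeros of `J₀` are at distance at least `1/2`. -/
theorem half_le_sub_of_besselJ_eq_zero {a b : ℝ} (ha : 1 ≤ a) (hab : a < b)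
    (hJa : besselJ a = 0) (hJb : besselJ b = 0) : 1 / 2 ≤ b - a := by
  obtain ⟨c, hc, hcD⟩ := exists_le_mul_besselD_sq
  have hDa : besselD a ≠ 0 := by
    intro h; have := hcD a ha hJa; rw [h] at this; simp at this; linarith
  obtain ⟨m, hm, hDm⟩ := exists_hasDerivAt_eq_zero hab continuous_besselJ.continuousOn
    (hJa.trans hJb.symm) fun x _ => hasDerivAt_besselJ x
  -- Rolle's theorem gave a zero m of J' between a and b. Past a the energy is at most J'(a)², so
  -- |J''| ≤ 2|J'(a)| there, and J' needs length at least 1/2 to fall from J'(a) to 0.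
  have hE : ∀ s, a ≤ s → besselJ s ^ 2 + besselD s ^ 2 ≤ besselD a ^ 2 := fun s hs => by
    have := antitoneOn_bessel_energy (mem_Ici.2 (by linarith : (0 : ℝ) ≤ a))
      (mem_Ici.2 (by linarith : (0 : ℝ) ≤ s)) hs
    simpa [hJa] using this
  have hb := Convex.norm_image_sub_le_of_norm_hasDerivWithin_le (f := besselD)
    (f' := fun s => -besselD s / s - besselJ s) (s := Icc a m) (x := m) (y := a)
    (C := 2 * |besselD a|) (fun s hs => (hasDerivAt_besselD (by linarith [hs.1])).hasDerivWithinAt)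
    (fun s hs => ?_) (convex_Icc a m) ⟨hm.1.le, le_rfl⟩ ⟨le_rfl, hm.1.le⟩
  · rw [hDm, sub_zero, Real.norm_eq_abs, Real.norm_eq_abs, abs_sub_comm, abs_of_pos (sub_pos.2 hm.1)] at hb
    have : 0 < |besselD a| := abs_pos.2 hDa
    have h2 : 1 ≤ 2 * (m - a) := by
      by_contra hlt
      push Not at hlt
      nlinarith
    linarith [hm.2]
  · have h := hE s hs.1
    have hs1 : 1 ≤ s := ha.trans hs.1
    have h1 : |besselJ s| ≤ |besselD a| := sq_le_sq.1 (by nlinarith [sq_nonneg (besselD s)])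
    have h2 : |besselD s| ≤ |besselD a| := sq_le_sq.1 (by nlinarith [sq_nonneg (besselJ s)])
    rw [Real.norm_eq_abs]
    calc _ ≤ |-besselD s / s| + |besselJ s| := abs_sub _ _
      _ ≤ |besselD s| + |besselJ s| := by
        refine add_le_add_left ?_ _
        rw [abs_div, abs_neg, abs_of_pos (by linarith : 0 < s)]
        exact div_le_self (abs_nonneg _) hs1
      _ ≤ _ := by linarith

/-- The normalization integral of the radial eigenfunctions. -/
theorem integral_besselJ_sq {z : ℝ} (hz : 0 < z) (h0 : besselJ z = 0) :
    ∫ r in (0 : ℝ)..1, r * besselJ (z * r) ^ 2 = besselD z ^ 2 / 2 := by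
  have hJ : ∀ r : ℝ, HasDerivAt (fun r => besselJ (z * r)) (besselD (z * r) * z) r := fun r => by
    exact ((hasDerivAt_besselJ (z * r)).comp r ((hasDerivAt_id r).const_mul z)).congr_deriv (by simp)
  have hD : ∀ r : ℝ, 0 < r → HasDerivAt (fun r => besselD (z * r))
      ((-besselD (z * r) / (z * r) - besselJ (z * r)) * z) r := fun r hr => by
    exact ((hasDerivAt_besselD (s := z * r) (by positivity)).comp r
      ((hasDerivAt_id r).const_mul z)).congr_deriv (by simp)
  -- The primitive is r²(J² + J'²)/2 at zr: in its derivative the damping term of the equation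
  -- cancels the contribution r J'².
  rw [intervalIntegral.integral_eq_sub_of_hasDerivAt_of_le
    (f := fun r => r ^ 2 * (besselJ (z * r) ^ 2 + besselD (z * r) ^ 2) / 2) zero_le_one]
  · simp [h0]
  · exact ((continuous_pow 2).mul (((continuous_besselJ.comp (continuous_const_mul z)).pow 2).add
      ((continuous_besselD.comp (continuous_const_mul z)).pow 2)) |>.div_const 2).continuousOn
  · intro r hr
    have hr0 : r ≠ 0 := hr.1.ne'
    have := (((hasDerivAt_id r).pow 2).mul (((hJ r).pow 2).add ((hD r hr.1).pow 2))).div_const 2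
    refine HasDerivAt.congr_deriv this ?_
    simp only [id, Pi.pow_apply, Pi.add_apply]
    field_simp; push_cast; ring
  · exact (continuous_id.mul ((continuous_besselJ.comp (continuous_const_mul z)).pow 2)).intervalIntegrable _ _

/-- Orthogonality of the radial eigenfunctions with respect to `r dr`. -/
theorem integral_besselJ_mul_besselJ {z w : ℝ} (hz : 0 < z) (hw : 0 < w) (hne : z ≠ w)
    (hz0 : besselJ z = 0) (hw0 : besselJ w = 0) :
    ∫ r in (0 : ℝ)..1, r * (besselJ (z * r) * besselJ (w * r)) = 0 := by
  have hJ : ∀ (z : ℝ) (r : ℝ), HasDerivAt (fun r => besselJ (z * r)) (besselD (z * r) * z) r :=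
    fun z r => by
      exact ((hasDerivAt_besselJ (z * r)).comp r ((hasDerivAt_id r).const_mul z)).congr_deriv (by simp)
  have hD : ∀ (z : ℝ) (r : ℝ), 0 < z → 0 < r → HasDerivAt (fun r => besselD (z * r))
      ((-besselD (z * r) / (z * r) - besselJ (z * r)) * z) r := fun z r hz hr => by
    exact ((hasDerivAt_besselD (s := z * r) (by positivity)).comp r
      ((hasDerivAt_id r).const_mul z)).congr_deriv (by simp)
  have hc : ∀ z : ℝ, Continuous fun r => besselJ (z * r) := fun z =>
    continuous_besselJ.comp (continuous_const_mul z)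
  have hcD : ∀ z : ℝ, Continuous fun r => besselD (z * r) := fun z =>
    continuous_besselD.comp (continuous_const_mul z)
  have hne' : w ^ 2 - z ^ 2 ≠ 0 := by
    rw [sq_sub_sq]; exact mul_ne_zero (by positivity) (sub_ne_zero.2 hne.symm)
  -- The primitive is r times the Wronskian of the two solutions, divided by w² - z²; it vanishes at
  -- r = 0, and at r = 1 since z and w are zeros.
  rw [intervalIntegral.integral_eq_sub_of_hasDerivAt_of_le
    (f := fun r => r * (z * besselD (z * r) * besselJ (w * r)
      - w * besselD (w * r) * besselJ (z * r)) / (w ^ 2 - z ^ 2)) zero_le_one]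
  · simp [hz0, hw0]
  · refine Continuous.continuousOn ?_
    have := hc z; have := hc w; have := hcD z; have := hcD w
    fun_prop
  · intro r hr
    have hr0 : r ≠ 0 := hr.1.ne'
    have := ((hasDerivAt_id r).mul ((((hD z r hz hr.1).const_mul z).mul (hJ w r)).sub
      (((hD w r hw hr.1).const_mul w).mul (hJ z r)))).div_const (w ^ 2 - z ^ 2)
    refine HasDerivAt.congr_deriv this ?_
    simp only [id, Pi.sub_apply, Pi.mul_apply]
    field_simp; ring
  · exact (continuous_id.mul ((hc z).mul (hc w))).intervalIntegrable _ _

end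

noncomputable section

/-! ### Radial eigenfunctions are Bessel functions -/

/-- The second derivative in a direction is the second derivative along a line. -/
theorem iteratedFDeriv_two_eq_of_line {E : Type*} [NormedAddCommGroup E] [NormedSpace ℝ E]
    {f : E → ℝ} {x v : E} (hf : ContDiffAt ℝ 2 f x) {g : ℝ → ℝ} {d : ℝ}
    (hg : ∀ᶠ t in nhds (0 : ℝ), HasDerivAt (fun t => f (x + t • v)) (g t) t)
    (hd : HasDerivAt g d 0) : iteratedFDeriv ℝ 2 f x ![v, v] = d := by
  have hline : ∀ t : ℝ, HasDerivAt (fun t : ℝ => x + t • v) v t := fun t => by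
    have := ((hasDerivAt_id t).smul_const v).const_add x
    exact this.congr_deriv (by simp)
  have hx0 : x + (0 : ℝ) • v = x := by simp
  have hcont : Filter.Tendsto (fun t : ℝ => x + t • v) (nhds 0) (nhds x) := by
    have := (hline 0).continuousAt.tendsto
    rwa [hx0] at this
  have hev : ∀ᶠ t in nhds (0 : ℝ), g t = fderiv ℝ f (x + t • v) v := by
    have h1 : ∀ᶠ y in nhds x, DifferentiableAt ℝ f y := by
      filter_upwards [hf.eventually (by simp)] with y hy
      exact hy.differentiableAt (by norm_num)
    filter_upwards [hg, hcont.eventually h1] with t ht hdt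
    exact ht.unique (hdt.hasFDerivAt.comp_hasDerivAt t (hline t))
  have h2 : DifferentiableAt ℝ (fderiv ℝ f) x :=
    (hf.fderiv_right (m := 1) (by norm_num)).differentiableAt (by norm_num)
  have h3 : HasDerivAt (fun t : ℝ => fderiv ℝ f (x + t • v) v) (fderiv ℝ (fderiv ℝ f) x v v) 0 := by
    have h4 : HasFDerivAt (fderiv ℝ f) (fderiv ℝ (fderiv ℝ f) x) (x + (0 : ℝ) • v) := by
      rw [hx0]; exact h2.hasFDerivAt
    exact ((ContinuousLinearMap.apply ℝ ℝ v).hasFDerivAt.comp_hasDerivAt 0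
      (h4.comp_hasDerivAt 0 (hline 0)))
  rw [iteratedFDeriv_two_apply]
  exact ((h3.congr_of_eventuallyEq hev).unique hd)

theorem norm_smul_basis (r : ℝ) : ‖r • (EuclideanSpace.single 0 1 : Plane)‖ = |r| := by
  simp [norm_smul]

theorem norm_add_smul_basis (r t : ℝ) :
    ‖r • (EuclideanSpace.single 0 1 : Plane) + t • (EuclideanSpace.single 1 1 : Plane)‖ =
      √(r ^ 2 + t ^ 2) := by
  rw [EuclideanSpace.norm_eq]
  simp [Fin.sum_univ_two]

/-- The derivatives of a radial function of class `C²` along a radius satisfy the radial form of the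
Laplace operator. -/
theorem laplacian_radial {f : Plane → ℝ} (hf : ContDiffOn ℝ 2 f unitDisc)
    (hrad : ∀ x ∈ Metric.closedBall (0 : Plane) 1, ∀ y ∈ Metric.closedBall (0 : Plane) 1,
      ‖x‖ = ‖y‖ → f x = f y) {h h1 : ℝ → ℝ} {d r : ℝ}
    (hh : ∀ r, h r = f (r • (EuclideanSpace.single 0 1 : Plane)))
    (hd1 : ∀ r ∈ Ioo (-1 : ℝ) 1, HasDerivAt h (h1 r) r)
    (hr : r ∈ Ioo (0 : ℝ) 1) (hd2 : HasDerivAt h1 d r) :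
    Laplacian.laplacian f (r • (EuclideanSpace.single 0 1 : Plane)) = d + h1 r / r := by
  have hmem : r • (EuclideanSpace.single 0 1 : Plane) ∈ unitDisc := by
    rw [mem_ball_zero_iff, norm_smul_basis, abs_of_pos hr.1]; exact hr.2
  have hfx : ContDiffAt ℝ 2 f (r • (EuclideanSpace.single 0 1 : Plane)) :=
    hf.contDiffAt (Metric.isOpen_ball.mem_nhds hmem)
  rw [InnerProductSpace.laplacian_eq_iteratedFDeriv_orthonormalBasis f
    (EuclideanSpace.basisFun (Fin 2) ℝ)]
  simp only [Fin.sum_univ_two, EuclideanSpace.basisFun_apply]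
  congr 1
  · refine iteratedFDeriv_two_eq_of_line hfx (g := fun t => h1 (r + t)) ?_ ?_
    · have : ∀ᶠ t in nhds (0 : ℝ), r + t ∈ Ioo (-1 : ℝ) 1 := by
        have hc : ContinuousAt (fun t : ℝ => r + t) 0 := by fun_prop
        refine hc.eventually (Ioo_mem_nhds ?_ ?_)
        · simpa using by linarith [hr.1]
        · simpa using hr.2
      filter_upwards [this] with t ht
      have h2 := (hd1 (r + t) ht).comp_const_add r t
      refine h2.congr_of_eventuallyEq (Filter.Eventually.of_forall fun t => ?_)
      simp only [hh, add_smul]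
    · exact HasDerivAt.comp_const_add r 0 (by simpa using hd2)
  · have hs : ∀ t : ℝ, HasDerivAt (fun t : ℝ => √(r ^ 2 + t ^ 2)) (t / √(r ^ 2 + t ^ 2)) t := by
      intro t
      have hp : r ^ 2 + t ^ 2 ≠ 0 := by have := hr.1; positivity
      refine (((hasDerivAt_pow 2 t).const_add (r ^ 2)).sqrt hp).congr_deriv ?_
      field_simp; push_cast; ring
    have hs0 : √(r ^ 2 + 0 ^ 2) = r := by
      rw [zero_pow two_ne_zero, add_zero, Real.sqrt_sq hr.1.le]
    have hlt : ∀ᶠ t in nhds (0 : ℝ), √(r ^ 2 + t ^ 2) < 1 := by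
      refine (hs 0).continuousAt.eventually (gt_mem_nhds ?_)
      simpa only [hs0] using hr.2
    -- Along the tangential line the function is h(√(r² + t²)), whose derivative is t times a
    -- function continuous at t = 0 with value h'(r)/r. The difference quotient at 0 is that
    -- function itself, so no further derivative is needed.
    refine iteratedFDeriv_two_eq_of_line hfx
      (g := fun t => t * (h1 (√(r ^ 2 + t ^ 2)) / √(r ^ 2 + t ^ 2))) ?_ ?_
    · filter_upwards [eventually_eventually_nhds.2 hlt] with t ht
      have hmem' : √(r ^ 2 + t ^ 2) ∈ Ioo (-1 : ℝ) 1 :=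
        ⟨by linarith [Real.sqrt_nonneg (r ^ 2 + t ^ 2)], ht.self_of_nhds⟩
      have h2 := (hd1 _ hmem').comp t (hs t)
      refine (h2.congr_deriv (by ring)).congr_of_eventuallyEq ?_
      filter_upwards [ht] with t ht
      rw [Function.comp, hh]
      have e : ‖r • (EuclideanSpace.single 0 1 : Plane) + t • EuclideanSpace.single 1 1‖ =
        ‖√(r ^ 2 + t ^ 2) • (EuclideanSpace.single 0 1 : Plane)‖ := by
        rw [norm_add_smul_basis, norm_smul_basis, abs_of_nonneg (Real.sqrt_nonneg _)]
      refine hrad _ ?_ _ ?_ e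
      · rw [mem_closedBall_zero_iff, norm_add_smul_basis]; exact ht.le
      · rw [mem_closedBall_zero_iff, ← e, norm_add_smul_basis]; exact ht.le
    · have hc : ContinuousAt (fun t => h1 (√(r ^ 2 + t ^ 2)) / √(r ^ 2 + t ^ 2)) 0 := by
        refine ContinuousAt.div ?_ (hs 0).continuousAt (by rw [hs0]; exact hr.1.ne')
        refine ContinuousAt.comp (g := h1) ?_ (hs 0).continuousAt
        rw [hs0]; exact hd2.continuousAt
      rw [hasDerivAt_iff_tendsto_slope]
      have ht := hc.tendsto
      simp only [hs0] at ht
      refine (ht.mono_left nhdsWithin_le_nhds).congr' ?_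
      filter_upwards [self_mem_nhdsWithin] with t ht
      have : t ≠ 0 := ht
      rw [slope_def_field]; field_simp; simp [mul_comm]

namespace IsRadialDirichletEigenfunction

variable {ζ : ℝ} {f : Plane → ℝ}

/-- Along a radius f solves the same singular ODE as J₀(ζr), with zero slope at the origin. The
difference D with f(0)J₀(ζr) has zero initial data, and D'² + ζ²D² is nonincreasing because the
singular term is a damping; hence D vanishes on [0, 1), and at r = 1 by continuity. -/
theorem eq_mul_besselJ (hf : IsRadialDirichletEigenfunction ζ f) (hζ : 0 < ζ) {x : Plane}
    (hx : x ∈ Metric.closedBall (0 : Plane) 1) : f x = f 0 * besselJ (ζ * ‖x‖) := by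
  set e : Plane := EuclideanSpace.single 0 1 with he
  set h : ℝ → ℝ := fun r => f (r • e) with hdef
  have hball : ∀ r ∈ Ioo (-1 : ℝ) 1, r • e ∈ unitDisc := fun r hr => by
    rw [mem_ball_zero_iff, norm_smul_basis]; exact abs_lt.2 hr
  have hcd : ContDiffOn ℝ 2 h (Ioo (-1) 1) :=
    hf.contDiffOn.comp (by fun_prop) hball
  have hd1 : ∀ r ∈ Ioo (-1 : ℝ) 1, HasDerivAt h (deriv h r) r := fun r hr =>
    ((hcd.contDiffAt (isOpen_Ioo.mem_nhds hr)).differentiableAt (by norm_num)).hasDerivAt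
  have hcd1 : ContDiffOn ℝ 1 (deriv h) (Ioo (-1) 1) :=
    hcd.deriv_of_isOpen isOpen_Ioo (by norm_num)
  have hd2 : ∀ r ∈ Ioo (-1 : ℝ) 1, HasDerivAt (deriv h) (deriv (deriv h) r) r := fun r hr =>
    ((hcd1.contDiffAt (isOpen_Ioo.mem_nhds hr)).differentiableAt (by norm_num)).hasDerivAt
  have hode : ∀ r ∈ Ioo (0 : ℝ) 1, deriv (deriv h) r = -deriv h r / r - ζ ^ 2 * h r := by
    intro r hr
    have hr' : r ∈ Ioo (-1 : ℝ) 1 := ⟨by linarith [hr.1], hr.2⟩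
    have h1 := laplacian_radial hf.contDiffOn hf.radial (fun r => rfl) hd1 hr (hd2 r hr')
    have h2 := hf.equation _ (hball r hr')
    rw [h1] at h2
    simp only [hdef] at h2 ⊢
    linear_combination -h2
  have h10 : deriv h 0 = 0 := by
    have h0 := hd1 0 (by simp)
    -- Radial symmetry makes the profile even across the origin, so its derivative there is its own
    -- negative.
    have hneg : HasDerivAt (fun r => h (-r)) (-deriv h 0) 0 := by
      have : HasDerivAt h (deriv h 0) (-0) := by simpa using h0
      exact (this.comp 0 (hasDerivAt_neg 0)).congr_deriv (by ring)
    have hev : (fun r => h (-r)) =ᶠ[nhds 0] h := by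
      filter_upwards [Ioo_mem_nhds (neg_one_lt_zero : (-1 : ℝ) < 0) zero_lt_one] with r hr
      have hr' : -r ∈ Ioo (-1 : ℝ) 1 := ⟨by linarith [hr.2], by linarith [hr.1]⟩
      refine hf.radial _ (Metric.ball_subset_closedBall (hball _ hr')) _
        (Metric.ball_subset_closedBall (hball r hr)) (by simp)
    linarith [(hneg.congr_of_eventuallyEq hev.symm).unique h0]
  have hJ : ∀ r : ℝ, HasDerivAt (fun r => besselJ (ζ * r)) (besselD (ζ * r) * ζ) r := fun r =>
    ((hasDerivAt_besselJ (ζ * r)).comp r ((hasDerivAt_id r).const_mul ζ)).congr_deriv (by simp)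
  have hD : ∀ r : ℝ, 0 < r → HasDerivAt (fun r => besselD (ζ * r))
      ((-besselD (ζ * r) / (ζ * r) - besselJ (ζ * r)) * ζ) r := fun r hr =>
    ((hasDerivAt_besselD (s := ζ * r) (by positivity)).comp r
      ((hasDerivAt_id r).const_mul ζ)).congr_deriv (by simp)
  set D : ℝ → ℝ := fun r => h r - h 0 * besselJ (ζ * r) with hDdef
  set D1 : ℝ → ℝ := fun r => deriv h r - h 0 * (besselD (ζ * r) * ζ) with hD1def
  have hsub : Ico (0 : ℝ) 1 ⊆ Ioo (-1) 1 := fun r hr => ⟨by linarith [hr.1], hr.2⟩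
  have hDd : ∀ r ∈ Ico (0 : ℝ) 1, HasDerivAt D (D1 r) r := fun r hr =>
    (hd1 r (hsub hr)).sub ((hJ r).const_mul _)
  have hcontJ : Continuous fun r => besselJ (ζ * r) :=
    continuous_besselJ.comp (continuous_const_mul ζ)
  have hcontD : Continuous fun r => besselD (ζ * r) :=
    continuous_besselD.comp (continuous_const_mul ζ)
  have hanti : AntitoneOn (fun r => D1 r ^ 2 + ζ ^ 2 * D r ^ 2) (Ico 0 1) := by
    refine antitoneOn_of_hasDerivWithinAt_nonpos (f' := fun r => -2 * (D1 r ^ 2 / r))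
      (convex_Ico 0 1) ?_ ?_ ?_
    · refine ContinuousOn.add (ContinuousOn.pow ?_ 2) (continuousOn_const.mul (ContinuousOn.pow ?_ 2))
      · exact (hcd1.continuousOn.mono hsub).sub
          (continuous_const.mul (hcontD.mul continuous_const)).continuousOn
      · exact fun r hr => (hDd r hr).continuousAt.continuousWithinAt
    · intro r hr
      rw [interior_Ico] at hr
      have hr0 : r ≠ 0 := hr.1.ne'
      have h1 : HasDerivAt D1 _ r := (hd2 r (hsub ⟨hr.1.le, hr.2⟩)).sub
        (((hD r hr.1).mul_const ζ).const_mul (h 0))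
      refine (HasDerivAt.congr_deriv ((h1.pow 2).add (((hDd r ⟨hr.1.le, hr.2⟩).pow 2).const_mul
        (ζ ^ 2))) ?_).hasDerivWithinAt
      rw [hode r hr]
      simp only [hDdef, hD1def]
      field_simp; push_cast; ring
    · intro r hr
      rw [interior_Ico] at hr
      have := hr.1
      have : 0 ≤ D1 r ^ 2 / r := by positivity
      linarith
  have hD0 : EqOn D (fun _ => 0) (Ico 0 1) := by
    intro r hr
    have hle := hanti (left_mem_Ico.2 zero_lt_one) hr hr.1
    have e0 : D 0 = 0 := by simp [hDdef, besselJ_zero]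
    have e1 : D1 0 = 0 := by simp [hD1def, besselD_zero, h10]
    simp only [e0, e1] at hle
    have : ζ ^ 2 * D r ^ 2 ≤ 0 := by nlinarith [sq_nonneg (D1 r)]
    have h2 : D r ^ 2 ≤ 0 := by
      by_contra hc
      push Not at hc
      have : 0 < ζ ^ 2 * D r ^ 2 := by positivity
      linarith
    exact pow_eq_zero_iff two_ne_zero |>.1 (le_antisymm h2 (sq_nonneg _))
  have hcont : ContinuousOn D (Icc 0 1) := by
    refine ContinuousOn.sub (hf.continuousOn.comp (by fun_prop) fun r hr => ?_)
      (continuous_const.mul hcontJ).continuousOn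
    rw [mem_closedBall_zero_iff, norm_smul_basis, abs_of_nonneg hr.1]; exact hr.2
  have hD1 : EqOn D (fun _ => 0) (Icc 0 1) :=
    hD0.of_subset_closure hcont continuousOn_const Ico_subset_Icc_self
      (by rw [closure_Ico zero_ne_one])
  have hx1 : ‖x‖ ≤ 1 := mem_closedBall_zero_iff.1 hx
  have h3 := hD1 (show ‖x‖ ∈ Icc (0 : ℝ) 1 from ⟨norm_nonneg x, hx1⟩)
  have h4 : f x = h ‖x‖ := hf.radial x hx _
    (by rw [mem_closedBall_zero_iff, norm_smul_basis, abs_norm]; exact hx1)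
    (by rw [norm_smul_basis, abs_norm])
  simp only [hDdef] at h3
  have h5 : h 0 = f 0 := by simp [hdef]
  rw [h4, ← h5]
  linarith

theorem apply_zero_ne_zero (hf : IsRadialDirichletEigenfunction ζ f) (hζ : 0 < ζ) : f 0 ≠ 0 := by
  intro h0
  obtain ⟨x, hx, hne⟩ := hf.nontrivial
  exact hne (by rw [hf.eq_mul_besselJ hζ (Metric.ball_subset_closedBall hx), h0, zero_mul])

theorem besselJ_eq_zero (hf : IsRadialDirichletEigenfunction ζ f) (hζ : 0 < ζ) :
    besselJ ζ = 0 := by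
  have hn : ‖(EuclideanSpace.single 0 1 : Plane)‖ = 1 := by simp
  have h1 := hf.eq_mul_besselJ hζ (x := EuclideanSpace.single 0 1)
    (by rw [mem_closedBall_zero_iff, hn])
  rw [hf.boundary _ (by rw [mem_sphere_zero_iff_norm, hn]), hn, mul_one] at h1
  exact (mul_eq_zero.1 h1.symm).resolve_left (hf.apply_zero_ne_zero hζ)

theorem one_lt (hf : IsRadialDirichletEigenfunction ζ f) (hζ : 0 < ζ) : 1 < ζ := by
  by_contra h
  exact (besselJ_pos hζ.le (not_lt.1 h)).ne' (hf.besselJ_eq_zero hζ)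

end IsRadialDirichletEigenfunction

end

noncomputable section

/-! ### Frequencies, orthonormality and pointwise bounds -/

/-- Polar coordinates. The angular constant is left as dimension times the volume of the ball, since
its numerical value plays no role. -/
theorem setIntegral_unitDisc_norm (f : ℝ → ℝ) :
    ∫ x in unitDisc, f ‖x‖ = 2 * volume.real unitDisc * ∫ r in (0 : ℝ)..1, r * f r := by
  have h1 : ∫ x in unitDisc, f ‖x‖ = ∫ x : Plane, (Iio (1 : ℝ)).indicator f ‖x‖ := by
    rw [← integral_indicator measurableSet_ball]
    refine integral_congr_ae (Filter.Eventually.of_forall fun x => ?_)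
    simp [indicator]
  rw [h1, integral_fun_norm_addHaar, intervalIntegral.integral_of_le zero_le_one,
    integral_Ioc_eq_integral_Ioo]
  simp only [finrank_euclideanSpace, Fintype.card_fin, smul_eq_mul, nsmul_eq_mul]
  have h2 : ∀ y : ℝ, y ^ (2 - 1) * (Iio (1 : ℝ)).indicator f y =
      (Iio (1 : ℝ)).indicator (fun y => y * f y) y := fun y => by
    by_cases hr : y < 1 <;> simp [hr]
  simp_rw [h2]
  rw [setIntegral_indicator measurableSet_Iio, Ioi_inter_Iio]
  push_cast
  ring

theorem volume_real_unitDisc_pos : 0 < volume.real unitDisc :=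
  ENNReal.toReal_pos (Metric.measure_ball_pos volume _ zero_lt_one).ne' measure_ball_lt_top.ne

theorem integrableOn_unitDisc_norm_rpow {s : ℝ} (hs : -2 < s) :
    IntegrableOn (fun x : Plane => ‖x‖ ^ s) unitDisc := by
  rw [integrableOn_fun_norm_addHaar volume (f := fun r => r ^ s)]
  have h := (intervalIntegral.integrableOn_Ioo_rpow_iff (s := s + 1) zero_lt_one).2 (by linarith)
  refine h.congr_fun (fun r hr => ?_) measurableSet_Ioo
  simp only [finrank_euclideanSpace, Fintype.card_fin, smul_eq_mul]
  rw [Real.rpow_add_one hr.1.ne']; simp [mul_comm]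

namespace RadialEigensystem

variable (S : RadialEigensystem)

theorem e_eq (n : ℕ) {x : Plane} (hx : x ∈ unitDisc) :
    S.e n x = S.e n 0 * besselJ (S.z n * ‖x‖) :=
  (S.eigen n).eq_mul_besselJ (S.z_pos n) (Metric.ball_subset_closedBall hx)

theorem one_lt_z (n : ℕ) : 1 < S.z n := (S.eigen n).one_lt (S.z_pos n)

theorem besselJ_z (n : ℕ) : besselJ (S.z n) = 0 := (S.eigen n).besselJ_eq_zero (S.z_pos n)

/-- The first zero exceeds 1 and consecutive zeros are 1/2 apart. This crude linear growth is all
that is used of the asymptotics of the frequencies. -/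
theorem one_add_half_le_z (n : ℕ) : 1 + (n : ℝ) / 2 ≤ S.z n := by
  induction n with
  | zero => simpa using (S.one_lt_z 0).le
  | succ n ih =>
    have := half_le_sub_of_besselJ_eq_zero (S.one_lt_z n).le (S.z_strictMono n.lt_succ_self)
      (S.besselJ_z n) (S.besselJ_z (n + 1))
    push_cast; linarith

theorem finite_z_le (r : ℝ) : {n : ℕ | S.z n ≤ r}.Finite := by
  refine (finite_le_nat ⌊2 * r⌋₊).subset fun n hn => ?_
  refine Nat.le_floor ?_
  have := S.one_add_half_le_z n
  have hn' : S.z n ≤ r := hn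
  linarith

/-- Partial sums of negative powers of the frequencies are bounded. -/
theorem exists_sum_z_rpow_le {s : ℝ} (hs : s < -1) :
    ∃ C : ℝ, 0 < C ∧ ∀ A : Finset ℕ, ∑ n ∈ A, S.z n ^ s ≤ C := by
  have hsum : Summable fun n : ℕ => ((n : ℝ) + 1) ^ s := by
    have := (summable_nat_add_iff 1).2 (Real.summable_nat_rpow.2 hs)
    simpa using this
  have hz : Summable fun n => S.z n ^ s := by
    refine Summable.of_nonneg_of_le (fun n => Real.rpow_nonneg (S.z_pos n).le _) (fun n => ?_)
      (hsum.mul_left ((1 / 2 : ℝ) ^ s))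
    rw [← Real.mul_rpow (by norm_num) (by positivity)]
    refine Real.rpow_le_rpow_of_nonpos (by positivity) ?_ (by linarith)
    have := S.one_add_half_le_z n
    linarith
  refine ⟨∑' n, S.z n ^ s + 1, ?_, fun A => ?_⟩
  · have : 0 ≤ ∑' n, S.z n ^ s := tsum_nonneg fun n => Real.rpow_nonneg (S.z_pos n).le s
    linarith
  · have := hz.sum_le_tsum A (fun n _ => Real.rpow_nonneg (S.z_pos n).le s)
    linarith

theorem setIntegral_e_mul_e (n m : ℕ) :
    ∫ x in unitDisc, S.e n x * S.e m x = if n = m then 1 else 0 := by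
  split_ifs with h
  · subst h
    simpa [sq] using S.normalized n
  · have : ∫ x in unitDisc, S.e n x * S.e m x = ∫ x in unitDisc,
        (fun r => S.e n 0 * S.e m 0 * (besselJ (S.z n * r) * besselJ (S.z m * r))) ‖x‖ := by
      refine setIntegral_congr_fun measurableSet_ball fun x hx => ?_
      simp only [S.e_eq n hx, S.e_eq m hx]; ring
    rw [this, setIntegral_unitDisc_norm
      (fun r => S.e n 0 * S.e m 0 * (besselJ (S.z n * r) * besselJ (S.z m * r)))]
    have h0 := integral_besselJ_mul_besselJ (S.z_pos n) (S.z_pos m)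
      (S.z_strictMono.injective.ne h) (S.besselJ_z n) (S.besselJ_z m)
    simp_rw [mul_left_comm _ (S.e n 0 * S.e m 0) _]
    rw [intervalIntegral.integral_const_mul, h0]; simp

/-- The L² normalization fixes the amplitude at the centre through J₀'(zₙ); with the lower bound on
|J₀'| at zeros it gives eₙ(0)² ≲ zₙ. -/
theorem e_zero_sq (n : ℕ) :
    S.e n 0 ^ 2 * (volume.real unitDisc * besselD (S.z n) ^ 2) = 1 := by
  rw [← S.normalized n]
  have : ∫ x in unitDisc, S.e n x ^ 2 = ∫ x in unitDisc,
      (fun r => S.e n 0 ^ 2 * besselJ (S.z n * r) ^ 2) ‖x‖ := by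
    refine setIntegral_congr_fun measurableSet_ball fun x hx => ?_
    simp only [S.e_eq n hx]; ring
  rw [this, setIntegral_unitDisc_norm (fun r => S.e n 0 ^ 2 * besselJ (S.z n * r) ^ 2)]
  simp_rw [mul_left_comm _ (S.e n 0 ^ 2) _]
  rw [intervalIntegral.integral_const_mul, integral_besselJ_sq (S.z_pos n) (S.besselJ_z n)]
  ring

/-- Pointwise bounds of the eigenfunctions, interpolating between `eₙ² ≲ zₙ` and
`eₙ² ≲ 1/|x|`. -/
theorem exists_e_sq_le : ∃ C : ℝ, 0 < C ∧ ∀ θ ∈ Icc (0 : ℝ) 1, ∀ n, ∀ x ∈ unitDisc, x ≠ 0 →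
    S.e n x ^ 2 ≤ C * S.z n ^ (1 - θ) * ‖x‖ ^ (-θ) := by
  obtain ⟨c, hc, hcD⟩ := exists_le_mul_besselD_sq
  have hV := volume_real_unitDisc_pos
  set V := volume.real unitDisc with hVdef
  refine ⟨3 / (V * c), by positivity, fun θ hθ n x hx hx0 => ?_⟩
  have hz := S.z_pos n
  have hr : 0 < ‖x‖ := norm_pos_iff.2 hx0
  have h0 : S.e n 0 ^ 2 ≤ S.z n / (V * c) := by
    have h1 := S.e_zero_sq n
    have h2 := hcD _ (S.one_lt_z n).le (S.besselJ_z n)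
    rw [le_div_iff₀ (by positivity)]
    calc S.e n 0 ^ 2 * (V * c) ≤ S.e n 0 ^ 2 * (V * (S.z n * besselD (S.z n) ^ 2)) := by gcongr
      _ = S.z n * (S.e n 0 ^ 2 * (V * besselD (S.z n) ^ 2)) := by ring
      _ = S.z n := by rw [h1, mul_one]
  -- Below 1 use J² ≤ 1 and s^θ ≤ 1; above 1 use s J² ≤ 3 and s^θ ≤ s.
  have hJ : besselJ (S.z n * ‖x‖) ^ 2 ≤ 3 * (S.z n * ‖x‖) ^ (-θ) := by
    have hp : 0 < S.z n * ‖x‖ := by positivity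
    rw [Real.rpow_neg hp.le, ← div_eq_mul_inv, le_div_iff₀ (by positivity)]
    rcases le_total (S.z n * ‖x‖) 1 with h1 | h1
    · have := besselJ_sq_le_one hp.le
      have h2 : (S.z n * ‖x‖) ^ θ ≤ 1 := Real.rpow_le_one hp.le h1 hθ.1
      nlinarith [sq_nonneg (besselJ (S.z n * ‖x‖)), Real.rpow_nonneg hp.le θ]
    · have h2 : (S.z n * ‖x‖) ^ θ ≤ S.z n * ‖x‖ := by
        simpa using Real.rpow_le_rpow_of_exponent_le h1 hθ.2
      have := mul_besselJ_sq_le hp.le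
      nlinarith [sq_nonneg (besselJ (S.z n * ‖x‖))]
  rw [S.e_eq n hx, mul_pow]
  calc _ ≤ S.z n / (V * c) * (3 * (S.z n * ‖x‖) ^ (-θ)) := by gcongr
    _ = _ := by
      rw [Real.mul_rpow hz.le hr.le, sub_eq_add_neg, Real.rpow_add hz, Real.rpow_one]; ring

theorem continuousOn_e (n : ℕ) : ContinuousOn (S.e n) unitDisc :=
  (S.eigen n).continuousOn.mono Metric.ball_subset_closedBall

theorem exists_abs_e_le (n : ℕ) : ∃ C : ℝ, ∀ x ∈ unitDisc, |S.e n x| ≤ C := by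
  obtain ⟨C, hC⟩ := (isCompact_closedBall (0 : Plane) 1).exists_bound_of_continuousOn
    (S.eigen n).continuousOn
  exact ⟨C, fun x hx => hC x (Metric.ball_subset_closedBall hx)⟩

end RadialEigensystem

end

noncomputable section

/-! ### Divergence-free flows do not increase Lebesgue measure -/

section Liouville

open Filter

variable {E : Type*} [NormedAddCommGroup E] [NormedSpace ℝ E]

/-- One step of the explicit Euler scheme. -/
def eulerStep (X : E → E) (h : ℝ) (x : E) : E := x + h • X x

/-- One step commits an error K B h², since the field varies by at most K B h along the solution in
time h. Earlier errors are amplified by at most 1 + hK per step. -/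
theorem norm_iterate_eulerStep_sub_le {X : E → E} {K : ℝ≥0} {B : ℝ} (hK : LipschitzWith K X)
    (hB : ∀ x, ‖X x‖ ≤ B) {γ : ℝ → E} (hγ : ∀ s, HasDerivAt γ (X (γ s)) s) {h : ℝ} (hh : 0 ≤ h)
    (k : ℕ) : ‖(eulerStep X h)^[k] (γ 0) - γ (k * h)‖ ≤ k * (K * B * h * h) * (1 + h * K) ^ k := by
  have hB0 : 0 ≤ B := (norm_nonneg _).trans (hB 0)
  have hloc : ∀ s, ‖γ (s + h) - γ s - h • X (γ s)‖ ≤ K * B * h * h := by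
    intro s
    have h1 : ∀ r ∈ Icc s (s + h), ‖γ r - γ s‖ ≤ B * h := by
      intro r hr
      have := Convex.norm_image_sub_le_of_norm_hasDerivWithin_le (f := γ) (s := univ)
        (fun x _ => (hγ x).hasDerivWithinAt) (fun x _ => hB _) convex_univ (mem_univ s) (mem_univ r)
      refine this.trans (mul_le_mul_of_nonneg_left ?_ hB0)
      rw [Real.norm_eq_abs, abs_of_nonneg (by linarith [hr.1])]; linarith [hr.2]
    have h2 := Convex.norm_image_sub_le_of_norm_hasDerivWithin_le
      (f := fun r => γ r - r • X (γ s)) (f' := fun r => X (γ r) - X (γ s)) (s := Icc s (s + h))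
      (C := K * B * h) (x := s) (y := s + h)
      (fun r _ => (((hγ r).sub ((hasDerivAt_id r).smul_const (X (γ s)))).congr_deriv
        (by simp)).hasDerivWithinAt) (fun r hr => ?_) (convex_Icc _ _)
      ⟨le_rfl, by linarith⟩ ⟨by linarith, le_rfl⟩
    · have e : γ (s + h) - (s + h) • X (γ s) - (γ s - s • X (γ s)) =
          γ (s + h) - γ s - h • X (γ s) := by rw [add_smul]; abel
      rw [e, add_sub_cancel_left, Real.norm_eq_abs, abs_of_nonneg hh] at h2
      exact h2
    · calc ‖X (γ r) - X (γ s)‖ ≤ K * ‖γ r - γ s‖ := hK.norm_sub_le _ _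
        _ ≤ K * (B * h) := by gcongr; exact h1 r hr
        _ = _ := by ring
  induction k with
  | zero => simp
  | succ k ih =>
    rw [Function.iterate_succ_apply']
    set x := (eulerStep X h)^[k] (γ 0)
    set s := (k : ℝ) * h with hs
    have e : eulerStep X h x - γ ((k + 1 : ℕ) * h) =
        (x - γ s) + h • (X x - X (γ s)) - (γ (s + h) - γ s - h • X (γ s)) := by
      have : ((k + 1 : ℕ) : ℝ) * h = s + h := by rw [hs]; push_cast; ring
      rw [this, eulerStep, smul_sub]; abel
    have hp : (1 : ℝ) ≤ (1 + h * K) ^ (k + 1) :=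
      one_le_pow₀ (by have : 0 ≤ h * K := by positivity
                      linarith)
    rw [e]
    calc _ ≤ ‖x - γ s‖ + h * (K * ‖x - γ s‖) + K * B * h * h := by
          refine (norm_sub_le _ _).trans (add_le_add ((norm_add_le _ _).trans ?_) (hloc s))
          rw [norm_smul, Real.norm_eq_abs, abs_of_nonneg hh]
          gcongr
          exact hK.norm_sub_le _ _
      _ = (1 + h * K) * ‖x - γ s‖ + K * B * h * h := by ring
      _ ≤ (1 + h * K) * (k * (K * B * h * h) * (1 + h * K) ^ k)
          + K * B * h * h * (1 + h * K) ^ (k + 1) := by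
          exact add_le_add (by gcongr) (le_mul_of_one_le_right (by positivity) hp)
      _ = _ := by push_cast; ring

/-- The Euler scheme converges to the solution. -/
theorem tendsto_iterate_eulerStep {X : E → E} {K : ℝ≥0} {B : ℝ} (hK : LipschitzWith K X)
    (hB : ∀ x, ‖X x‖ ≤ B) {γ : ℝ → E} (hγ : ∀ s, HasDerivAt γ (X (γ s)) s) {t : ℝ} (ht : 0 ≤ t) :
    Tendsto (fun n : ℕ => (eulerStep X (t / n))^[n] (γ 0)) atTop (nhds (γ t)) := by
  have hB0 : 0 ≤ B := (norm_nonneg _).trans (hB 0)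
  have hlim : Tendsto (fun n : ℕ => (t * (K * B) * Real.exp (t * K)) * (t / n)) atTop (nhds 0) := by
    simpa using (tendsto_const_div_atTop_nhds_zero_nat t).const_mul (t * (K * B) * Real.exp (t * K))
  rw [tendsto_iff_norm_sub_tendsto_zero]
  refine squeeze_zero' (Eventually.of_forall fun _ => norm_nonneg _) ?_ hlim
  filter_upwards [eventually_gt_atTop 0] with n hn
  have hn' : (0 : ℝ) < n := Nat.cast_pos.2 hn
  have h := norm_iterate_eulerStep_sub_le hK hB hγ (h := t / n) (by positivity) n
  rw [mul_div_cancel₀ t hn'.ne'] at h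
  refine h.trans ?_
  have h1 : (1 + t / n * K) ^ n ≤ Real.exp (t * K) := by
    calc (1 + t / n * K) ^ n ≤ Real.exp (t / n * K) ^ n := by
          refine pow_le_pow_left₀ (by positivity) ?_ n
          linarith [Real.add_one_le_exp (t / n * K)]
      _ = Real.exp (t * K) := by
          rw [← Real.exp_nat_mul]; congr 1; field_simp
  calc _ ≤ n * (K * B * (t / n) * (t / n)) * Real.exp (t * K) := by gcongr
    _ = _ := by field_simp

variable [FiniteDimensional ℝ E]

/-- In coordinates det(1 + rM) is 1 + r tr M plus r² times a polynomial in r. -/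
theorem hasDerivAt_det_one_add_smul (A : E →L[ℝ] E) :
    HasDerivAt (fun r : ℝ => (1 + r • A).det) (LinearMap.trace ℝ E A) 0 := by
  classical
  let b := Module.finBasis ℝ E
  let M := LinearMap.toMatrix b b (A : E →ₗ[ℝ] E)
  have h : ∀ r : ℝ, (1 + r • A).det = 1 + M.trace * r +
      (Matrix.det (1 + (Polynomial.X : Polynomial ℝ) • M.map Polynomial.C)).divX.divX.eval r
        * r ^ 2 := by
    intro r
    rw [← Matrix.det_one_add_smul, ContinuousLinearMap.det, ← LinearMap.det_toMatrix b]
    congr 1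
    simp [M, LinearMap.toMatrix_one]
  simp_rw [h]
  rw [LinearMap.trace_eq_matrix_trace ℝ b]
  have h1 := (((hasDerivAt_id (0 : ℝ)).const_mul M.trace).const_add 1).add
    ((Polynomial.hasDerivAt (Matrix.det (1 + (Polynomial.X : Polynomial ℝ) •
      M.map Polynomial.C)).divX.divX 0).mul (hasDerivAt_pow 2 (0 : ℝ)))
  exact h1.congr_deriv (by simp [M])

theorem differentiable_det : Differentiable ℝ fun A : E →L[ℝ] E => A.det := by
  classical
  let b := Module.finBasis ℝ E
  have h : ∀ A : E →L[ℝ] E, A.det = ∑ σ : Equiv.Perm (Fin (Module.finrank ℝ E)),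
      Equiv.Perm.sign σ • ∏ i, b.repr (A (b i)) (σ i) := by
    intro A
    rw [ContinuousLinearMap.det, ← LinearMap.det_toMatrix b, Matrix.det_apply]
    simp [LinearMap.toMatrix_apply]
  simp_rw [h]
  have hl : ∀ i j, Differentiable ℝ fun A : E →L[ℝ] E => b.repr (A (b i)) j := fun i j => by
    have := ((b.coord j).toContinuousLinearMap.comp
      (ContinuousLinearMap.apply ℝ E (b i))).differentiable
    exact this
  refine Differentiable.fun_sum fun σ _ => ?_
  have : Differentiable ℝ fun A : E →L[ℝ] E => ∏ i, b.repr (A (b i)) (σ i) :=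
    fun A => (HasFDerivAt.finsetProd fun i _ => (hl i (σ i) A).hasFDerivAt).differentiableAt
  exact this.const_smul (R := ℤˣ) (Equiv.Perm.sign σ)

/-- The determinant of a small trace-free perturbation of the identity is `1` to first order. -/
theorem exists_abs_det_one_add_sub_one_le {ε : ℝ} (hε : 0 < ε) :
    ∃ δ : ℝ, 0 < δ ∧ ∀ A : E →L[ℝ] E, ‖A‖ ≤ δ → LinearMap.trace ℝ E A = 0 →
      |(1 + A).det - 1| ≤ ε * ‖A‖ := by
  have hd := (differentiable_det (E := E) 1).hasFDerivAt
  have htr : ∀ A : E →L[ℝ] E, fderiv ℝ (fun A : E →L[ℝ] E => A.det) 1 A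
      = LinearMap.trace ℝ E A := by
    intro A
    have hline : HasDerivAt (fun r : ℝ => (1 : E →L[ℝ] E) + r • A) A 0 :=
      (((hasDerivAt_id (0 : ℝ)).smul_const A).const_add 1).congr_deriv (by simp)
    have hd' : HasFDerivAt (fun A : E →L[ℝ] E => A.det)
        (fderiv ℝ (fun A : E →L[ℝ] E => A.det) 1) (1 + (0 : ℝ) • A) := by simpa using hd
    have hcomp : HasDerivAt (fun r : ℝ => (1 + r • A).det)
        (fderiv ℝ (fun A : E →L[ℝ] E => A.det) 1 A) 0 := by
      change HasDerivAt ((fun A : E →L[ℝ] E => A.det) ∘ fun r : ℝ => 1 + r • A) _ 0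
      exact HasFDerivAt.comp_hasDerivAt 0 hd' hline
    exact hcomp.unique (hasDerivAt_det_one_add_smul A)
  rw [hasFDerivAt_iff_isLittleO_nhds_zero] at hd
  have := hd.def hε
  obtain ⟨δ, hδ, hball⟩ := Metric.eventually_nhds_iff.1 this
  refine ⟨δ / 2, by positivity, fun A hA h0 => ?_⟩
  have h1 := hball (y := A) (by rw [dist_zero_right]; linarith)
  rw [htr, h0, sub_zero, Real.norm_eq_abs] at h1
  simpa [ContinuousLinearMap.det] using h1

variable [MeasurableSpace E] [BorelSpace E] (μ : Measure E) [μ.IsAddHaarMeasure]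

/-- For hK < 1 the step is injective, so the change of variables formula applies on its image.
Enlarging the image to the whole space costs only an inequality, so surjectivity is not needed. -/
theorem mul_lintegral_eulerStep_le {X : E → E} {K : ℝ≥0} (hK : LipschitzWith K X)
    (hX : Differentiable ℝ X) {h : ℝ} (hh : 0 ≤ h) (hhK : h * K < 1) {c : ℝ}
    (hc : ∀ x, c ≤ |(1 + h • fderiv ℝ X x).det|) (g : E → ℝ≥0∞) :
    ENNReal.ofReal c * ∫⁻ x, g (eulerStep X h x) ∂μ ≤ ∫⁻ x, g x ∂μ := by
  have hinj : InjOn (eulerStep X h) univ := by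
    intro x _ y _ hxy
    simp only [eulerStep] at hxy
    have e : x - y = h • (X y - X x) := by
      rw [smul_sub, sub_eq_sub_iff_add_eq_add, hxy, add_comm]
    have h1 : ‖x - y‖ ≤ h * (K * ‖x - y‖) := by
      calc ‖x - y‖ = h * ‖X y - X x‖ := by
            rw [e, norm_smul, Real.norm_eq_abs, abs_of_nonneg hh]
        _ ≤ h * (K * ‖x - y‖) := by
            rw [norm_sub_rev x y]; gcongr; exact hK.norm_sub_le _ _
    by_contra hne
    have : 0 < ‖x - y‖ := norm_pos_iff.2 (sub_ne_zero.2 hne)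
    nlinarith
  have hd : ∀ x ∈ univ, HasFDerivWithinAt (eulerStep X h) (1 + h • fderiv ℝ X x) univ x :=
    fun x _ => ((hasFDerivAt_id x).add ((hX x).hasFDerivAt.const_smul h)).hasFDerivWithinAt
  have hcv := lintegral_image_eq_lintegral_abs_det_fderiv_mul μ MeasurableSet.univ hd hinj g
  rw [← lintegral_const_mul' _ _ ENNReal.ofReal_ne_top]
  calc _ ≤ ∫⁻ x in univ, ENNReal.ofReal |(1 + h • fderiv ℝ X x).det| * g (eulerStep X h x) ∂μ := by
        rw [Measure.restrict_univ]
        refine lintegral_mono fun x => ?_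
        gcongr
        exact hc x
    _ = ∫⁻ x in eulerStep X h '' univ, g x ∂μ := hcv.symm
    _ ≤ _ := setLIntegral_le_lintegral _ _

/-- **Liouville's theorem** (as an inequality): the flow of a divergence-free vector field does not
increase Lebesgue measure. -/
theorem setLIntegral_flow_le {X : E → E} {K : ℝ≥0} {B : ℝ} (hK : LipschitzWith K X)
    (hB : ∀ x, ‖X x‖ ≤ B) (hX : Differentiable ℝ X)
    (htr : ∀ x, LinearMap.trace ℝ E (fderiv ℝ X x) = 0) {A : Set E} (hA : MeasurableSet A)
    {γ : E → ℝ → E} (h0 : ∀ x ∈ A, γ x 0 = x)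
    (hγ : ∀ x ∈ A, ∀ s, HasDerivAt (γ x) (X (γ x s)) s) {t : ℝ} (ht : 0 ≤ t)
    {g : E → ℝ≥0∞} (hg : Continuous g) : ∫⁻ x in A, g (γ x t) ∂μ ≤ ∫⁻ x, g x ∂μ := by
  have hstep : ∀ h : ℝ, Continuous (eulerStep X h) := fun h =>
    continuous_id.add (hK.continuous.const_smul h)
  -- The flow is a pointwise limit of Euler iterates, so Fatou's lemma reduces the claim to the
  -- scheme and no regularity of the flow in its initial point is required.
  have hfatou : ∫⁻ x in A, g (γ x t) ∂μ ≤
      liminf (fun n : ℕ => ∫⁻ x, g ((eulerStep X (t / n))^[n] x) ∂μ) atTop := by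
    calc ∫⁻ x in A, g (γ x t) ∂μ =
          ∫⁻ x in A, liminf (fun n : ℕ => g ((eulerStep X (t / n))^[n] x)) atTop ∂μ := by
          refine setLIntegral_congr_fun hA fun x hx => ?_
          have := tendsto_iterate_eulerStep hK hB (hγ x hx) ht
          rw [h0 x hx] at this
          exact ((hg.tendsto _).comp this).liminf_eq.symm
      _ ≤ liminf (fun n : ℕ => ∫⁻ x in A, g ((eulerStep X (t / n))^[n] x) ∂μ) atTop :=
          lintegral_liminf_le fun n => (hg.comp ((hstep _).iterate n)).measurable
      _ ≤ _ := by
          refine liminf_le_liminf (Eventually.of_forall fun n => ?_)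
          exact setLIntegral_le_lintegral _ _
  have hmain : ∀ c : ℝ, c < 1 → ENNReal.ofReal c * ∫⁻ x in A, g (γ x t) ∂μ ≤ ∫⁻ x, g x ∂μ := by
    intro c hc
    -- Each of the n steps loses a factor 1 - ε(t/n)K. By Bernoulli the total is at least 1 - εtK,
    -- and this ε makes it at least c; the 1 in the denominator covers tK = 0.
    have hε : 0 < (1 - c) / (t * K + 1) := div_pos (by linarith) (by positivity)
    obtain ⟨δ, hδ, hdet⟩ := exists_abs_det_one_add_sub_one_le (E := E) hε
    have hsmall : Tendsto (fun n : ℕ => t / n * K) atTop (nhds 0) := by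
      simpa using (tendsto_const_div_atTop_nhds_zero_nat t).mul_const (K : ℝ)
    have hev : ∀ᶠ n : ℕ in atTop,
        ENNReal.ofReal c * ∫⁻ x, g ((eulerStep X (t / n))^[n] x) ∂μ ≤ ∫⁻ x, g x ∂μ := by
      filter_upwards [hsmall.eventually (gt_mem_nhds hδ), hsmall.eventually (gt_mem_nhds one_pos),
        hsmall.eventually (gt_mem_nhds (show 0 < 1 / ((1 - c) / (t * K + 1)) by positivity)),
        eventually_gt_atTop 0] with n hn1 hn2 hn3 hn0
      have hn' : (0 : ℝ) < n := Nat.cast_pos.2 hn0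
      set h := t / n with hh
      set ε := (1 - c) / (t * K + 1) with hεdef
      have hh0 : 0 ≤ h := by positivity
      have hnA : ∀ x, ‖h • fderiv ℝ X x‖ ≤ h * K := fun x => by
        rw [norm_smul, Real.norm_eq_abs, abs_of_nonneg hh0]
        gcongr
        exact norm_fderiv_le_of_lipschitz ℝ hK
      have hone : ∀ x, 1 - ε * (h * K) ≤ |(1 + h • fderiv ℝ X x).det| := fun x => by
        have h1 := hdet (h • fderiv ℝ X x) ((hnA x).trans hn1.le) (by simp [htr x])
        have h2 : ε * ‖h • fderiv ℝ X x‖ ≤ ε * (h * K) := by gcongr; exact hnA x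
        have h3 := neg_abs_le ((1 + h • fderiv ℝ X x).det - 1)
        have h4 := le_abs_self (1 + h • fderiv ℝ X x).det
        linarith
      have hnn : 0 ≤ 1 - ε * (h * K) := by
        rw [lt_div_iff₀ hε] at hn3; linarith
      have hiter : ∀ k : ℕ, ENNReal.ofReal (1 - ε * (h * K)) ^ k *
          ∫⁻ x, g ((eulerStep X h)^[k] x) ∂μ ≤ ∫⁻ x, g x ∂μ := by
        intro k
        induction k with
        | zero => simp
        | succ k ih =>
          refine le_trans ?_ ih
          rw [pow_succ, mul_assoc]
          gcongr
          simp_rw [Function.iterate_succ_apply]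
          exact mul_lintegral_eulerStep_le μ hK hX hh0 hn2 hone fun y => g ((eulerStep X h)^[k] y)
      refine le_trans ?_ (hiter n)
      gcongr
      rw [← ENNReal.ofReal_pow hnn]
      refine ENNReal.ofReal_le_ofReal ?_
      have hb := one_add_mul_le_pow (a := -(ε * (h * K))) (by
        have : ε * (h * K) ≤ 1 := by linarith
        linarith) n
      rw [← sub_eq_add_neg] at hb
      refine le_trans ?_ hb
      have e : (n : ℝ) * (ε * (h * K)) = ε * (t * K) := by rw [hh]; field_simp
      have : ε * (t * K) ≤ 1 - c := by
        rw [hεdef, div_mul_eq_mul_div, div_le_iff₀ (by positivity)]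
        have : 0 ≤ t * K := by positivity
        nlinarith
      linarith
    calc _ ≤ ENNReal.ofReal c *
          liminf (fun n : ℕ => ∫⁻ x, g ((eulerStep X (t / n))^[n] x) ∂μ) atTop := by gcongr
      _ ≤ liminf (fun n : ℕ => ENNReal.ofReal c *
          ∫⁻ x, g ((eulerStep X (t / n))^[n] x) ∂μ) atTop := by
          rw [ENNReal.liminf_const_mul_of_ne_top ENNReal.ofReal_ne_top]
      _ ≤ ∫⁻ x, g x ∂μ := liminf_le_of_frequently_le' hev.frequently
  have hlim : Tendsto (fun n : ℕ => ENNReal.ofReal (1 - 1 / ((n : ℝ) + 1)) *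
      ∫⁻ x in A, g (γ x t) ∂μ) atTop (nhds (1 * ∫⁻ x in A, g (γ x t) ∂μ)) := by
    refine ENNReal.Tendsto.mul_const ?_ (Or.inl one_ne_zero)
    rw [← ENNReal.ofReal_one]
    refine (ENNReal.continuous_ofReal.tendsto _).comp ?_
    simpa using (tendsto_one_div_add_atTop_nhds_zero_nat (𝕜 := ℝ)).const_sub 1
  rw [one_mul] at hlim
  exact le_of_tendsto' hlim fun n => hmain _ (by
    have : 0 < 1 / ((n : ℝ) + 1) := by positivity
    linarith)

end Liouville

end

noncomputable section

/-! ### Divergence-free fields on `ℂⁿ` preserving the `ℓ²` norm -/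

section MassPreserving

open Filter

variable {ι : Type*} [Fintype ι]

/-- The square of the `ℓ²` norm. -/
def massSq (a : ι → ℂ) : ℝ := ∑ n, Complex.normSq (a n)

theorem contDiff_massSq {m : WithTop ℕ∞} : ContDiff ℝ m (massSq (ι := ι)) := by
  have : (massSq (ι := ι)) = fun a : ι → ℂ => ∑ n, ((a n).re ^ 2 + (a n).im ^ 2) := by
    ext a; simp [massSq, Complex.normSq_apply, sq]
  rw [this]
  refine ContDiff.sum fun n _ => ?_
  have h1 : ContDiff ℝ m fun a : ι → ℂ => (a n).re :=
    Complex.reCLM.contDiff.comp (contDiff_apply ℝ ℂ n)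
  have h2 : ContDiff ℝ m fun a : ι → ℂ => (a n).im :=
    Complex.imCLM.contDiff.comp (contDiff_apply ℝ ℂ n)
  exact (h1.pow 2).add (h2.pow 2)

theorem hasDerivAt_massSq {c : ℝ → ι → ℂ} {c' : ι → ℂ} {t : ℝ} (hc : HasDerivAt c c' t) :
    HasDerivAt (fun s => massSq (c s)) (2 * ∑ n, (star (c t n) * c' n).re) t := by
  have hn : ∀ n, HasDerivAt (fun s => Complex.normSq (c s n)) (2 * (star (c t n) * c' n).re) t := by
    intro n
    have h1 : HasDerivAt (fun s => c s n) (c' n) t := hasDerivAt_pi.1 hc n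
    have hre : HasDerivAt (fun s => (c s n).re) (c' n).re t :=
      Complex.reCLM.hasFDerivAt.comp_hasDerivAt t h1
    have him : HasDerivAt (fun s => (c s n).im) (c' n).im t :=
      Complex.imCLM.hasFDerivAt.comp_hasDerivAt t h1
    have := (hre.mul hre).add (him.mul him)
    refine HasDerivAt.congr_deriv this ?_
    simp [Complex.mul_re]; ring
  have := HasDerivAt.fun_sum fun n (_ : n ∈ Finset.univ) => hn n
  rw [Finset.mul_sum]
  exact this

theorem norm_le_of_massSq_le {a : ι → ℂ} {R : ℝ} (h : massSq a ≤ R) : ‖a‖ ≤ √R := by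
  refine (pi_norm_le_iff_of_nonneg (Real.sqrt_nonneg _)).2 fun n => ?_
  rw [← Real.sqrt_sq (norm_nonneg (a n)), ← Complex.normSq_eq_norm_sq]
  refine Real.sqrt_le_sqrt (le_trans ?_ h)
  exact Finset.single_le_sum (f := fun n => Complex.normSq (a n))
    (fun n _ => Complex.normSq_nonneg _) (Finset.mem_univ n)

/-- A field multiplied by a smooth cutoff of the `ℓ²` norm. -/
def cutoffField (X : (ι → ℂ) → ι → ℂ) (R : ℝ) (a : ι → ℂ) : ι → ℂ :=
  Real.smoothTransition (2 - massSq a / R) • X a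

/-- A smooth divergence-free vector field preserving the `ℓ²` norm. -/
structure IsMassPreservingField (X : (ι → ℂ) → ι → ℂ) : Prop where
  contDiff : ContDiff ℝ 1 X
  trace_eq_zero : ∀ a, LinearMap.trace ℝ (ι → ℂ) (fderiv ℝ X a) = 0
  mass : ∀ a, ∑ n, (star (a n) * X a n).re = 0

namespace IsMassPreservingField

variable {X : (ι → ℂ) → ι → ℂ}

theorem massSq_eq (hX : IsMassPreservingField X) {γ : ℝ → ι → ℂ} (hγ : ∀ s, HasDerivAt γ (X (γ s)) s) (t : ℝ) :
    massSq (γ t) = massSq (γ 0) := by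
  have h : ∀ s, HasDerivAt (fun s => massSq (γ s)) 0 s := fun s =>
    (hasDerivAt_massSq (hγ s)).congr_deriv (by rw [hX.mass, mul_zero])
  exact is_const_of_deriv_eq_zero (fun s => (h s).differentiableAt) (fun s => (h s).deriv) t 0

theorem contDiff_cutoffField (hX : IsMassPreservingField X) (R : ℝ) : ContDiff ℝ 1 (cutoffField X R) := by
  have h1 : ContDiff ℝ 1 fun a : ι → ℂ => Real.smoothTransition (2 - massSq a / R) :=
    Real.smoothTransition.contDiff.comp (contDiff_const.sub (contDiff_massSq.div_const R))
  exact h1.smul hX.contDiff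

theorem hasCompactSupport_cutoffField {R : ℝ} (hR : 0 < R) :
    HasCompactSupport (cutoffField X R) := by
  refine HasCompactSupport.intro (isCompact_closedBall (0 : ι → ℂ) (√(2 * R))) fun a ha => ?_
  have : 2 * R ≤ massSq a := by
    by_contra hlt
    push Not at hlt
    exact ha (mem_closedBall_zero_iff.2 (norm_le_of_massSq_le hlt.le))
  rw [cutoffField, Real.smoothTransition.zero_of_nonpos, zero_smul]
  rw [sub_nonpos, le_div_iff₀ hR]; exact this

theorem exists_lipschitzWith_cutoffField (hX : IsMassPreservingField X) {R : ℝ} (hR : 0 < R) :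
    ∃ K : ℝ≥0, LipschitzWith K (cutoffField X R) :=
  (hX.contDiff_cutoffField R).lipschitzWith_of_hasCompactSupport
    (hasCompactSupport_cutoffField hR) one_ne_zero

theorem exists_bound_cutoffField (hX : IsMassPreservingField X) {R : ℝ} (hR : 0 < R) : ∃ B : ℝ, ∀ a, ‖cutoffField X R a‖ ≤ B :=
  (hX.contDiff_cutoffField R).continuous.bounded_above_of_compact_support
    (hasCompactSupport_cutoffField hR)

/-- The divergence of χX is χ div X plus the derivative of χ along X. The latter vanishes because χ
depends only on the mass, which is stationary along X. -/
theorem trace_fderiv_cutoffField (hX : IsMassPreservingField X) (R : ℝ) (a : ι → ℂ) :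
    LinearMap.trace ℝ (ι → ℂ) (fderiv ℝ (cutoffField X R) a) = 0 := by
  have hχ : Differentiable ℝ fun a : ι → ℂ => Real.smoothTransition (2 - massSq a / R) := by
    have : ContDiff ℝ 1 fun a : ι → ℂ => Real.smoothTransition (2 - massSq a / R) :=
      Real.smoothTransition.contDiff.comp (contDiff_const.sub (contDiff_massSq.div_const R))
    exact this.differentiable one_ne_zero
  have hd := (hχ a).hasFDerivAt.smul ((hX.contDiff.differentiable one_ne_zero) a).hasFDerivAt
  have hzero : fderiv ℝ (fun a : ι → ℂ => Real.smoothTransition (2 - massSq a / R)) a (X a) = 0 := by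
    have hline : HasDerivAt (fun r : ℝ => a + r • X a) (X a) 0 :=
      (((hasDerivAt_id (0 : ℝ)).smul_const (X a)).const_add a).congr_deriv (by simp)
    have hm := hasDerivAt_massSq hline
    simp only [zero_smul, add_zero] at hm
    rw [hX.mass, mul_zero] at hm
    have h1 : HasDerivAt (fun r : ℝ => Real.smoothTransition (2 - massSq (a + r • X a) / R)) 0 0 := by
      have hs := (Real.smoothTransition.contDiff (n := 1)).differentiable one_ne_zero
        (2 - massSq (a + (0 : ℝ) • X a) / R)
      have h2 := hs.hasDerivAt.comp (0 : ℝ) ((hm.div_const R).const_sub 2)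
      exact h2.congr_deriv (by simp)
    have hχ' : HasFDerivAt (fun a : ι → ℂ => Real.smoothTransition (2 - massSq a / R))
        (fderiv ℝ (fun a : ι → ℂ => Real.smoothTransition (2 - massSq a / R)) a)
        (a + (0 : ℝ) • X a) := by simpa using (hχ a).hasFDerivAt
    have h3 := HasFDerivAt.comp_hasDerivAt 0 hχ' hline
    exact HasDerivAt.unique h3 h1
  have hf : fderiv ℝ (cutoffField X R) a = _ := hd.fderiv
  rw [hf, ContinuousLinearMap.toLinearMap_add, map_add, ContinuousLinearMap.toLinearMap_smul, map_smul,
    hX.trace_eq_zero, smul_zero, zero_add]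
  exact (LinearMap.trace_smulRight _ _).trans hzero

theorem cutoffField_eq {R : ℝ} (hR : 0 < R) {a : ι → ℂ} (ha : massSq a ≤ R) :
    cutoffField X R a = X a := by
  rw [cutoffField, Real.smoothTransition.one_of_one_le, one_smul]
  have := (div_le_one hR).2 ha
  linarith

theorem hasDerivAt_cutoffField (hX : IsMassPreservingField X) {γ : ℝ → ι → ℂ} (hγ : ∀ s, HasDerivAt γ (X (γ s)) s) {R : ℝ}
    (hR : 0 < R) (h0 : massSq (γ 0) ≤ R) (s : ℝ) : HasDerivAt γ (cutoffField X R (γ s)) s := by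
  rw [cutoffField_eq hR (by rwa [hX.massSq_eq hγ])]
  exact hγ s

theorem tendsto_eulerStep_cutoffField (hX : IsMassPreservingField X) {γ : ℝ → ι → ℂ} (hγ : ∀ s, HasDerivAt γ (X (γ s)) s) {R : ℝ}
    (hR : 0 < R) (h0 : massSq (γ 0) ≤ R) {t : ℝ} (ht : 0 ≤ t) :
    Tendsto (fun n : ℕ => (eulerStep (cutoffField X R) (t / n))^[n] (γ 0)) atTop (nhds (γ t)) := by
  obtain ⟨K, hK⟩ := hX.exists_lipschitzWith_cutoffField hR
  obtain ⟨B, hB⟩ := hX.exists_bound_cutoffField hR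
  exact tendsto_iterate_eulerStep hK hB (hX.hasDerivAt_cutoffField hγ hR h0) ht

/-- Both solutions are limits of the same Euler scheme, the cutoff being inactive on their common
mass level. -/
theorem eq_of_hasDerivAt (hX : IsMassPreservingField X) {γ η : ℝ → ι → ℂ} (hγ : ∀ s, HasDerivAt γ (X (γ s)) s)
    (hη : ∀ s, HasDerivAt η (X (η s)) s) (h : γ 0 = η 0) {t : ℝ} (ht : 0 ≤ t) : γ t = η t := by
  have hR : 0 < massSq (γ 0) + 1 := by
    have : 0 ≤ massSq (γ 0) := Finset.sum_nonneg fun _ _ => Complex.normSq_nonneg _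
    linarith
  have h1 := hX.tendsto_eulerStep_cutoffField hγ hR (by linarith) ht
  have h2 := hX.tendsto_eulerStep_cutoffField hη hR (by rw [← h]; linarith) ht
  rw [← h] at h2
  exact tendsto_nhds_unique h1 h2

/-- On each mass ball the flow is a limit of iterates that are continuous in the initial point, and
these balls exhaust the space. -/
theorem measurable_flow (hX : IsMassPreservingField X) {γ : (ι → ℂ) → ℝ → ι → ℂ}
    (h0 : ∀ a, γ a 0 = a) (hγ : ∀ a s, HasDerivAt (γ a) (X (γ a s)) s)
    {t : ℝ} (ht : 0 ≤ t) : Measurable fun a => γ a t := by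
  have hset : ∀ R : ℝ, MeasurableSet {a : ι → ℂ | massSq a ≤ R} := fun R =>
    (isClosed_le (contDiff_massSq (m := 0)).continuous continuous_const).measurableSet
  have h1 : ∀ j : ℕ, Measurable ({a : ι → ℂ | massSq a ≤ (j : ℝ) + 1}.indicator fun a => γ a t) := by
    intro j
    have hj : (0 : ℝ) < (j : ℝ) + 1 := by positivity
    refine measurable_of_tendsto_metrizable (f := fun (n : ℕ) =>
      {a : ι → ℂ | massSq a ≤ (j : ℝ) + 1}.indicator
        fun a => (eulerStep (cutoffField X (j + 1)) (t / n))^[n] a) (fun n => ?_) ?_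
    · refine Measurable.indicator (Continuous.measurable ?_) (hset _)
      refine Continuous.iterate ?_ n
      have := (hX.contDiff_cutoffField (j + 1)).continuous
      unfold eulerStep
      fun_prop
    · rw [tendsto_pi_nhds]
      intro a
      by_cases ha : massSq a ≤ (j : ℝ) + 1
      · have := hX.tendsto_eulerStep_cutoffField (hγ a) hj (by rwa [h0]) ht
        simpa [indicator, ha, h0] using this
      · simp [indicator, ha]
  refine measurable_of_tendsto_metrizable h1 ?_
  rw [tendsto_pi_nhds]
  intro a
  refine tendsto_const_nhds.congr' ?_
  filter_upwards [eventually_ge_atTop ⌈massSq a⌉₊] with j hj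
  have : massSq a ≤ (j : ℝ) + 1 := by
    have := Nat.ceil_le.1 hj
    linarith
  simp [indicator, this]

/-- The flow of a mass preserving divergence-free field does not increase Lebesgue measure. -/
theorem lintegral_flow_le (hX : IsMassPreservingField X) {γ : (ι → ℂ) → ℝ → ι → ℂ}
    (h0 : ∀ a, γ a 0 = a) (hγ : ∀ a s, HasDerivAt (γ a) (X (γ a s)) s)
    {t : ℝ} (ht : 0 ≤ t) {g : (ι → ℂ) → ℝ≥0∞} (hg : Continuous g) :
    ∫⁻ a, g (γ a t) ≤ ∫⁻ a, g a := by
  -- Mass balls are invariant under the flow, so on each of them X may be replaced by a compactly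
  -- supported divergence-free field; monotone convergence then removes the restriction.
  set A : ℕ → Set (ι → ℂ) := fun j => {a | massSq a ≤ (j : ℝ) + 1} with hA
  have hAm : ∀ j, MeasurableSet (A j) := fun j =>
    (isClosed_le (contDiff_massSq (m := 0)).continuous continuous_const).measurableSet
  have hmono : Monotone A := fun i j hij a ha => by
    have h1 : massSq a ≤ (i : ℝ) + 1 := ha
    have h2 : (i : ℝ) ≤ j := Nat.cast_le.2 hij
    exact h1.trans (by linarith)
  have hunion : ⋃ j, A j = univ := by
    refine eq_univ_of_forall fun a => mem_iUnion.2 ⟨⌈massSq a⌉₊, ?_⟩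
    have : massSq a ≤ (⌈massSq a⌉₊ : ℝ) := Nat.le_ceil _
    change massSq a ≤ (⌈massSq a⌉₊ : ℝ) + 1
    linarith
  rw [← setLIntegral_univ (fun a => g (γ a t)), ← hunion,
    setLIntegral_iUnion_of_directed _ hmono.directed_le]
  refine iSup_le fun j => ?_
  have hj : (0 : ℝ) < (j : ℝ) + 1 := by positivity
  obtain ⟨K, hK⟩ := hX.exists_lipschitzWith_cutoffField hj
  obtain ⟨B, hB⟩ := hX.exists_bound_cutoffField hj
  exact setLIntegral_flow_le volume hK hB ((hX.contDiff_cutoffField _).differentiable one_ne_zero)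
    (hX.trace_fderiv_cutoffField _) (hAm j) (fun a _ => h0 a)
    (fun a ha => hX.hasDerivAt_cutoffField (hγ a) hj (by rw [h0]; exact ha)) ht hg

end IsMassPreservingField

end MassPreserving

end

noncomputable section

/-! ### The truncated Schrödinger field -/

/-- A real endomorphism of `ℂⁿ` whose complex linear part has purely imaginary entries is trace
free. -/
theorem trace_eq_zero_of_conj {ι : Type*} [Fintype ι] (T : (ι → ℂ) →ₗ[ℝ] (ι → ℂ))
    (h : ∀ b, star (T (star b)) - star (Complex.I • T (Complex.I • star b)) =
      -(T b - Complex.I • T (Complex.I • b))) :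
    LinearMap.trace ℝ (ι → ℂ) T = 0 := by
  classical
  let Q : (ι → ℂ) →ₗ[ℝ] (ι → ℂ) :=
    { toFun := fun b => Complex.I • b
      map_add' := fun a b => smul_add _ _ _
      map_smul' := fun r a => smul_comm _ _ _ }
  let P : (ι → ℂ) →ₗ[ℝ] (ι → ℂ) :=
    { toFun := fun b => star b
      map_add' := fun a b => star_add _ _
      map_smul' := fun r a => by ext; simp }
  have hQ : Q * Q = -1 := by
    exact LinearMap.ext fun b => by simp [Q, smul_smul]
  have hP : P * P = 1 := by
    exact LinearMap.ext fun b => star_star b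
  -- With Q multiplication by i, T - QTQ is twice the complex linear part of T. The hypothesis says
  -- that conjugation by the real structure P changes its sign, which forces its real trace to
  -- vanish.
  have h1 : P * (T - Q * T * Q) * P = -(T - Q * T * Q) := by
    refine LinearMap.ext fun b => ?_
    have := h b
    simpa [P, Q] using this
  have h2 : LinearMap.trace ℝ (ι → ℂ) (T - Q * T * Q) = 0 := by
    have h3 : LinearMap.trace ℝ (ι → ℂ) (P * (T - Q * T * Q) * P) =
        LinearMap.trace ℝ (ι → ℂ) (T - Q * T * Q) := by
      rw [LinearMap.trace_mul_comm, ← mul_assoc, hP, one_mul]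
    rw [h1, map_neg] at h3
    linarith
  -- By cyclicity and Q² = -1, the trace of T - QTQ is twice that of T.
  have h4 : LinearMap.trace ℝ (ι → ℂ) (Q * T * Q) = -LinearMap.trace ℝ (ι → ℂ) T := by
    have h5 : Q * (Q * T) = -T := by
      rw [← mul_assoc, hQ]
      exact LinearMap.ext fun b => by simp
    rw [LinearMap.trace_mul_comm, h5, map_neg]
  rw [map_sub, h4] at h2
  linarith

/-! ### The Hamiltonian field, its divergence and its conserved quantities in a commutative star
algebra. -/

section HamiltonianField

variable {ι : Type*} [Fintype ι] {W : Type*} [NormedCommRing W] [NormedAlgebra ℂ W]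

/-- The function with coefficients `a` in the modes `e`. -/
def modeSum (e : ι → W) (a : ι → ℂ) : W := ∑ n, a n • e n

variable (e : ι → W) (L : W →L[ℂ] ℂ) (z : ι → ℝ) (k : ℕ)

/-- `modeSum` as a continuous linear map. -/
def modeSumL : (ι → ℂ) →L[ℂ] W := ∑ n, (ContinuousLinearMap.proj n).smulRight (e n)

theorem modeSumL_apply (a : ι → ℂ) : modeSumL e a = modeSum e a := by
  simp [modeSumL, modeSum]

theorem modeSum_smul (c : ℂ) (a : ι → ℂ) : modeSum e (c • a) = c • modeSum e a := by
  rw [← modeSumL_apply, map_smul, modeSumL_apply]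

theorem contDiff_modeSum {m : WithTop ℕ∞} : ContDiff ℝ m (modeSum e) := by
  have : modeSum e = modeSumL e := by ext a; rw [modeSumL_apply]
  rw [this]
  exact ((modeSumL e).restrictScalars ℝ).contDiff

theorem hasDerivAt_modeSum {c : ℝ → ι → ℂ} {c' : ι → ℂ} {t : ℝ} (hc : HasDerivAt c c' t) :
    HasDerivAt (fun s => modeSum e (c s)) (modeSum e c') t := by
  have h := ((modeSumL e).restrictScalars ℝ).hasFDerivAt.comp_hasDerivAt t hc
  simp only [Function.comp_def, ContinuousLinearMap.coe_restrictScalars', modeSumL_apply] at h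
  exact h

theorem hasDerivAt_L {w : ℝ → W} {w' : W} {t : ℝ} (hw : HasDerivAt w w' t) :
    HasDerivAt (fun s => L (w s)) (L w') t :=
  (L.restrictScalars ℝ).hasFDerivAt.comp_hasDerivAt t hw

theorem hasDerivAt_modeSum_pow {c : ℝ → ι → ℂ} {c' : ι → ℂ} {t : ℝ} (hc : HasDerivAt c c' t)
    (m : ℕ) : HasDerivAt (fun s => modeSum e (c s) ^ m)
      ((m : W) * modeSum e (c t) ^ (m - 1) * modeSum e c') t := by
  have := (hasDerivAt_modeSum e hc).fun_pow m
  exact this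

variable [StarRing W] [StarModule ℂ W]

theorem star_modeSum (he : ∀ n, star (e n) = e n) (a : ι → ℂ) :
    star (modeSum e a) = modeSum e (star a) := by
  simp [modeSum, star_sum, star_smul, he]

/-- The Hamiltonian vector field of the truncated Schrödinger equation with nonlinearity
`|u|^{2k} u`, in an abstract commutative star algebra with integral `L`. -/
def hamField (e : ι → W) (L : W →L[ℂ] ℂ) (z : ι → ℝ) (k : ℕ) (a : ι → ℂ) (n : ι) : ℂ :=
  -Complex.I * ((z n : ℂ) ^ 2 * a n + L (modeSum e a ^ (k + 1) * star (modeSum e a) ^ k * e n))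

/-- The potential energy. -/
def potential (e : ι → W) (L : W →L[ℂ] ℂ) (k : ℕ) (a : ι → ℂ) : ℝ :=
  (1 / (2 * k + 2)) * (L (modeSum e a ^ (k + 1) * star (modeSum e a) ^ (k + 1))).re

/-- The total energy. -/
def hamEnergy (e : ι → W) (L : W →L[ℂ] ℂ) (z : ι → ℝ) (k : ℕ) (a : ι → ℂ) : ℝ :=
  (1 / 2) * ∑ n, z n ^ 2 * Complex.normSq (a n) + potential e L k a

theorem sum_star_mul_L (he : ∀ n, star (e n) = e n) (w : W) (b : ι → ℂ) :
    ∑ n, star (b n) * L (w * e n) = L (w * star (modeSum e b)) := by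
  rw [star_modeSum e he, modeSum, Finset.mul_sum, map_sum]
  simp

/-- The sum of conj(aₙ) Xₙ is -i times a real number: the quadratic part is real, and L takes a real
value on the self-adjoint element u^(k+1) ū^(k+1). -/
theorem hamField_mass (he : ∀ n, star (e n) = e n) (hL : ∀ w, L (star w) = star (L w))
    (a : ι → ℂ) : ∑ n, (star (a n) * hamField e L z k a n).re = 0 := by
  rw [← Complex.re_sum]
  have h1 : ∑ n, star (a n) * hamField e L z k a n = -Complex.I *
      (((∑ n, z n ^ 2 * Complex.normSq (a n) : ℝ) : ℂ) +
        L (modeSum e a ^ (k + 1) * star (modeSum e a) ^ (k + 1))) := by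
    rw [pow_succ (star (modeSum e a)), ← mul_assoc, ← sum_star_mul_L e L he, Complex.ofReal_sum,
      ← Finset.sum_add_distrib, Finset.mul_sum]
    refine Finset.sum_congr rfl fun n _ => ?_
    rw [Complex.ofReal_mul, Complex.normSq_eq_conj_mul_self, hamField, Complex.star_def]
    push_cast
    ring
  have h2 : (L (modeSum e a ^ (k + 1) * star (modeSum e a) ^ (k + 1))).im = 0 := by
    have := hL (modeSum e a ^ (k + 1) * star (modeSum e a) ^ (k + 1))
    rw [star_mul', star_pow, star_pow, star_star, mul_comm, Complex.star_def] at this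
    exact Complex.conj_eq_iff_im.1 this.symm
  rw [h1]
  generalize (∑ n, z n ^ 2 * Complex.normSq (a n)) = M
  simp [Complex.mul_re, h2]

variable [NormedStarGroup W]

theorem contDiff_star {m : WithTop ℕ∞} : ContDiff ℝ m (star : W → W) :=
  ((starL' ℝ : W ≃L[ℝ] W) : W →L[ℝ] W).contDiff

theorem contDiff_hamField {m : WithTop ℕ∞} : ContDiff ℝ m (hamField e L z k) := by
  refine contDiff_pi.2 fun n => ?_
  have hu := contDiff_modeSum (m := m) e
  have hs : ContDiff ℝ m fun a => star (modeSum e a) := contDiff_star.comp hu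
  have hL : ContDiff ℝ m L := (L.restrictScalars ℝ).contDiff
  have hw : ContDiff ℝ m fun a => modeSum e a ^ (k + 1) * star (modeSum e a) ^ k * e n :=
    ((hu.pow _).mul (hs.pow _)).mul contDiff_const
  exact contDiff_const.mul ((contDiff_const.mul (contDiff_apply ℝ ℂ n)).add (hL.comp hw))

theorem hasDerivAt_star_modeSum_pow {c : ℝ → ι → ℂ} {c' : ι → ℂ} {t : ℝ} (hc : HasDerivAt c c' t)
    (m : ℕ) : HasDerivAt (fun s => star (modeSum e (c s)) ^ m)
      ((m : W) * star (modeSum e (c t)) ^ (m - 1) * star (modeSum e c')) t := by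
  have := (hasDerivAt_modeSum e hc).star.fun_pow m
  exact this

/-- The differential is displayed as a complex linear part plus a conjugate linear part in b, ready
for the trace computation. At k = 0 the truncated exponent k - 1 is harmless, because its term
carries the factor k. -/
theorem fderiv_hamField_apply (a b : ι → ℂ) (n : ι) :
    fderiv ℝ (hamField e L z k) a b n = -Complex.I * ((z n : ℂ) ^ 2 * b n +
      (L ((((k + 1 : ℕ) : W) * modeSum e a ^ k * star (modeSum e a) ^ k) * modeSum e b * e n) +
        L (((k : W) * modeSum e a ^ (k + 1) * star (modeSum e a) ^ (k - 1)) *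
          star (modeSum e b) * e n))) := by
  have hline : HasDerivAt (fun r : ℝ => a + r • b) b 0 :=
    (((hasDerivAt_id (0 : ℝ)).smul_const b).const_add a).congr_deriv (by simp)
  have hd : HasFDerivAt (hamField e L z k) (fderiv ℝ (hamField e L z k) a) (a + (0 : ℝ) • b) := by
    simpa using ((contDiff_hamField (m := 1) e L z k).differentiable one_ne_zero a).hasFDerivAt
  have h1 : HasDerivAt (fun r : ℝ => hamField e L z k (a + r • b) n)
      (fderiv ℝ (hamField e L z k) a b n) 0 :=
    hasDerivAt_pi.1 (HasFDerivAt.comp_hasDerivAt 0 hd hline) n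
  have hn : HasDerivAt (fun r : ℝ => (a + r • b) n) (b n) 0 := hasDerivAt_pi.1 hline n
  have h2 := ((hn.const_mul ((z n : ℂ) ^ 2)).add (hasDerivAt_L L
    (((hasDerivAt_modeSum_pow e hline (k + 1)).mul (hasDerivAt_star_modeSum_pow e hline k)).mul_const
      (e n)))).const_mul (-Complex.I)
  have h3 := h1.unique h2
  rw [h3, ← map_add]
  simp only [zero_smul, add_zero, Nat.add_sub_cancel]
  congr 4
  ring

/-- The complex linear part has matrix -i(zₙ² δ + L(A eₘ eₙ)) with A self-adjoint, so its entries
are purely imaginary; the conjugate linear part does not affect the trace. -/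
theorem trace_fderiv_hamField (he : ∀ n, star (e n) = e n) (hL : ∀ w, L (star w) = star (L w))
    (a : ι → ℂ) : LinearMap.trace ℝ (ι → ℂ) (fderiv ℝ (hamField e L z k) a) = 0 := by
  refine trace_eq_zero_of_conj _ fun b => ?_
  ext n
  set A : W := ((k + 1 : ℕ) : W) * modeSum e a ^ k * star (modeSum e a) ^ k with hA
  set B : W := (k : W) * modeSum e a ^ (k + 1) * star (modeSum e a) ^ (k - 1) with hB
  have hstarA : star A = A := by
    simp only [hA, star_mul', star_pow, star_star, star_natCast]; ring
  have hAb : star (L (A * modeSum e (star b) * e n)) = L (A * modeSum e b * e n) := by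
    rw [← hL, star_mul', star_mul', hstarA, he, star_modeSum e he, star_star]
  have hI : modeSum e (Complex.I • b) = Complex.I • modeSum e b := modeSum_smul e _ _
  have hI' : modeSum e (Complex.I • star b) = Complex.I • modeSum e (star b) := modeSum_smul e _ _
  simp only [Pi.sub_apply, Pi.neg_apply, Pi.star_apply, Pi.smul_apply, ContinuousLinearMap.coe_coe,
    fderiv_hamField_apply, ← hA, ← hB, hI, hI', star_smul, mul_smul_comm, smul_mul_assoc, map_smul,
    smul_eq_mul, star_mul', star_add, star_neg, star_pow, star_star, hAb]
  simp only [Complex.star_def, Complex.conj_I, Complex.conj_ofReal]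
  ring_nf
  simp only [Complex.I_pow_three]
  ring

theorem isMassPreservingField_hamField (he : ∀ n, star (e n) = e n)
    (hL : ∀ w, L (star w) = star (L w)) : IsMassPreservingField (hamField e L z k) where
  contDiff := contDiff_hamField e L z k
  trace_eq_zero := trace_fderiv_hamField e L z k he hL
  mass := hamField_mass e L z k he hL

/-- The gradient of the potential is the nonlinear term of the field. Differentiating u^(k+1) and
ū^(k+1) gives two terms with equal real parts, which together cancel the factor 1/(2k + 2). -/
theorem hasDerivAt_potential (he : ∀ n, star (e n) = e n) (hL : ∀ w, L (star w) = star (L w))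
    {c : ℝ → ι → ℂ} {c' : ι → ℂ} {t : ℝ} (hc : HasDerivAt c c' t) :
    HasDerivAt (fun s => potential e L k (c s))
      (∑ n, star (c' n) * L (modeSum e (c t) ^ (k + 1) * star (modeSum e (c t)) ^ k * e n)).re t := by
  have h1 := hasDerivAt_L L ((hasDerivAt_modeSum_pow e hc (k + 1)).mul
    (hasDerivAt_star_modeSum_pow e hc (k + 1)))
  have h2 := (Complex.reCLM.hasFDerivAt.comp_hasDerivAt t h1).const_mul (1 / (2 * (k : ℝ) + 2))
  refine HasDerivAt.congr_deriv h2 ?_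
  rw [sum_star_mul_L e L he]
  set u := modeSum e (c t)
  set w := modeSum e c'
  simp only [Nat.add_sub_cancel, Complex.reCLM_apply]
  have h3 : (L (u ^ k * star u ^ (k + 1) * w)).re = (L (u ^ (k + 1) * star u ^ k * star w)).re := by
    have : u ^ (k + 1) * star u ^ k * star w = star (u ^ k * star u ^ (k + 1) * w) := by
      simp only [star_mul', star_pow, star_star]; ring
    rw [this, hL, Complex.star_def, Complex.conj_re]
  have h4 : ((k + 1 : ℕ) : W) * u ^ k * w * star u ^ (k + 1) +
      u ^ (k + 1) * (((k + 1 : ℕ) : W) * star u ^ k * star w) =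
      ((k + 1 : ℕ) : ℂ) • (u ^ k * star u ^ (k + 1) * w + u ^ (k + 1) * star u ^ k * star w) := by
    rw [Nat.cast_smul_eq_nsmul, nsmul_eq_mul]; ring
  rw [h4, map_smul, map_add, smul_eq_mul]
  have h5 : (((k + 1 : ℕ) : ℂ) * (L (u ^ k * star u ^ (k + 1) * w) +
      L (u ^ (k + 1) * star u ^ k * star w))).re =
      ((k : ℝ) + 1) * (2 * (L (u ^ (k + 1) * star u ^ k * star w)).re) := by
    rw [← Complex.ofReal_natCast, Complex.re_ofReal_mul, Complex.add_re, h3]; push_cast; ring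
  rw [h5]
  field_simp

/-- Conservation of energy. -/
theorem hamEnergy_eq (he : ∀ n, star (e n) = e n) (hL : ∀ w, L (star w) = star (L w))
    {γ : ℝ → ι → ℂ} (hγ : ∀ s, HasDerivAt γ (hamField e L z k (γ s)) s) (t : ℝ) :
    hamEnergy e L z k (γ t) = hamEnergy e L z k (γ 0) := by
  have h : ∀ s, HasDerivAt (fun s => hamEnergy e L z k (γ s)) 0 s := by
    intro s
    have hn : ∀ n, HasDerivAt (fun s => Complex.normSq (γ s n))
        (2 * (star (γ s n) * hamField e L z k (γ s) n).re) s := by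
      intro n
      have h1 : HasDerivAt (fun s => γ s n) (hamField e L z k (γ s) n) s := hasDerivAt_pi.1 (hγ s) n
      have hre : HasDerivAt (fun s => (γ s n).re) (hamField e L z k (γ s) n).re s :=
        Complex.reCLM.hasFDerivAt.comp_hasDerivAt s h1
      have him : HasDerivAt (fun s => (γ s n).im) (hamField e L z k (γ s) n).im s :=
        Complex.imCLM.hasFDerivAt.comp_hasDerivAt s h1
      refine HasDerivAt.congr_deriv ((hre.mul hre).add (him.mul him)) ?_
      simp [Complex.mul_re]; ring
    have h1 := (HasDerivAt.fun_sum fun n (_ : n ∈ Finset.univ) => (hn n).const_mul (z n ^ 2)).const_mul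
      (1 / 2 : ℝ)
    refine HasDerivAt.congr_deriv (h1.add (hasDerivAt_potential e L k he hL (hγ s))) ?_
    rw [Complex.re_sum, Finset.mul_sum, ← Finset.sum_add_distrib]
    -- Mode by mode, Xₙ is -i times the energy gradient, so its real pairing with that gradient is
    -- zero.
    refine Finset.sum_eq_zero fun n _ => ?_
    simp only [hamField]
    generalize L (modeSum e (γ s) ^ (k + 1) * star (modeSum e (γ s)) ^ k * e n) = G
    rw [← Complex.ofReal_pow]
    generalize z n ^ 2 = q
    simp [Complex.mul_re, Complex.mul_im]
    ring
  exact is_const_of_deriv_eq_zero (fun s => (h s).differentiableAt) (fun s => (h s).deriv) t 0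

end HamiltonianField

end

noncomputable section

/-! ### Solutions of the truncated equation in coordinates -/

open scoped BoundedContinuousFunction

/-- Lebesgue measure on the unit ball as a subtype. -/
def discSubtypeMeasure : Measure ↥unitDisc := Measure.comap Subtype.val volume

instance : IsFiniteMeasure discSubtypeMeasure :=
  ⟨by
    rw [discSubtypeMeasure, (MeasurableEmbedding.subtype_coe measurableSet_ball).comap_apply,
      image_univ, Subtype.range_coe]
    exact measure_ball_lt_top⟩

theorem integral_discSubtypeMeasure (f : Plane → ℂ) :
    ∫ x, f x ∂discSubtypeMeasure = ∫ x in unitDisc, f x :=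
  integral_subtype_comap measurableSet_ball f

/-- Integration over the unit ball as a functional on bounded continuous functions. -/
def discIntegral : (↥unitDisc →ᵇ ℂ) →L[ℂ] ℂ :=
  LinearMap.mkContinuous
    { toFun := fun w => ∫ x, w x ∂discSubtypeMeasure
      map_add' := fun v _ => integral_add (v.integrable _) (BoundedContinuousFunction.integrable _ _)
      map_smul' := fun c _ => integral_const_mul c _ }
    (discSubtypeMeasure.real univ)
    (BoundedContinuousFunction.norm_integral_le_mul_norm discSubtypeMeasure)

theorem discIntegral_apply (w : ↥unitDisc →ᵇ ℂ) :
    discIntegral w = ∫ x, w x ∂discSubtypeMeasure := rfl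

theorem discIntegral_star (w : ↥unitDisc →ᵇ ℂ) : discIntegral (star w) = star (discIntegral w) := by
  rw [discIntegral_apply, discIntegral_apply]
  exact integral_conj

namespace RadialEigensystem

variable (S : RadialEigensystem)

/-- The eigenfunctions as bounded continuous functions on the ball. -/
def discMode (n : ℕ) : ↥unitDisc →ᵇ ℂ :=
  BoundedContinuousFunction.ofNormedAddCommGroup (fun x : ↥unitDisc => (S.e n x : ℂ))
    (Complex.continuous_ofReal.comp (S.continuousOn_e n).domRestrict) (S.exists_abs_e_le n).choose
    fun x => by
      simpa using (S.exists_abs_e_le n).choose_spec x x.2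

theorem discMode_apply (n : ℕ) (x : ↥unitDisc) : S.discMode n x = (S.e n x : ℂ) := rfl

theorem star_discMode (n : ℕ) : star (S.discMode n) = S.discMode n := by
  ext x
  rw [BoundedContinuousFunction.star_apply, discMode_apply]
  exact Complex.conj_ofReal _

/-- The field of the truncated equation on the coefficients. -/
def discField (A : Finset ℕ) (k : ℕ) : (A → ℂ) → A → ℂ :=
  hamField (fun n : A => S.discMode n) discIntegral (fun n => S.z n) k

theorem isMassPreservingField_discField (A : Finset ℕ) (k : ℕ) :
    IsMassPreservingField (S.discField A k) :=
  isMassPreservingField_hamField _ _ _ _ (fun n => S.star_discMode n) discIntegral_star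

theorem modeSum_discMode_apply (A : Finset ℕ) (a : A → ℂ) (x : ↥unitDisc) :
    modeSum (fun n : A => S.discMode n) a x = ∑ n, a n * (S.e n x : ℂ) := by
  simp [modeSum, discMode_apply]

theorem coeff_eq_discIntegral {f : Plane → ℂ} {w : ↥unitDisc →ᵇ ℂ}
    (h : ∀ x : ↥unitDisc, f x = w x) (n : ℕ) : S.coeff f n = discIntegral (w * S.discMode n) := by
  rw [discIntegral_apply, coeff, ← integral_discSubtypeMeasure]
  refine integral_congr_ae (Filter.Eventually.of_forall fun x => ?_)
  simp [h, discMode_apply]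

theorem discIntegral_discMode_mul (n m : ℕ) :
    discIntegral (S.discMode n * S.discMode m) = if n = m then 1 else 0 := by
  have h := integral_discSubtypeMeasure (fun x => ((S.e n x * S.e m x : ℝ) : ℂ))
  have h2 : ∫ x in unitDisc, ((S.e n x * S.e m x : ℝ) : ℂ) =
      ((∫ x in unitDisc, S.e n x * S.e m x : ℝ) : ℂ) := integral_ofReal
  rw [h2, S.setIntegral_e_mul_e] at h
  rw [discIntegral_apply]
  simp only [BoundedContinuousFunction.coe_mul, Pi.mul_apply, discMode_apply]
  rw [← Complex.ofReal_one, ← Complex.ofReal_zero, ← apply_ite Complex.ofReal]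
  push_cast at h ⊢
  exact h

theorem coeff_sum (A : Finset ℕ) (a : A → ℂ) {f : Plane → ℂ}
    (h : ∀ x ∈ unitDisc, f x = ∑ n, a n * (S.e n x : ℂ)) (m : ℕ) :
    S.coeff f m = if hm : m ∈ A then a ⟨m, hm⟩ else 0 := by
  rw [S.coeff_eq_discIntegral (w := modeSum (fun n : A => S.discMode n) a)
    (fun x => by rw [modeSum_discMode_apply, h x x.2]), modeSum, Finset.sum_mul, map_sum]
  simp only [smul_mul_assoc, map_smul, discIntegral_discMode_mul, smul_eq_mul, mul_ite, mul_one,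
    mul_zero]
  split_ifs with hm
  · rw [Finset.sum_eq_single ⟨m, hm⟩]
    · simp
    · intro b _ hb
      exact if_neg fun e => hb (Subtype.ext e)
    · simp
  · exact Finset.sum_eq_zero fun b _ => if_neg fun (e : (b : ℕ) = m) => hm (e ▸ b.2)

theorem eq_of_sum_eq (A : Finset ℕ) {a b : A → ℂ}
    (h : ∀ x ∈ unitDisc, ∑ n, a n * (S.e n x : ℂ) = ∑ n, b n * (S.e n x : ℂ)) : a = b := by
  ext n
  have h1 := S.coeff_sum A a (fun x _ => rfl) n
  have h2 := S.coeff_sum A b h n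
  rw [h1] at h2
  simpa using h2

/-- The modes of frequency at most `N`. -/
def modes (N : ℕ) : Finset ℕ := (S.finite_z_le N).toFinset

theorem finsum_modes (N : ℕ) (f : ℕ → ℂ) :
    ∑ᶠ (n : ℕ) (_ : S.z n ≤ (N : ℝ)), f n = ∑ n : S.modes N, f n := by
  rw [Finset.sum_coe_sort (S.modes N) f]
  exact finsum_mem_eq_finite_toFinset_sum f (S.finite_z_le N)

theorem trunc_eq_sum (N : ℕ) (f : Plane → ℂ) (x : Plane) :
    S.trunc N f x = ∑ n : S.modes N, S.coeff f n * (S.e n x : ℂ) :=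
  S.finsum_modes N fun n => S.coeff f n * (S.e n x : ℂ)

/-- Every coordinate of a finite sum of modes is a combination of its values. -/
theorem mem_span_evaluation (A : Finset ℕ) (K : Module.Dual ℂ (A → ℂ)) :
    K ∈ Submodule.span ℂ (range fun x : ↥unitDisc =>
      (∑ n : A, (S.e n x : ℂ) • LinearMap.proj n : Module.Dual ℂ (A → ℂ))) := by
  set V := Submodule.span ℂ (range fun x : ↥unitDisc =>
      (∑ n : A, (S.e n x : ℂ) • LinearMap.proj n : Module.Dual ℂ (A → ℂ))) with hV
  -- A coefficient vector killed by all point evaluations is zero by orthonormality; in finite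
  -- dimension the evaluations then span the whole dual.
  have hbot : V.dualCoannihilator = ⊥ := by
    rw [eq_bot_iff]
    intro a ha
    rw [Submodule.mem_dualCoannihilator] at ha
    refine S.eq_of_sum_eq A fun x hx => ?_
    have := ha _ (Submodule.subset_span ⟨⟨x, hx⟩, rfl⟩)
    simpa [mul_comm] using this
  have htop : V = ⊤ := by
    rw [← Subspace.dualCoannihilator_dualAnnihilator_eq (W := V), hbot,
      Submodule.dualAnnihilator_bot]
  rw [htop]; trivial

/-- Differentiability in time is only given at each fixed point of the ball. It passes to the
coefficients because each of them is a finite combination of point values, with no differentiation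
under an integral. -/
theorem differentiable_of_sum (A : Finset ℕ) {a : ℝ → A → ℂ}
    (h : ∀ x ∈ unitDisc, Differentiable ℝ fun t => ∑ n, a t n * (S.e n x : ℂ)) :
    Differentiable ℝ a := by
  refine differentiable_pi.2 fun n => ?_
  have key : ∀ K : Module.Dual ℂ (A → ℂ), Differentiable ℝ fun t => K (a t) := by
    intro K
    refine Submodule.span_induction (p := fun K _ => Differentiable ℝ fun t => K (a t))
      ?_ ?_ ?_ ?_ (S.mem_span_evaluation A K)
    · rintro _ ⟨x, rfl⟩
      have := h x x.2
      simpa [mul_comm] using this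
    · simp
    · intro K₁ K₂ _ _ h1 h2
      exact h1.add h2
    · intro c K _ h1
      exact h1.const_mul c
  exact key (LinearMap.proj n)

theorem contDiffAt_ofReal_e (n : ℕ) {x : Plane} (hx : x ∈ unitDisc) :
    ContDiffAt ℝ 2 (fun y => (S.e n y : ℂ)) x :=
  Complex.ofRealCLM.contDiff.contDiffAt.comp x
    ((S.eigen n).contDiffOn.contDiffAt (Metric.isOpen_ball.mem_nhds hx))

theorem laplacian_ofReal_e (n : ℕ) {x : Plane} (hx : x ∈ unitDisc) :
    Laplacian.laplacian (fun y => (S.e n y : ℂ)) x = -((S.z n : ℂ) ^ 2 * S.e n x) := by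
  have h1 := ((S.eigen n).contDiffOn.contDiffAt
    (Metric.isOpen_ball.mem_nhds hx)).laplacian_CLM_comp_left (l := Complex.ofRealCLM)
  have h2 := (S.eigen n).equation x hx
  have h3 : Laplacian.laplacian (S.e n) x = -(S.z n ^ 2 * S.e n x) := by linarith
  refine h1.trans ?_
  rw [Function.comp_apply, h3]
  simp

theorem laplacian_sum_e (A : Finset ℕ) (a : ℕ → ℂ) {x : Plane} (hx : x ∈ unitDisc) :
    Laplacian.laplacian (fun y => ∑ n ∈ A, a n * (S.e n y : ℂ)) x =
      ∑ n ∈ A, -((S.z n : ℂ) ^ 2 * a n) * S.e n x := by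
  classical
  induction A using Finset.induction_on with
  | empty =>
    simp only [Finset.sum_empty]
    exact congrFun InnerProductSpace.laplacian_const x
  | insert m A hm ih =>
    have hc : ∀ n, ContDiffAt ℝ 2 (fun y => a n * (S.e n y : ℂ)) x := fun n =>
      contDiffAt_const.mul (S.contDiffAt_ofReal_e n hx)
    simp only [Finset.sum_insert hm]
    have h1 := ContDiffAt.laplacian_add (hc m)
      (ContDiffAt.sum (s := A) fun n _ => hc n)
    refine h1.trans ?_
    rw [ih]
    congr 1
    have h2 := InnerProductSpace.laplacian_smul (a m) (S.contDiffAt_ofReal_e m hx)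
    refine h2.trans ?_
    rw [S.laplacian_ofReal_e m hx, smul_eq_mul]; ring

variable {S}

namespace IsTruncatedSolution

variable {N k : ℕ} {φ : Plane → ℂ} {u : ℝ → Plane → ℂ}

theorem eq_sum {α : ℕ} (h : S.IsTruncatedSolution α N φ u) (t : ℝ) {x : Plane}
    (hx : x ∈ unitDisc) : u t x = ∑ n : S.modes N, S.coeff (u t) n * (S.e n x : ℂ) := by
  obtain ⟨a, ha⟩ := h.mem_span t
  have ha' : ∀ x ∈ unitDisc, u t x = ∑ n : S.modes N, a n * (S.e n x : ℂ) := fun x hx => by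
    rw [ha x hx]; exact S.finsum_modes N fun n => a n * (S.e n x : ℂ)
  rw [ha' x hx]
  refine Finset.sum_congr rfl fun n _ => ?_
  rw [S.coeff_sum (S.modes N) (fun n => a n) ha', dif_pos n.2]

theorem coeff_eq_zero {α : ℕ} (h : S.IsTruncatedSolution α N φ u) (t : ℝ) {m : ℕ}
    (hm : m ∉ S.modes N) : S.coeff (u t) m = 0 := by
  rw [S.coeff_sum (S.modes N) (fun n => S.coeff (u t) n) (fun x hx => h.eq_sum t hx), dif_neg hm]

theorem coeff_zero {α : ℕ} (h : S.IsTruncatedSolution α N φ u) (n : S.modes N) :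
    S.coeff (u 0) n = S.coeff φ n := by
  have := S.coeff_sum (S.modes N) (fun n => S.coeff φ n) (f := u 0)
    (fun x hx => by rw [h.initial x hx, trunc_eq_sum]) n
  rw [this, dif_pos n.2]

/-- The coefficients of a solution satisfy the ordinary differential equation. -/
theorem hasDerivAt_coeff (h : S.IsTruncatedSolution (2 * k) N φ u) (t : ℝ) :
    HasDerivAt (fun s (n : S.modes N) => S.coeff (u s) n)
      (S.discField (S.modes N) k fun n => S.coeff (u t) n) t := by
  set a : ℝ → S.modes N → ℂ := fun s n => S.coeff (u s) n with ha
  have hu : ∀ s, ∀ x ∈ unitDisc, u s x = ∑ n, a s n * (S.e n x : ℂ) := fun s x hx => h.eq_sum s hx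
  have hdiff : Differentiable ℝ a := by
    refine S.differentiable_of_sum (S.modes N) fun x hx => ?_
    have := h.differentiable x hx
    simpa only [hu _ x hx] using this
  have hd := (hdiff t).hasDerivAt
  refine hd.congr_deriv ?_
  set w := modeSum (fun n : S.modes N => S.discMode n) (a t) with hw
  have hwx : ∀ x : ↥unitDisc, w x = u t x := fun x => by
    rw [hw, modeSum_discMode_apply, hu t x x.2]
  -- Evenness of the exponent enters here: |u|^(2k) u = u^(k+1) ū^k is a polynomial in u and its
  -- conjugate.
  have hnl : ∀ n, S.coeff (fun y => ((‖u t y‖ ^ (2 * k) : ℝ) : ℂ) * u t y) n =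
      discIntegral (w ^ (k + 1) * star w ^ k * S.discMode n) := by
    refine S.coeff_eq_discIntegral fun x => ?_
    simp only [BoundedContinuousFunction.coe_mul, BoundedContinuousFunction.coe_pow, Pi.mul_apply,
      Pi.pow_apply, BoundedContinuousFunction.star_apply, hwx]
    rw [pow_mul, Complex.ofReal_pow, Complex.ofReal_pow, ← Complex.mul_conj', Complex.star_def]
    ring
  -- The equation, pointwise on the ball, says that a finite sum of modes vanishes, so its
  -- coefficients vanish.
  have key : (fun n => Complex.I * deriv a t n - (S.z n : ℂ) ^ 2 * a t n -
      discIntegral (w ^ (k + 1) * star w ^ k * S.discMode n)) = (0 : S.modes N → ℂ) := by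
    refine S.eq_of_sum_eq (S.modes N) fun x hx => ?_
    have heq := h.equation t x hx
    have h1 : deriv (fun s => u s x) t = ∑ n, deriv a t n * (S.e n x : ℂ) := by
      refine HasDerivAt.deriv ?_
      simp only [hu _ x hx]
      exact HasDerivAt.fun_sum fun n _ => (hasDerivAt_pi.1 hd n).mul_const _
    have h2 : Laplacian.laplacian (u t) x = ∑ n : S.modes N, -((S.z n : ℂ) ^ 2 * a t n) * S.e n x := by
      have hev : u t =ᶠ[nhds x] fun y => ∑ n ∈ S.modes N, S.coeff (u t) n * (S.e n y : ℂ) := by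
        filter_upwards [Metric.isOpen_ball.mem_nhds hx] with y hy
        rw [hu t y hy]
        exact Finset.sum_coe_sort (S.modes N) fun n => S.coeff (u t) n * (S.e n y : ℂ)
      rw [(InnerProductSpace.laplacian_congr_nhds hev).self_of_nhds, S.laplacian_sum_e _ _ hx]
      exact (Finset.sum_coe_sort (S.modes N)
        fun n => -((S.z n : ℂ) ^ 2 * S.coeff (u t) n) * (S.e n x : ℂ)).symm
    rw [h1, h2, trunc_eq_sum, Finset.mul_sum, ← Finset.sum_add_distrib,
      ← Finset.sum_sub_distrib] at heq
    simp only [Pi.zero_apply, zero_mul, Finset.sum_const_zero]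
    rw [← heq]
    refine Finset.sum_congr rfl fun n _ => ?_
    rw [hnl]; ring
  ext n
  have := congrFun key n
  simp only [Pi.zero_apply] at this
  change deriv a t n = -Complex.I * ((S.z n : ℂ) ^ 2 * a t n +
    discIntegral (w ^ (k + 1) * star w ^ k * S.discMode n))
  linear_combination (-Complex.I) * this + deriv a t n * Complex.I_sq

end IsTruncatedSolution

end RadialEigensystem

end

noncomputable section

/-! ### Complex Gaussian vectors -/

section ComplexGaussian

/-- The density of a complex Gaussian. -/
def complexGaussianPDF (v : ℝ≥0) (w : ℂ) : ℝ≥0∞ := gaussianPDF 0 v w.re * gaussianPDF 0 v w.im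

theorem measurable_complexGaussianPDF (v : ℝ≥0) : Measurable (complexGaussianPDF v) :=
  ((measurable_gaussianPDF 0 v).comp Complex.measurable_re).mul
    ((measurable_gaussianPDF 0 v).comp Complex.measurable_im)

theorem complexGaussianPDF_eq (v : ℝ≥0) (w : ℂ) : complexGaussianPDF v w =
    ENNReal.ofReal ((√(2 * Real.pi * v))⁻¹ ^ 2) *
      ENNReal.ofReal (Real.exp (-(Complex.normSq w / (2 * v)))) := by
  rw [complexGaussianPDF, gaussianPDF, gaussianPDF, gaussianPDFReal, gaussianPDFReal,
    ← ENNReal.ofReal_mul (by positivity), ← ENNReal.ofReal_mul (by positivity), mul_mul_mul_comm,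
    ← Real.exp_add, Complex.normSq_apply]
  congr 2
  · ring
  · congr 1; ring

theorem lintegral_complexGaussian {v : ℝ≥0} (hv : v ≠ 0) {f : ℂ → ℝ≥0∞} (hf : Measurable f) :
    ∫⁻ w, f w ∂complexGaussian v = ∫⁻ w, complexGaussianPDF v w * f w := by
  have hρ : Measurable fun z : ℝ × ℝ => gaussianPDF 0 v z.1 * gaussianPDF 0 v z.2 :=
    ((measurable_gaussianPDF 0 v).comp measurable_fst).mul
      ((measurable_gaussianPDF 0 v).comp measurable_snd)
  have h1 := lintegral_withDensity_eq_lintegral_mul (volume.prod volume) hρ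
    (hf.comp measurable_complexMk)
  have h2 := Complex.volume_preserving_equiv_real_prod.lintegral_comp_emb
    Complex.measurableEquivRealProd.measurableEmbedding
    fun z : ℝ × ℝ => gaussianPDF 0 v z.1 * gaussianPDF 0 v z.2 * f ⟨z.1, z.2⟩
  rw [complexGaussian, lintegral_map hf measurable_complexMk, gaussianReal_of_var_ne_zero 0 hv,
    prod_withDensity (measurable_gaussianPDF 0 v) (measurable_gaussianPDF 0 v)]
  exact h1.trans h2.symm

/-- Expressing Lebesgue measure by a density relative to a probability measure lets the product case
follow from independence of coordinates. -/
theorem volume_eq_withDensity_complexGaussian {v : ℝ≥0} (hv : v ≠ 0) :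
    (volume : Measure ℂ) = (complexGaussian v).withDensity fun w => (complexGaussianPDF v w)⁻¹ := by
  have hm : Measurable fun w => (complexGaussianPDF v w)⁻¹ := (measurable_complexGaussianPDF v).inv
  ext s hs
  rw [withDensity_apply _ hs, ← lintegral_indicator hs,
    lintegral_complexGaussian hv (hm.indicator hs), ← lintegral_indicator_one hs]
  refine lintegral_congr fun w => ?_
  by_cases hw : w ∈ s
  · simp only [indicator_of_mem hw, Pi.one_apply]
    rw [ENNReal.mul_inv_cancel]
    · exact mul_ne_zero (gaussianPDF_pos 0 hv _).ne' (gaussianPDF_pos 0 hv _).ne'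
    · exact ENNReal.mul_ne_top gaussianPDF_ne_top gaussianPDF_ne_top
  · simp [indicator_of_notMem hw]

variable {ι : Type*} [Fintype ι]

theorem lintegral_pi_prod {X : ι → Type*} [∀ i, MeasurableSpace (X i)] (μ : ∀ i, Measure (X i))
    [∀ i, IsProbabilityMeasure (μ i)] {f : ∀ i, X i → ℝ≥0∞} (hf : ∀ i, Measurable (f i)) :
    ∫⁻ x, ∏ i, f i (x i) ∂Measure.pi μ = ∏ i, ∫⁻ y, f i y ∂μ i := by
  have hind : iIndepFun (fun i (x : ∀ i, X i) => f i (x i)) (Measure.pi μ) :=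
    iIndepFun_pi fun i => (hf i).aemeasurable
  rw [lintegral_prod_eq_prod_lintegral_of_indepFun Finset.univ _ hind
    (fun i => (hf i).comp (measurable_pi_apply i))]
  refine Finset.prod_congr rfl fun i _ => ?_
  rw [← lintegral_map (f := f i) (hf i) (measurable_pi_apply i)]
  congr 1
  exact (measurePreserving_eval μ i).map_eq

/-- Integrals against a Gaussian vector in terms of its density. -/
theorem lintegral_pi_complexGaussian {v : ι → ℝ≥0} (hv : ∀ i, v i ≠ 0) {h : (ι → ℂ) → ℝ≥0∞}
    (hh : Measurable h) : ∫⁻ a, h a ∂Measure.pi (fun i => complexGaussian (v i)) =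
      ∫⁻ a, (∏ i, complexGaussianPDF (v i) (a i)) * h a := by
  set r : (ι → ℂ) → ℝ≥0∞ := fun a => ∏ i, (complexGaussianPDF (v i) (a i))⁻¹ with hr
  set ρ : (ι → ℂ) → ℝ≥0∞ := fun a => ∏ i, complexGaussianPDF (v i) (a i) with hρ
  have hrm : Measurable r := Finset.measurable_fun_prod _ fun i _ =>
    ((measurable_complexGaussianPDF (v i)).inv).comp (measurable_pi_apply i)
  have hρm : Measurable ρ := Finset.measurable_fun_prod _ fun i _ =>
    (measurable_complexGaussianPDF (v i)).comp (measurable_pi_apply i)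
  have hvol : (volume : Measure (ι → ℂ)) =
      (Measure.pi fun i => complexGaussian (v i)).withDensity r := by
    refine Measure.pi_eq fun s hs => ?_
    have hset : MeasurableSet (univ.pi s) := MeasurableSet.univ_pi hs
    rw [withDensity_apply _ hset, ← lintegral_indicator hset]
    have e1 : ∀ a, (univ.pi s).indicator r a =
        ∏ i, (s i).indicator (fun w => (complexGaussianPDF (v i) w)⁻¹) (a i) := by
      intro a
      by_cases ha : a ∈ univ.pi s
      · rw [indicator_of_mem ha]
        exact Finset.prod_congr rfl fun i _ =>
          (indicator_of_mem (ha i (mem_univ i)) (fun w => (complexGaussianPDF (v i) w)⁻¹)).symm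
      · rw [indicator_of_notMem ha]
        have : ∃ i, a i ∉ s i := by simpa [mem_univ_pi] using ha
        obtain ⟨i, hi⟩ := this
        exact (Finset.prod_eq_zero (Finset.mem_univ i) (indicator_of_notMem hi _)).symm
    simp_rw [e1]
    rw [lintegral_pi_prod (fun i => complexGaussian (v i))
      (f := fun i => (s i).indicator fun w => (complexGaussianPDF (v i) w)⁻¹)
      fun i => ((measurable_complexGaussianPDF (v i)).inv).indicator (hs i)]
    refine Finset.prod_congr rfl fun i _ => ?_
    rw [lintegral_indicator (hs i), ← withDensity_apply _ (hs i),
      ← volume_eq_withDensity_complexGaussian (hv i)]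
  rw [hvol]
  refine (Eq.trans (lintegral_withDensity_eq_lintegral_mul _ hrm (hρm.mul hh))
    (lintegral_congr fun a => ?_)).symm
  have : r a * ρ a = 1 := by
    simp only [hr, hρ]
    rw [← Finset.prod_mul_distrib]
    refine Finset.prod_eq_one fun i _ => ENNReal.inv_mul_cancel ?_ ?_
    · exact mul_ne_zero (gaussianPDF_pos 0 (hv i) _).ne' (gaussianPDF_pos 0 (hv i) _).ne'
    · exact ENNReal.mul_ne_top gaussianPDF_ne_top gaussianPDF_ne_top
  simp only [Pi.mul_apply]
  rw [← mul_assoc, this, one_mul]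

theorem complexGaussian_map_mul (v : ℝ≥0) (c : ℝ) :
    (complexGaussian v).map (fun w => (c : ℂ) * w) = complexGaussian (Real.toNNReal (c ^ 2) * v) := by
  rw [complexGaussian, complexGaussian, Measure.map_map (by fun_prop) measurable_complexMk]
  have h1 : (gaussianReal 0 v).map (c * ·) = gaussianReal 0 (Real.toNNReal (c ^ 2) * v) := by
    rw [gaussianReal_map_const_mul, mul_zero]
    congr 2
    ext; simp [Real.coe_toNNReal _ (sq_nonneg c)]
  have hm : Measurable fun x : ℝ => c * x := by fun_prop
  have h2 := Measure.map_prod_map (gaussianReal 0 v) (gaussianReal 0 v) hm hm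
  rw [← h1, h2, Measure.map_map measurable_complexMk (hm.prodMap hm)]
  congr 1
  ext a
  simp [Complex.ext_iff]

theorem lintegral_exp_re_complexGaussian (v : ℝ≥0) (c : ℝ) :
    ∫⁻ w, ENNReal.ofReal (Real.exp (c * w.re)) ∂complexGaussian v =
      ENNReal.ofReal (Real.exp (v * c ^ 2 / 2)) := by
  have hm : (complexGaussian v).map Complex.re = gaussianReal 0 v := by
    rw [complexGaussian, Measure.map_map Complex.measurable_re measurable_complexMk]
    exact measurePreserving_fst.map_eq
  have h1 := mgf_gaussianReal hm c
  rw [← ofReal_integral_eq_lintegral_ofReal]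
  · rw [mgf] at h1; rw [h1]; simp
  · have := integrable_exp_mul_gaussianReal (μ := 0) (v := v) c
    rw [← hm] at this
    exact (integrable_map_measure (by fun_prop) Complex.measurable_re.aemeasurable).1 this
  · exact Filter.Eventually.of_forall fun _ => (Real.exp_pos _).le

theorem lintegral_exp_im_complexGaussian (v : ℝ≥0) (c : ℝ) :
    ∫⁻ w, ENNReal.ofReal (Real.exp (c * w.im)) ∂complexGaussian v =
      ENNReal.ofReal (Real.exp (v * c ^ 2 / 2)) := by
  have hm : (complexGaussian v).map Complex.im = gaussianReal 0 v := by
    rw [complexGaussian, Measure.map_map Complex.measurable_im measurable_complexMk]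
    exact measurePreserving_snd.map_eq
  have h1 := mgf_gaussianReal hm c
  rw [← ofReal_integral_eq_lintegral_ofReal]
  · rw [mgf] at h1; rw [h1]; simp
  · have := integrable_exp_mul_gaussianReal (μ := 0) (v := v) c
    rw [← hm] at this
    exact (integrable_map_measure (by fun_prop) Complex.measurable_im.aemeasurable).1 this
  · exact Filter.Eventually.of_forall fun _ => (Real.exp_pos _).le

theorem lintegral_exp_sum_re (v : ι → ℝ≥0) (c : ι → ℝ) (τ : ℝ) :
    ∫⁻ a, ENNReal.ofReal (Real.exp (τ * ∑ i, c i * (a i).re))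
      ∂Measure.pi (fun i => complexGaussian (v i)) =
      ENNReal.ofReal (Real.exp (τ ^ 2 * (∑ i, c i ^ 2 * v i) / 2)) := by
  have e : ∀ a : ι → ℂ, ENNReal.ofReal (Real.exp (τ * ∑ i, c i * (a i).re)) =
      ∏ i, ENNReal.ofReal (Real.exp (τ * c i * (a i).re)) := fun a => by
    rw [← ENNReal.ofReal_prod_of_nonneg fun _ _ => (Real.exp_pos _).le, ← Real.exp_sum,
      Finset.mul_sum]
    simp only [mul_assoc]
  simp_rw [e]
  rw [lintegral_pi_prod (fun i => complexGaussian (v i))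
    (f := fun i w => ENNReal.ofReal (Real.exp (τ * c i * w.re))) fun i => by fun_prop]
  simp_rw [lintegral_exp_re_complexGaussian]
  rw [← ENNReal.ofReal_prod_of_nonneg fun _ _ => (Real.exp_pos _).le, ← Real.exp_sum,
    Finset.mul_sum, Finset.sum_div]
  congr 3; ext i; ring

theorem lintegral_exp_sum_im (v : ι → ℝ≥0) (c : ι → ℝ) (τ : ℝ) :
    ∫⁻ a, ENNReal.ofReal (Real.exp (τ * ∑ i, c i * (a i).im))
      ∂Measure.pi (fun i => complexGaussian (v i)) =
      ENNReal.ofReal (Real.exp (τ ^ 2 * (∑ i, c i ^ 2 * v i) / 2)) := by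
  have e : ∀ a : ι → ℂ, ENNReal.ofReal (Real.exp (τ * ∑ i, c i * (a i).im)) =
      ∏ i, ENNReal.ofReal (Real.exp (τ * c i * (a i).im)) := fun a => by
    rw [← ENNReal.ofReal_prod_of_nonneg fun _ _ => (Real.exp_pos _).le, ← Real.exp_sum,
      Finset.mul_sum]
    simp only [mul_assoc]
  simp_rw [e]
  rw [lintegral_pi_prod (fun i => complexGaussian (v i))
    (f := fun i w => ENNReal.ofReal (Real.exp (τ * c i * w.im))) fun i => by fun_prop]
  simp_rw [lintegral_exp_im_complexGaussian]
  rw [← ENNReal.ofReal_prod_of_nonneg fun _ _ => (Real.exp_pos _).le, ← Real.exp_sum,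
    Finset.mul_sum, Finset.sum_div]
  congr 3; ext i; ring

/-- The modulus is at most twice the larger of |Re w| and |Im w|; this reduces exponential moments
of the modulus to those of real linear forms. -/
theorem exp_norm_le (w : ℂ) : Real.exp ‖w‖ ≤ Real.exp (2 * w.re) + Real.exp (-2 * w.re) +
    (Real.exp (2 * w.im) + Real.exp (-2 * w.im)) := by
  have h1 := Complex.norm_le_abs_re_add_abs_im w
  have h2 : ∀ x : ℝ, Real.exp (2 * |x|) ≤ Real.exp (2 * x) + Real.exp (-2 * x) := fun x => by
    rcases abs_cases x with ⟨h, _⟩ | ⟨h, _⟩ <;> rw [h]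
    · linarith [Real.exp_pos (-2 * x)]
    · rw [mul_neg, ← neg_mul]; linarith [Real.exp_pos (2 * x)]
  rcases le_total |w.re| |w.im| with h | h
  · have := Real.exp_le_exp.2 (show ‖w‖ ≤ 2 * |w.im| by linarith)
    linarith [h2 w.im, Real.exp_pos (2 * w.re), Real.exp_pos (-2 * w.re)]
  · have := Real.exp_le_exp.2 (show ‖w‖ ≤ 2 * |w.re| by linarith)
    linarith [h2 w.re, Real.exp_pos (2 * w.im), Real.exp_pos (-2 * w.im)]

/-- Moments of linear combinations of complex Gaussians. -/
theorem lintegral_enorm_sum_pow_le (v : ι → ℝ≥0) (c : ι → ℝ) {d : ℝ} (hd : 0 < d)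
    (hs : ∑ i, c i ^ 2 * v i ≤ d ^ 2) (m : ℕ) :
    ∫⁻ a, ‖∑ i, (c i : ℂ) * a i‖ₑ ^ m ∂Measure.pi (fun i => complexGaussian (v i)) ≤
      ENNReal.ofReal (4 * Real.exp 2 * d ^ m * m.factorial) := by
  -- From x^m/m! ≤ e^x at x = ‖w‖/d. Each of the four exponentials then has mean at most e², since
  -- (2/d)² d²/2 = 2.
  have hpt : ∀ a : ι → ℂ, ‖∑ i, (c i : ℂ) * a i‖ₑ ^ m ≤
      ENNReal.ofReal (d ^ m * m.factorial) *
        (ENNReal.ofReal (Real.exp ((2 / d) * ∑ i, c i * (a i).re)) +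
          ENNReal.ofReal (Real.exp ((-2 / d) * ∑ i, c i * (a i).re)) +
        (ENNReal.ofReal (Real.exp ((2 / d) * ∑ i, c i * (a i).im)) +
          ENNReal.ofReal (Real.exp ((-2 / d) * ∑ i, c i * (a i).im)))) := by
    intro a
    set w : ℂ := ∑ i, (c i : ℂ) * a i with hw
    have hre : w.re = ∑ i, c i * (a i).re := by simp [hw]
    have him : w.im = ∑ i, c i * (a i).im := by simp [hw]
    rw [← hre, ← him, ← ENNReal.ofReal_add (by positivity) (by positivity),
      ← ENNReal.ofReal_add (by positivity) (by positivity),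
      ← ENNReal.ofReal_add (by positivity) (by positivity),
      ← ENNReal.ofReal_mul (by positivity), ← ofReal_norm, ← ENNReal.ofReal_pow (norm_nonneg _)]
    refine ENNReal.ofReal_le_ofReal ?_
    have h1 := Real.pow_div_factorial_le_exp (‖w‖ / d) (by positivity) m
    have h2 := exp_norm_le ((d⁻¹ : ℝ) * w)
    rw [norm_mul, Complex.norm_real, Real.norm_eq_abs, abs_of_pos (inv_pos.2 hd),
      Complex.re_ofReal_mul, Complex.im_ofReal_mul, ← div_eq_inv_mul] at h2
    have h3 := h1.trans h2
    rw [div_pow, div_div, div_le_iff₀ (by positivity)] at h3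
    refine h3.trans (le_of_eq ?_)
    have e1 : ∀ y : ℝ, 2 * (d⁻¹ * y) = 2 / d * y := fun y => by ring
    have e2 : ∀ y : ℝ, -2 * (d⁻¹ * y) = -2 / d * y := fun y => by ring
    simp only [e1, e2]
    ring
  refine (lintegral_mono hpt).trans ?_
  rw [lintegral_const_mul _ (by fun_prop), lintegral_add_left (by fun_prop),
    lintegral_add_left (by fun_prop), lintegral_add_left (by fun_prop), lintegral_exp_sum_re,
    lintegral_exp_sum_re, lintegral_exp_sum_im, lintegral_exp_sum_im]
  have hb : ∀ τ : ℝ, τ ^ 2 = 4 / d ^ 2 →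
      ENNReal.ofReal (Real.exp (τ ^ 2 * (∑ i, c i ^ 2 * v i) / 2)) ≤
      ENNReal.ofReal (Real.exp 2) := by
    intro τ hτ
    refine ENNReal.ofReal_le_ofReal (Real.exp_le_exp.2 ?_)
    rw [hτ, div_mul_eq_mul_div, div_div, div_le_iff₀ (by positivity)]
    linarith
  have e1 := hb (2 / d) (by ring)
  have e2 := hb (-2 / d) (by ring)
  calc _ ≤ ENNReal.ofReal (d ^ m * m.factorial) * (ENNReal.ofReal (Real.exp 2) +
        ENNReal.ofReal (Real.exp 2) + (ENNReal.ofReal (Real.exp 2) + ENNReal.ofReal (Real.exp 2))) := by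
        gcongr
    _ = _ := by
      rw [← ENNReal.ofReal_add (by positivity) (by positivity),
        ← ENNReal.ofReal_add (by positivity) (by positivity), ← ENNReal.ofReal_mul (by positivity)]
      congr 1; ring

end ComplexGaussian

end

noncomputable section

/-! ### Moments of mixed norms -/

section MixedNorm

/-- Hölder on a space of finite measure. The maximum with 1 makes the constant the r-th power of a
number independent of r, so that it only rescales the exponential rate later. -/
theorem eLpNorm_pow_le_lintegral {α ε : Type*} [MeasurableSpace α] [TopologicalSpace ε]
    [ContinuousENorm ε] {μ : Measure α} {p : ℝ≥0∞} (hp : p ≠ 0) {r : ℕ} (hr : p ≤ r) {f : α → ε}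
    (hf : AEStronglyMeasurable f μ) :
    eLpNorm f p μ ^ r ≤ (max 1 (μ univ) ^ (1 / p.toReal)) ^ r * ∫⁻ x, ‖f x‖ₑ ^ r ∂μ := by
  have hr0 : r ≠ 0 := by
    rintro rfl
    exact hp (le_antisymm (by simpa using hr) bot_le)
  have hpt : 0 < p.toReal := ENNReal.toReal_pos hp (ne_top_of_le_ne_top (by simp) hr)
  have hpr : p.toReal ≤ r := by simpa using ENNReal.toReal_mono (by simp) hr
  have h1 := eLpNorm_le_eLpNorm_mul_rpow_measure_univ hr hf
  have h2 : μ univ ^ (1 / p.toReal - 1 / (r : ℝ≥0∞).toReal) ≤ max 1 (μ univ) ^ (1 / p.toReal) := by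
    have e : 0 ≤ 1 / p.toReal - 1 / (r : ℝ≥0∞).toReal := by
      rw [sub_nonneg]; simpa using one_div_le_one_div_of_le hpt hpr
    refine (ENNReal.rpow_le_rpow (le_max_right 1 _) e).trans
      (ENNReal.rpow_le_rpow_of_exponent_le (le_max_left _ _) ?_)
    simp
  have h3 : eLpNorm f r μ ^ r = ∫⁻ x, ‖f x‖ₑ ^ r ∂μ := by
    rw [eLpNorm_eq_lintegral_rpow_enorm_toReal (by simpa using hr0) (by simp), ← ENNReal.rpow_natCast,
      ← ENNReal.rpow_mul]
    simp [hr0]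
  calc _ ≤ (eLpNorm f r μ * max 1 (μ univ) ^ (1 / p.toReal)) ^ r := by gcongr; exact h1.trans (by gcongr)
    _ = _ := by rw [mul_pow, h3, mul_comm]

/-- The constant in the comparison of a mixed norm with moments. -/
def mixedNormConst (p q : ℝ≥0∞) (T : ℝ) (W : Plane → ℝ≥0∞) : ℝ≥0∞ :=
  max 1 (∫⁻ x in unitDisc, W x ^ p.toReal) ^ (1 / p.toReal) *
    max 1 (ENNReal.ofReal T) ^ (1 / q.toReal)

/-- The L^p norm of g equals that of g/W against W^p dx, and Hölder is applied for this measure. The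
high moments of the field have a singularity W^r at the origin that need not be integrable for large
r; dividing by W first leaves only the integrability of W^p. -/
theorem mixedNorm_pow_le {p q : ℝ≥0∞} (hp0 : p ≠ 0) (hq0 : q ≠ 0) (T : ℝ) {W : Plane → ℝ≥0∞}
    (hWm : Measurable W) (hW : ∀ᵐ x ∂discMeasure, W x ≠ 0 ∧ W x ≠ ∞) {f : ℝ → Plane → ℂ}
    (hf : Measurable fun z : ℝ × Plane => f z.1 z.2) {r : ℕ} (hpr : p ≤ r) (hqr : q ≤ r) :
    mixedNorm p q T f ^ r ≤ mixedNormConst p q T W ^ r *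
      ∫⁻ x in unitDisc, W x ^ p.toReal * ((W x)⁻¹ ^ r * ∫⁻ t in Ico 0 T, ‖f t x‖ₑ ^ r) := by
  have hpt : p ≠ ∞ := ne_top_of_le_ne_top (by simp) hpr
  have hqt : q ≠ ∞ := ne_top_of_le_ne_top (by simp) hqr
  set g : Plane → ℝ≥0∞ := fun x => eLpNorm (fun t => f t x) q (volume.restrict (Ico 0 T)) with hg
  have hgm : Measurable g := by
    have : g = fun x => (∫⁻ t in Ico 0 T, ‖f t x‖ₑ ^ q.toReal) ^ (1 / q.toReal) :=
      funext fun x => eLpNorm_eq_lintegral_rpow_enorm_toReal hq0 hqt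
    rw [this]
    refine Measurable.pow_const ?_ _
    exact Measurable.lintegral_prod_right' (f := fun z : Plane × ℝ => ‖f z.2 z.1‖ₑ ^ q.toReal)
      ((hf.comp measurable_swap).enorm.pow_const _)
  have hgr : ∀ x, g x ^ r ≤ (max 1 (ENNReal.ofReal T) ^ (1 / q.toReal)) ^ r *
      ∫⁻ t in Ico 0 T, ‖f t x‖ₑ ^ r := by
    intro x
    have := eLpNorm_pow_le_lintegral (μ := volume.restrict (Ico 0 T)) hq0 hqr
      (f := fun t => f t x) (hf.comp measurable_prodMk_right).aestronglyMeasurable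
    simpa using this
  set κ : Measure Plane := discMeasure.withDensity fun x => W x ^ p.toReal with hκ
  have hWp : Measurable fun x => W x ^ p.toReal := hWm.pow_const _
  have hκu : κ univ = ∫⁻ x in unitDisc, W x ^ p.toReal := by
    rw [hκ, withDensity_apply _ MeasurableSet.univ, Measure.restrict_univ]
  have h1 : mixedNorm p q T f = eLpNorm (fun x => g x * (W x)⁻¹) p κ := by
    rw [mixedNorm, eLpNorm_eq_lintegral_rpow_enorm_toReal hp0 hpt,
      eLpNorm_eq_lintegral_rpow_enorm_toReal hp0 hpt]
    congr 1
    refine Eq.trans ?_ (lintegral_withDensity_eq_lintegral_mul _ hWp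
      ((hgm.mul hWm.inv).enorm.pow_const _)).symm
    refine lintegral_congr_ae (hW.mono fun x hx => ?_)
    simp only [Pi.mul_apply, Pi.inv_apply, enorm_eq_self]
    rw [← ENNReal.mul_rpow_of_nonneg _ _ ENNReal.toReal_nonneg, mul_left_comm,
      ENNReal.mul_inv_cancel hx.1 hx.2, mul_one]
  have h2 := eLpNorm_pow_le_lintegral (μ := κ) hp0 hpr (f := fun x => g x * (W x)⁻¹)
    (hgm.mul hWm.inv).aestronglyMeasurable
  rw [← h1, hκu] at h2
  refine h2.trans ?_
  rw [mixedNormConst, mul_pow, mul_assoc]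
  gcongr
  refine (lintegral_withDensity_eq_lintegral_mul _ hWp
      ((hgm.mul hWm.inv).enorm.pow_const _)).trans_le ?_
  refine (lintegral_mono (g := fun x => (max 1 (ENNReal.ofReal T) ^ (1 / q.toReal)) ^ r *
    (W x ^ p.toReal * ((W x)⁻¹ ^ r * ∫⁻ t in Ico 0 T, ‖f t x‖ₑ ^ r))) fun x => ?_).trans ?_
  · simp only [Pi.mul_apply, enorm_eq_self, mul_pow]
    calc W x ^ p.toReal * (g x ^ r * (W x)⁻¹ ^ r)
        ≤ W x ^ p.toReal * ((max 1 (ENNReal.ofReal T) ^ (1 / q.toReal)) ^ r *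
          (∫⁻ t in Ico 0 T, ‖f t x‖ₑ ^ r) * (W x)⁻¹ ^ r) := by gcongr; exact hgr x
      _ = _ := by ring
  · rw [lintegral_const_mul]
    refine hWp.mul ((hWm.inv.pow_const _).mul ?_)
    exact Measurable.lintegral_prod_right' (f := fun z : Plane × ℝ => ‖f z.2 z.1‖ₑ ^ r)
      ((hf.comp measurable_swap).enorm.pow_const _)

variable {Ω : Type*} [MeasurableSpace Ω]

theorem measurable_mixedNorm {p q : ℝ≥0∞} (hp0 : p ≠ 0) (hpt : p ≠ ∞) (hq0 : q ≠ 0) (hqt : q ≠ ∞)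
    (T : ℝ) {F : Ω → ℝ → Plane → ℂ} (hF : Measurable fun z : Ω × ℝ × Plane => F z.1 z.2.1 z.2.2) :
    Measurable fun ω => mixedNorm p q T (F ω) := by
  have : (fun ω => mixedNorm p q T (F ω)) = fun ω =>
      (∫⁻ x in unitDisc, ((∫⁻ t in Ico 0 T, ‖F ω t x‖ₑ ^ q.toReal) ^ (1 / q.toReal)) ^ p.toReal) ^
        (1 / p.toReal) := by
    funext ω
    rw [mixedNorm, eLpNorm_eq_lintegral_rpow_enorm_toReal hp0 hpt]
    simp_rw [eLpNorm_eq_lintegral_rpow_enorm_toReal hq0 hqt, enorm_eq_self]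
  rw [this]
  refine Measurable.pow_const ?_ _
  refine Measurable.lintegral_prod_right' (ν := discMeasure) (f := fun z : Ω × Plane =>
    ((∫⁻ t in Ico 0 T, ‖F z.1 t z.2‖ₑ ^ q.toReal) ^ (1 / q.toReal)) ^ p.toReal) ?_
  refine (Measurable.pow_const ?_ _).pow_const _
  refine Measurable.lintegral_prod_right' (f := fun z : (Ω × Plane) × ℝ =>
    ‖F z.1.1 z.2 z.1.2‖ₑ ^ q.toReal) ?_
  have hm : Measurable fun z : (Ω × Plane) × ℝ => (z.1.1, z.2, z.1.2) := by fun_prop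
  exact (hF.comp hm).enorm.pow_const _

/-- Moments of a mixed norm from weighted pointwise moments. -/
theorem lintegral_mixedNorm_pow_le {p q : ℝ≥0∞} (hp0 : p ≠ 0) (hq0 : q ≠ 0) (T : ℝ)
    {W : Plane → ℝ≥0∞} (hWm : Measurable W) (hW : ∀ᵐ x ∂discMeasure, W x ≠ 0 ∧ W x ≠ ∞)
    (ρ : Measure Ω) [SFinite ρ] {F : Ω → ℝ → Plane → ℂ}
    (hF : Measurable fun z : Ω × ℝ × Plane => F z.1 z.2.1 z.2.2)
    {r : ℕ} (hpr : p ≤ r) (hqr : q ≤ r) {K : ℝ≥0∞}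
    (hK : ∀ᵐ x ∂discMeasure, ∀ t ∈ Ico 0 T, ∫⁻ ω, ‖F ω t x‖ₑ ^ r ∂ρ ≤ K * W x ^ r) :
    ∫⁻ ω, mixedNorm p q T (F ω) ^ r ∂ρ ≤ mixedNormConst p q T W ^ r *
      (K * ENNReal.ofReal T * ∫⁻ x in unitDisc, W x ^ p.toReal) := by
  have hWp : Measurable fun x => W x ^ p.toReal := hWm.pow_const _
  have hm3 : Measurable fun z : (Ω × Plane) × ℝ => ‖F z.1.1 z.2 z.1.2‖ₑ ^ r := by
    have hm : Measurable fun z : (Ω × Plane) × ℝ => (z.1.1, z.2, z.1.2) := by fun_prop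
    exact (hF.comp hm).enorm.pow_const _
  have hm2 : Measurable fun z : Ω × Plane => ∫⁻ t in Ico 0 T, ‖F z.1 t z.2‖ₑ ^ r :=
    Measurable.lintegral_prod_right' (f := fun z : (Ω × Plane) × ℝ => ‖F z.1.1 z.2 z.1.2‖ₑ ^ r) hm3
  have hm1 : Measurable fun z : Ω × Plane => W z.2 ^ p.toReal * ((W z.2)⁻¹ ^ r *
      ∫⁻ t in Ico 0 T, ‖F z.1 t z.2‖ₑ ^ r) :=
    (hWp.comp measurable_snd).mul (((hWm.inv.pow_const r).comp measurable_snd).mul hm2)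
  refine (lintegral_mono fun ω => mixedNorm_pow_le hp0 hq0 T hWm hW
    (f := F ω) (hF.comp measurable_prodMk_left) hpr hqr).trans ?_
  rw [lintegral_const_mul _ (Measurable.lintegral_prod_right' (ν := discMeasure) hm1),
    lintegral_lintegral_swap (ν := discMeasure) hm1.aemeasurable]
  gcongr
  rw [← lintegral_const_mul _ hWp]
  refine lintegral_mono_ae ?_
  filter_upwards [hW, hK] with x hx hKx
  have hmx : Measurable fun ω => ∫⁻ t in Ico 0 T, ‖F ω t x‖ₑ ^ r := hm2.comp measurable_prodMk_right
  rw [lintegral_const_mul _ (hmx.const_mul _), lintegral_const_mul _ hmx,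
    lintegral_lintegral_swap]
  swap
  · have hm : Measurable fun z : Ω × ℝ => ((z.1, x), z.2) := by fun_prop
    exact (hm3.comp hm).aemeasurable
  have h1 : ∫⁻ t in Ico 0 T, ∫⁻ ω, ‖F ω t x‖ₑ ^ r ∂ρ ≤ K * W x ^ r * ENNReal.ofReal T := by
    refine (setLIntegral_mono measurable_const fun t ht => hKx t ht).trans (le_of_eq ?_)
    simp
  calc W x ^ p.toReal * ((W x)⁻¹ ^ r * ∫⁻ t in Ico 0 T, ∫⁻ ω, ‖F ω t x‖ₑ ^ r ∂ρ)
      ≤ W x ^ p.toReal * ((W x)⁻¹ ^ r * (K * W x ^ r * ENNReal.ofReal T)) := by gcongr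
    _ = K * ENNReal.ofReal T * W x ^ p.toReal * ((W x)⁻¹ * W x) ^ r := by rw [mul_pow]; ring
    _ = _ := by rw [ENNReal.inv_mul_cancel hx.1 hx.2, one_pow, mul_one]

/-- Factorial moment bounds give an exponential tail. -/
theorem measure_lt_le_of_lintegral_pow_le (ρ : Measure Ω) (hρ : ρ univ ≤ 1) {Y : Ω → ℝ≥0∞}
    (hY : Measurable Y) {C K : ℝ} (hC : 0 ≤ C) (hK : 0 < K) (m₀ : ℕ)
    (h : ∀ m : ℕ, m₀ ≤ m → ∫⁻ ω, Y ω ^ m ∂ρ ≤ ENNReal.ofReal (C * K ^ m * m.factorial))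
    {lam : ℝ} (hl : 0 < lam) :
    ρ {ω | ENNReal.ofReal lam < Y ω} ≤ ENNReal.ofReal
      ((C + 1) * Real.exp (m₀ + 1) * Real.exp (-(lam / (Real.exp 1 * K)))) := by
  set y := lam / (Real.exp 1 * K) with hy
  have hy0 : 0 < y := by positivity
  rw [mul_assoc, ← Real.exp_add]
  -- For small y the right side is at least 1. Otherwise Markov's inequality is used with exponent m
  -- = ⌊y⌋, and m! ≤ y^m together with λ = y e K leaves e^(-m).
  rcases lt_or_ge y (m₀ + 1) with hlt | hge
  · refine (measure_mono (subset_univ _)).trans (hρ.trans ?_)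
    rw [← ENNReal.ofReal_one]
    refine ENNReal.ofReal_le_ofReal ?_
    have : 1 ≤ Real.exp (m₀ + 1 + -y) := Real.one_le_exp (by linarith)
    nlinarith
  · set m := ⌊y⌋₊ with hm
    have hmy : (m : ℝ) ≤ y := Nat.floor_le hy0.le
    have hym : y < m + 1 := Nat.lt_floor_add_one y
    have hm0 : m₀ ≤ m := Nat.le_floor (by linarith)
    have h1 : ρ {ω | ENNReal.ofReal lam < Y ω} ≤ ρ {ω | ENNReal.ofReal (lam ^ m) ≤ Y ω ^ m} := by
      refine measure_mono fun ω hω => ?_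
      rw [mem_ofPred_eq, ENNReal.ofReal_pow hl.le]
      exact pow_le_pow_left₀ bot_le (le_of_lt hω) m
    refine h1.trans ((meas_ge_le_lintegral_div (hY.pow_const m).aemeasurable
      (by simpa using pow_pos hl m) ENNReal.ofReal_ne_top).trans ?_)
    refine (ENNReal.div_le_div_right (h m hm0) _).trans ?_
    rw [← ENNReal.ofReal_div_of_pos (by positivity)]
    refine ENNReal.ofReal_le_ofReal ?_
    have hlam : lam = y * (Real.exp 1 * K) := by rw [hy]; field_simp
    have hfac : (m.factorial : ℝ) ≤ y ^ m := by
      calc (m.factorial : ℝ) ≤ (m : ℝ) ^ m := by exact_mod_cast Nat.factorial_le_pow m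
        _ ≤ y ^ m := by gcongr
    rw [div_le_iff₀ (by positivity), hlam, mul_pow, mul_pow, ← Real.exp_nat_mul, mul_one]
    have hexp : 1 ≤ Real.exp (m₀ + 1 + -y) * Real.exp m := by
      rw [← Real.exp_add]
      exact Real.one_le_exp (by have : (0 : ℝ) ≤ m₀ := by positivity
                                linarith)
    calc C * K ^ m * m.factorial ≤ (C + 1) * K ^ m * y ^ m * 1 := by
          rw [mul_one]; gcongr; linarith
      _ ≤ (C + 1) * K ^ m * y ^ m * (Real.exp (m₀ + 1 + -y) * Real.exp m) := by gcongr
      _ = _ := by ring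

end MixedNorm

end

noncomputable section

/-! ### The law of the coefficients under the free measure -/

namespace RadialEigensystem

variable (S : RadialEigensystem)

theorem coeff_eq_inner (φ : DiscL2) (n : ℕ) : S.coeff φ n = inner ℂ (S.eL2 n) φ := by
  rw [L2.inner_def, coeff]
  refine integral_congr_ae ?_
  filter_upwards [(S.memLp_e n).coeFn_toLp] with x hx
  rw [eL2, hx]
  simp [RCLike.inner_apply]

theorem orthonormal_eL2 : Orthonormal ℂ S.eL2 := by
  rw [orthonormal_iff_ite]
  intro i j
  rw [← S.coeff_eq_inner, coeff]
  have h : ∫ x in unitDisc, (S.eL2 j : Plane → ℂ) x * (S.e i x : ℂ) =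
      ∫ x in unitDisc, ((S.e j x * S.e i x : ℝ) : ℂ) := by
    refine integral_congr_ae ?_
    filter_upwards [(S.memLp_e j).coeFn_toLp] with x hx
    rw [eL2, hx]; push_cast; rfl
  have h2 : ∫ x in unitDisc, ((S.e j x * S.e i x : ℝ) : ℂ) =
      ((∫ x in unitDisc, S.e j x * S.e i x : ℝ) : ℂ) := integral_ofReal
  rw [h, h2, S.setIntegral_e_mul_e]
  by_cases hij : i = j
  · simp [hij]
  · simp [hij, Ne.symm hij]

theorem measurable_coeff (n : ℕ) : Measurable fun φ : DiscL2 => S.coeff φ n := by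
  simp_rw [S.coeff_eq_inner]
  exact (innerSL ℂ (S.eL2 n)).continuous.measurable

theorem coeff_randomSeries {g : ℕ → ℂ}
    (hg : Summable fun n => ‖((1 / Real.pi : ℝ) : ℂ) * (g n / (S.z n : ℂ))‖ ^ 2) (n : ℕ) :
    S.coeff (S.randomSeries g) n = ((1 / Real.pi : ℝ) : ℂ) * (g n / (S.z n : ℂ)) := by
  have hs : Summable fun n => (((1 / Real.pi : ℝ) : ℂ) * (g n / (S.z n : ℂ))) • S.eL2 n := by
    have := (S.orthonormal_eL2.orthogonalFamily.summable_iff_norm_sq_summable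
      fun n => ((1 / Real.pi : ℝ) : ℂ) * (g n / (S.z n : ℂ))).2 hg
    simpa using this
  rw [S.coeff_eq_inner, randomSeries, ← innerSL_apply_apply ℂ, ContinuousLinearMap.map_tsum _ hs,
    tsum_eq_single n]
  · rw [map_smul, innerSL_apply_apply, orthonormal_iff_ite.1 S.orthonormal_eL2]
    simp
  · intro m hm
    rw [map_smul, innerSL_apply_apply, orthonormal_iff_ite.1 S.orthonormal_eL2, if_neg hm.symm,
      smul_zero]

end RadialEigensystem

theorem lintegral_enorm_sq_complexGaussian_ne_top (v : ℝ≥0) :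
    ∫⁻ w, ‖w‖ₑ ^ 2 ∂complexGaussian v ≠ ∞ := by
  have h1 := lintegral_enorm_sum_pow_le (ι := Unit) (fun _ => v) (fun _ => 1)
    (d := 1 + v) (by positivity) (by have := v.2; simp; nlinarith [NNReal.coe_nonneg v]) 2
  have h2 := (measurePreserving_eval (fun _ : Unit => complexGaussian v) ()).lintegral_comp
    (f := fun w : ℂ => ‖w‖ₑ ^ 2) (by fun_prop)
  rw [← h2]
  refine ne_top_of_le_ne_top ENNReal.ofReal_ne_top (le_trans (le_of_eq ?_) h1)
  simp

namespace RadialEigensystem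

variable (S : RadialEigensystem)

/-- The series defining φ has a meaningful sum only when it is summable, as `tsum` is 0 otherwise.
Summability holds almost surely because the expected sum of squares is bounded by a multiple of ∑
zₙ⁻². -/
theorem ae_coeff_randomSeries (v : ℝ≥0) :
    ∀ᵐ g ∂Measure.infinitePi fun _ : ℕ => complexGaussian v, ∀ n,
      S.coeff (S.randomSeries g) n = ((1 / Real.pi : ℝ) : ℂ) * (g n / (S.z n : ℂ)) := by
  obtain ⟨C, -, hC⟩ := S.exists_sum_z_rpow_le (s := -2) (by norm_num)
  set M := ∫⁻ w, ‖w‖ₑ ^ 2 ∂complexGaussian v with hM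
  have hterm : ∀ n, ∫⁻ g : ℕ → ℂ, ‖((1 / Real.pi : ℝ) : ℂ) * (g n / (S.z n : ℂ))‖ₑ ^ 2
      ∂Measure.infinitePi (fun _ : ℕ => complexGaussian v) ≤ ENNReal.ofReal (S.z n ^ (-2 : ℝ)) * M := by
    intro n
    have h1 := (measurePreserving_eval_infinitePi (fun _ : ℕ => complexGaussian v) n).lintegral_comp
      (f := fun w : ℂ => ‖w‖ₑ ^ 2) (by fun_prop)
    rw [hM, ← h1, ← lintegral_const_mul _ (by fun_prop)]
    refine lintegral_mono fun g => ?_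
    have hz := S.z_pos n
    have hpi : ‖((1 / Real.pi : ℝ) : ℂ)‖ₑ ≤ 1 := by
      rw [← ofReal_norm, Complex.norm_real, Real.norm_of_nonneg (by positivity),
        ← ENNReal.ofReal_one]
      refine ENNReal.ofReal_le_ofReal ?_
      rw [div_le_one Real.pi_pos]; linarith [Real.pi_gt_three]
    have hzn : ‖(S.z n : ℂ)⁻¹‖ₑ ^ 2 = ENNReal.ofReal (S.z n ^ (-2 : ℝ)) := by
      rw [← ofReal_norm, norm_inv, Complex.norm_real, Real.norm_of_nonneg hz.le,
        ← ENNReal.ofReal_pow (by positivity), Real.rpow_neg hz.le, inv_pow]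
      norm_num
    rw [enorm_mul, div_eq_mul_inv (g n), enorm_mul, mul_pow, mul_pow, hzn, mul_comm (‖g n‖ₑ ^ 2)]
    calc _ ≤ 1 ^ 2 * (ENNReal.ofReal (S.z n ^ (-2 : ℝ)) * ‖g n‖ₑ ^ 2) := by gcongr
      _ = _ := by simp
  have hmeas : ∀ n, Measurable fun g : ℕ → ℂ =>
      ‖((1 / Real.pi : ℝ) : ℂ) * (g n / (S.z n : ℂ))‖ₑ ^ 2 := fun n =>
    (((measurable_pi_apply n).div_const _).const_mul _).enorm.pow_const _
  have hfin : ∫⁻ g : ℕ → ℂ, ∑' n, ‖((1 / Real.pi : ℝ) : ℂ) * (g n / (S.z n : ℂ))‖ₑ ^ 2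
      ∂Measure.infinitePi (fun _ : ℕ => complexGaussian v) ≠ ∞ := by
    rw [lintegral_tsum fun n => (hmeas n).aemeasurable]
    refine ne_top_of_le_ne_top ?_ (ENNReal.tsum_le_tsum hterm)
    rw [ENNReal.tsum_mul_right]
    refine ENNReal.mul_ne_top ?_ (lintegral_enorm_sq_complexGaussian_ne_top v)
    refine ne_top_of_le_ne_top (ENNReal.ofReal_ne_top (r := C)) ?_
    rw [ENNReal.tsum_eq_iSup_sum]
    refine iSup_le fun A => ?_
    rw [← ENNReal.ofReal_sum_of_nonneg fun n _ => Real.rpow_nonneg (S.z_pos n).le _]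
    exact ENNReal.ofReal_le_ofReal (hC A)
  filter_upwards [ae_lt_top (Measurable.tsum hmeas) hfin] with g hg n
  refine S.coeff_randomSeries ?_ n
  have := ENNReal.summable_toReal hg.ne
  simpa using this

/-- The variance of the `n`-th coefficient under the free measure. -/
def coeffVariance (v : ℝ≥0) (n : ℕ) : ℝ≥0 := Real.toNNReal ((1 / (Real.pi * S.z n)) ^ 2) * v

theorem coeffVariance_ne_zero {v : ℝ≥0} (hv : v ≠ 0) (n : ℕ) : S.coeffVariance v n ≠ 0 := by
  refine mul_ne_zero ?_ hv
  have := S.z_pos n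
  exact (Real.toNNReal_pos.2 (by positivity)).ne'

theorem coe_coeffVariance (v : ℝ≥0) (n : ℕ) :
    (S.coeffVariance v n : ℝ) = v / (Real.pi ^ 2 * S.z n ^ 2) := by
  have := S.z_pos n
  rw [coeffVariance, NNReal.coe_mul, Real.coe_toNNReal _ (sq_nonneg _)]
  field_simp

/-- Under the free measure the coefficients are independent complex Gaussians. -/
theorem freeMeasure_map_coeff (v : ℝ≥0) (A : Finset ℕ) :
    (S.freeMeasure v).map (fun (φ : DiscL2) (n : A) => S.coeff φ n) =
      Measure.pi fun n : A => complexGaussian (S.coeffVariance v n) := by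
  have hm : Measurable fun (φ : DiscL2) (n : A) => S.coeff φ n :=
    measurable_pi_iff.2 fun n => S.measurable_coeff n
  rw [freeMeasure, Measure.map_map hm S.measurable_randomSeries]
  have h1 : ((fun (φ : DiscL2) (n : A) => S.coeff φ n) ∘ S.randomSeries)
      =ᵐ[Measure.infinitePi fun _ : ℕ => complexGaussian v]
      (fun (b : A → ℂ) (n : A) => ((1 / (Real.pi * S.z n) : ℝ) : ℂ) * b n) ∘ A.restrict := by
    filter_upwards [S.ae_coeff_randomSeries v] with g hg
    funext n
    simp only [Function.comp_apply, hg, Finset.restrict]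
    push_cast
    have := S.z_pos n
    field_simp
  have h3 := Measure.map_map (μ := Measure.infinitePi fun _ : ℕ => complexGaussian v)
    (g := fun (b : A → ℂ) (n : A) => ((1 / (Real.pi * S.z n) : ℝ) : ℂ) * b n)
    (by fun_prop) (Finset.measurable_restrict A)
  rw [Measure.map_congr h1]
  refine h3.symm.trans ?_
  rw [Measure.infinitePi_map_restrict]
  have h2 := Measure.pi_map_pi (μ := fun _ : A => complexGaussian v)
    (f := fun (n : A) (w : ℂ) => ((1 / (Real.pi * S.z n) : ℝ) : ℂ) * w)
    (hμ := fun n => by rw [complexGaussian_map_mul]; infer_instance) fun n => by fun_prop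
  rw [h2]
  simp_rw [complexGaussian_map_mul]
  rfl

end RadialEigensystem

end

noncomputable section

/-! ### Exponential tails of random fields -/

namespace RadialEigensystem

variable (S : RadialEigensystem)

/-- The law of the coefficients with indices in `A`. -/
def coeffLaw (v : ℝ≥0) (A : Finset ℕ) : Measure (A → ℂ) :=
  Measure.pi fun n : A => complexGaussian (S.coeffVariance v n)

instance (v : ℝ≥0) (A : Finset ℕ) : IsProbabilityMeasure (S.coeffLaw v A) :=
  inferInstanceAs (IsProbabilityMeasure (Measure.pi _))

/-- The function `zₙ^σ eₙ`, extended by zero outside of the ball. -/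
def fracMode (σ : ℝ) (n : ℕ) : Plane → ℝ := unitDisc.indicator fun x => S.z n ^ σ * S.e n x

theorem fracMode_of_mem (σ : ℝ) (n : ℕ) {x : Plane} (hx : x ∈ unitDisc) :
    S.fracMode σ n x = S.z n ^ σ * S.e n x := indicator_of_mem hx _

theorem measurable_fracMode (σ : ℝ) (n : ℕ) : Measurable (S.fracMode σ n) := by
  classical
  have h : ContinuousOn (fun x => S.z n ^ σ * S.e n x) unitDisc :=
    continuousOn_const.mul (S.continuousOn_e n)
  rw [fracMode, ← piecewise_eq_indicator]
  exact h.measurable_piecewise continuousOn_const measurableSet_ball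

/-- This bounds the pointwise variance of (√-Δ)^σ φ. The summand is of order zₙ^(2σ-1-θ)|x|^(-θ),
and 2σ < θ puts the exponent below -1. -/
theorem exists_sum_fracMode_sq_le (v : ℝ≥0) {σ θ : ℝ} (hσ : 2 * σ < θ) (hθ0 : 0 ≤ θ) (hθ : θ ≤ 1) :
    ∃ D : ℝ, 0 < D ∧ ∀ A : Finset ℕ, ∀ x ∈ unitDisc, x ≠ 0 →
      ∑ n : A, S.fracMode σ n x ^ 2 * S.coeffVariance v n ≤ (D * ‖x‖ ^ (-(θ / 2))) ^ 2 := by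
  obtain ⟨C, hC0, hC⟩ := S.exists_e_sq_le
  obtain ⟨Z, hZ0, hZ⟩ := S.exists_sum_z_rpow_le (s := 2 * σ - 1 - θ) (by linarith)
  set D := (v / Real.pi ^ 2 + 1) * C * Z with hD
  have hD0 : 0 < D := by positivity
  refine ⟨√D, Real.sqrt_pos.2 hD0, fun A x hx hx0 => ?_⟩
  have hnx : 0 < ‖x‖ := norm_pos_iff.2 hx0
  have hr : (√D * ‖x‖ ^ (-(θ / 2))) ^ 2 = D * ‖x‖ ^ (-θ) := by
    rw [mul_pow, Real.sq_sqrt hD0.le, ← Real.rpow_natCast (‖x‖ ^ _), ← Real.rpow_mul hnx.le]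
    congr 2; push_cast; ring
  rw [hr]
  have hterm : ∀ n, S.fracMode σ n x ^ 2 * S.coeffVariance v n ≤
      (v / Real.pi ^ 2 + 1) * C * ‖x‖ ^ (-θ) * S.z n ^ (2 * σ - 1 - θ) := by
    intro n
    have hz := S.z_pos n
    have e1 : S.z n ^ (2 * σ - 1 - θ) = (S.z n ^ σ) ^ 2 * S.z n ^ (1 - θ) / S.z n ^ 2 := by
      rw [show 2 * σ - 1 - θ = σ * (2 : ℕ) + (1 - θ) - (2 : ℕ) by push_cast; ring,
        Real.rpow_sub hz, Real.rpow_add hz, Real.rpow_mul hz.le, Real.rpow_natCast,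
        Real.rpow_natCast]
    have h1 := hC θ ⟨hθ0, hθ⟩ n x hx hx0
    rw [S.fracMode_of_mem σ n hx, S.coe_coeffVariance, e1]
    calc (S.z n ^ σ * S.e n x) ^ 2 * (v / (Real.pi ^ 2 * S.z n ^ 2))
        = (v / Real.pi ^ 2) * ((S.z n ^ σ) ^ 2 / S.z n ^ 2) * S.e n x ^ 2 := by
          have := Real.pi_pos
          field_simp
      _ ≤ (v / Real.pi ^ 2 + 1) * ((S.z n ^ σ) ^ 2 / S.z n ^ 2) *
          (C * S.z n ^ (1 - θ) * ‖x‖ ^ (-θ)) := by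
          gcongr; linarith
      _ = _ := by ring
  rw [Finset.sum_coe_sort A fun n => S.fracMode σ n x ^ 2 * (S.coeffVariance v n : ℝ)]
  refine (Finset.sum_le_sum fun n _ => hterm n).trans ?_
  rw [← Finset.mul_sum, hD]
  calc (v / Real.pi ^ 2 + 1) * C * ‖x‖ ^ (-θ) * ∑ n ∈ A, S.z n ^ (2 * σ - 1 - θ)
      ≤ (v / Real.pi ^ 2 + 1) * C * ‖x‖ ^ (-θ) * Z := by gcongr; exact hZ A
    _ = _ := by ring

/-- The operator `(√-Δ)^σ` applied to the function with coefficients `b`. -/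
def fracField (σ : ℝ) {A : Finset ℕ} (b : A → ℂ) (x : Plane) : ℂ :=
  ∑ n : A, (S.fracMode σ n x : ℂ) * b n

theorem measurable_fracField (σ : ℝ) {A : Finset ℕ} {Ω : Type*} [MeasurableSpace Ω]
    {g : Ω → A → ℂ} {y : Ω → Plane} (hg : Measurable g) (hy : Measurable y) :
    Measurable fun ω => S.fracField σ (g ω) (y ω) :=
  Finset.measurable_fun_sum _ fun n _ =>
    (Complex.measurable_ofReal.comp ((S.measurable_fracMode σ n).comp hy)).mul
      ((measurable_pi_apply n).comp hg)

/-- Moments of the mixed norm reduce to moments at a single (t, x), so domination of the one-time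
laws is enough; nothing is needed about the joint law in time. It serves both for the flow under the
Gibbs weight and, with G constant in time, for the potential energy. -/
theorem exists_tail_fracField {v : ℝ≥0} {σ : ℝ} (hσ0 : 0 ≤ σ) (hσ : σ < 1 / 2) {p q : ℝ≥0∞}
    (hp0 : p ≠ 0) (hpt : p ≠ ∞) (hpσ : p.toReal * σ < 2) (hq0 : q ≠ 0) (hqt : q ≠ ∞)
    {T : ℝ} (hT : 0 < T) :
    ∃ C δ : ℝ, 0 < C ∧ 0 < δ ∧ ∀ (A : Finset ℕ) (ρ : Measure (A → ℂ)), ρ univ ≤ 1 →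
      ∀ G : (A → ℂ) → ℝ → A → ℂ, (Measurable fun z : (A → ℂ) × ℝ => G z.1 z.2) →
      (∀ t ∈ Ico 0 T, ∀ f : (A → ℂ) → ℝ≥0∞, Continuous f →
        ∫⁻ a, f (G a t) ∂ρ ≤ ∫⁻ a, f a ∂S.coeffLaw v A) →
      ∀ lam : ℝ, 0 < lam →
        ρ {a | ENNReal.ofReal lam < mixedNorm p q T fun t => S.fracField σ (G a t)} ≤
          ENNReal.ofReal (C * Real.exp (-(δ * lam))) := by
  have hppos : 0 < p.toReal := ENNReal.toReal_pos hp0 hpt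
  -- θ > 2σ makes the variance sum converge, θ ≤ 1 is required by the eigenfunction bound, and θp <
  -- 4 makes |x|^(-θp/2) integrable on the disc.
  obtain ⟨θ, hθ1, hθ2⟩ : ∃ θ, 2 * σ < θ ∧ θ < min 1 (4 / p.toReal) :=
    exists_between (lt_min (by linarith) (by rw [lt_div_iff₀ hppos]; linarith))
  have hθ0 : 0 ≤ θ := by linarith
  have hθ3 : θ ≤ 1 := (hθ2.trans_le (min_le_left _ _)).le
  have hθ4 : θ * p.toReal < 4 := (lt_div_iff₀ hppos).1 (hθ2.trans_le (min_le_right _ _))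
  obtain ⟨D, hD0, hD⟩ := S.exists_sum_fracMode_sq_le v hθ1 hθ0 hθ3
  set W : Plane → ℝ≥0∞ := fun x => ENNReal.ofReal (‖x‖ ^ (-(θ / 2))) with hWdef
  have hWm : Measurable W := by fun_prop
  have hae : ∀ᵐ x ∂discMeasure, x ∈ unitDisc ∧ x ≠ 0 := by
    filter_upwards [ae_restrict_mem measurableSet_ball,
      ae_restrict_of_ae (compl_mem_ae_iff.2 (measure_singleton (0 : Plane)))] with x h1 h2
    exact ⟨h1, h2⟩
  have hW : ∀ᵐ x ∂discMeasure, W x ≠ 0 ∧ W x ≠ ∞ := hae.mono fun x hx =>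
    ⟨(ENNReal.ofReal_pos.2 (Real.rpow_pos_of_pos (norm_pos_iff.2 hx.2) _)).ne',
      ENNReal.ofReal_ne_top⟩
  have hM : ∫⁻ x in unitDisc, W x ^ p.toReal ≠ ∞ := by
    have h1 := (integrableOn_unitDisc_norm_rpow (s := -(θ / 2) * p.toReal) (by linarith)).2
    rw [hasFiniteIntegral_iff_ofReal (Filter.Eventually.of_forall fun x => by positivity)] at h1
    refine ne_of_lt (lt_of_eq_of_lt (lintegral_congr fun x => ?_) h1)
    rw [hWdef]
    simp only
    rw [ENNReal.ofReal_rpow_of_nonneg (by positivity) hppos.le, ← Real.rpow_mul (norm_nonneg _)]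
  set M := (∫⁻ x in unitDisc, W x ^ p.toReal).toReal with hMdef
  have hB : mixedNormConst p q T W ≠ ∞ := by
    refine ENNReal.mul_ne_top ?_ ?_
    · exact ENNReal.rpow_ne_top_of_nonneg (by positivity) (by simp [hM])
    · exact ENNReal.rpow_ne_top_of_nonneg (by positivity) (by simp)
  set B := (mixedNormConst p q T W).toReal with hBdef
  have hB0 : 0 ≤ B := ENNReal.toReal_nonneg
  have hM0 : 0 ≤ M := ENNReal.toReal_nonneg
  -- The sum of the two ceilings exceeds both p and q, as Hölder requires in each variable.
  set m₀ := ⌈p.toReal⌉₊ + ⌈q.toReal⌉₊ with hm₀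
  set C := 4 * Real.exp 2 * T * M with hC
  have hC0 : 0 ≤ C := by positivity
  set K := (B + 1) * D with hK
  have hK0 : 0 < K := by positivity
  refine ⟨(C + 1) * Real.exp (m₀ + 1), 1 / (Real.exp 1 * K), by positivity, by positivity, ?_⟩
  intro A ρ hρ G hG hGf lam hlam
  have : IsFiniteMeasure ρ := ⟨hρ.trans_lt ENNReal.one_lt_top⟩
  have hFm : Measurable fun z : (A → ℂ) × ℝ × Plane => S.fracField σ (G z.1 z.2.1) z.2.2 := by
    have h1 : Measurable fun z : (A → ℂ) × ℝ × Plane => (z.1, z.2.1) := by fun_prop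
    have h2 : Measurable fun z : (A → ℂ) × ℝ × Plane => G z.1 z.2.1 := hG.comp h1
    exact S.measurable_fracField σ h2 measurable_snd.snd
  have hpm : ∀ r : ℕ, m₀ ≤ r → p ≤ r ∧ q ≤ r := by
    intro r hr
    constructor
    · rw [← ENNReal.ofReal_toReal hpt, ← ENNReal.ofReal_natCast]
      refine ENNReal.ofReal_le_ofReal ((Nat.le_ceil _).trans ?_)
      exact_mod_cast (Nat.le_add_right _ _).trans hr
    · rw [← ENNReal.ofReal_toReal hqt, ← ENNReal.ofReal_natCast]
      refine ENNReal.ofReal_le_ofReal ((Nat.le_ceil _).trans ?_)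
      exact_mod_cast (Nat.le_add_left _ _).trans hr
  have hpoint : ∀ r : ℕ, ∀ᵐ x ∂discMeasure, ∀ t ∈ Ico 0 T,
      ∫⁻ a, ‖S.fracField σ (G a t) x‖ₑ ^ r ∂ρ ≤
        ENNReal.ofReal (4 * Real.exp 2 * D ^ r * r.factorial) * W x ^ r := by
    intro r
    filter_upwards [hae] with x hx t ht
    have hc : Continuous fun b : A → ℂ => ‖S.fracField σ b x‖ₑ ^ r := by
      unfold fracField
      fun_prop
    refine (hGf t ht _ hc).trans ?_
    have hd : 0 < D * ‖x‖ ^ (-(θ / 2)) :=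
      mul_pos hD0 (Real.rpow_pos_of_pos (norm_pos_iff.2 hx.2) _)
    refine (lintegral_enorm_sum_pow_le (fun n : A => S.coeffVariance v n)
      (fun n : A => S.fracMode σ n x) hd (hD A x hx.1 hx.2) r).trans (le_of_eq ?_)
    rw [hWdef]
    simp only
    rw [← ENNReal.ofReal_pow (by positivity), ← ENNReal.ofReal_mul (by positivity), mul_pow]
    congr 1; ring
  have hmom : ∀ r : ℕ, m₀ ≤ r →
      ∫⁻ a, (mixedNorm p q T fun t => S.fracField σ (G a t)) ^ r ∂ρ ≤
        ENNReal.ofReal (C * K ^ r * r.factorial) := by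
    intro r hr
    refine (lintegral_mixedNorm_pow_le hp0 hq0 T hWm hW ρ
      (F := fun a t x => S.fracField σ (G a t) x) hFm (hpm r hr).1 (hpm r hr).2 (hpoint r)).trans ?_
    rw [← ENNReal.ofReal_toReal hB, ← ENNReal.ofReal_toReal hM, ← hBdef, ← hMdef,
      ← ENNReal.ofReal_pow hB0, ← ENNReal.ofReal_mul (by positivity),
      ← ENNReal.ofReal_mul (by positivity), ← ENNReal.ofReal_mul (by positivity)]
    refine ENNReal.ofReal_le_ofReal ?_
    rw [hK, hC, mul_pow]
    calc B ^ r * (4 * Real.exp 2 * D ^ r * r.factorial * T * M)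
        ≤ (B + 1) ^ r * (4 * Real.exp 2 * D ^ r * r.factorial * T * M) := by gcongr; linarith
      _ = _ := by ring
  have hYm := measurable_mixedNorm hp0 hpt hq0 hqt T
    (F := fun a t x => S.fracField σ (G a t) x) hFm
  have := measure_lt_le_of_lintegral_pow_le ρ hρ hYm hC0 hK0 m₀ hmom hlam
  rwa [show lam / (Real.exp 1 * K) = 1 / (Real.exp 1 * K) * lam by ring] at this

end RadialEigensystem

end

noncomputable section

/-! ### The potential energy and the weighted free measure -/

theorem mixedNorm_congr {p q : ℝ≥0∞} {T : ℝ} {f g : ℝ → Plane → ℂ}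
    (h : ∀ t ∈ Ico 0 T, ∀ x ∈ unitDisc, f t x = g t x) :
    mixedNorm p q T f = mixedNorm p q T g := by
  refine eLpNorm_congr_ae ?_
  filter_upwards [ae_restrict_mem measurableSet_ball] with x hx
  refine eLpNorm_congr_ae ?_
  filter_upwards [ae_restrict_mem measurableSet_Ico] with t ht
  exact h t ht x hx

/-- Time is frozen on an interval of length 1, so that the tail estimate for mixed norms covers
spatial norms, hence the potential energy. -/
theorem mixedNorm_const_pow (m : ℕ) (hm : m ≠ 0) (f : Plane → ℂ) :
    mixedNorm m 1 1 (fun _ => f) ^ m = ∫⁻ x in unitDisc, ‖f x‖ₑ ^ m := by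
  have h1 : ∀ x, eLpNorm (fun _ : ℝ => f x) 1 (volume.restrict (Ico 0 1)) = ‖f x‖ₑ := fun x => by
    rw [eLpNorm_one_eq_lintegral_enorm]; simp
  rw [mixedNorm]
  simp_rw [h1]
  rw [eLpNorm_eq_lintegral_rpow_enorm_toReal (by simpa using hm) (by simp), ← ENNReal.rpow_natCast,
    ← ENNReal.rpow_mul]
  simp [hm]

namespace RadialEigensystem

variable (S : RadialEigensystem)

/-- The potential energy of a finite sum of modes. -/
def discPotential (A : Finset ℕ) (k : ℕ) (a : A → ℂ) : ℝ :=
  potential (fun n : A => S.discMode n) discIntegral k a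

theorem continuous_discPotential (A : Finset ℕ) (k : ℕ) : Continuous (S.discPotential A k) := by
  have hu := (contDiff_modeSum (m := 0) fun n : A => S.discMode n).continuous
  unfold discPotential potential
  exact continuous_const.mul (Complex.continuous_re.comp (discIntegral.continuous.comp
    ((hu.pow _).mul ((continuous_star.comp hu).pow _))))

theorem fracField_zero {A : Finset ℕ} (a : A → ℂ) (x : ↥unitDisc) :
    S.fracField 0 a x = modeSum (fun n : A => S.discMode n) a x := by
  rw [modeSum_discMode_apply, fracField]
  refine Finset.sum_congr rfl fun n _ => ?_
  rw [S.fracMode_of_mem 0 n x.2, Real.rpow_zero, one_mul, mul_comm]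

theorem discPotential_eq (A : Finset ℕ) (k : ℕ) (a : A → ℂ) : S.discPotential A k a =
    (1 / (2 * k + 2)) * ∫ x, ‖modeSum (fun n : A => S.discMode n) a x‖ ^ (2 * k + 2)
      ∂discSubtypeMeasure := by
  rw [discPotential, potential, discIntegral_apply]
  congr 1
  have h : ∀ x : ↥unitDisc, (modeSum (fun n : A => S.discMode n) a ^ (k + 1) *
      star (modeSum (fun n : A => S.discMode n) a) ^ (k + 1)) x =
      ((‖modeSum (fun n : A => S.discMode n) a x‖ ^ (2 * k + 2) : ℝ) : ℂ) := by
    intro x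
    simp only [BoundedContinuousFunction.coe_mul, BoundedContinuousFunction.coe_pow, Pi.mul_apply,
      Pi.pow_apply, BoundedContinuousFunction.star_apply]
    rw [← mul_pow, Complex.star_def, Complex.mul_conj', ← pow_mul, mul_add, mul_one]
    push_cast; rfl
  simp_rw [h]
  have h2 : ∫ x, ((‖modeSum (fun n : A => S.discMode n) a x‖ ^ (2 * k + 2) : ℝ) : ℂ)
      ∂discSubtypeMeasure = ((∫ x, ‖modeSum (fun n : A => S.discMode n) a x‖ ^ (2 * k + 2)
      ∂discSubtypeMeasure : ℝ) : ℂ) := integral_ofReal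
  rw [h2, Complex.ofReal_re]

theorem discPotential_nonneg (A : Finset ℕ) (k : ℕ) (a : A → ℂ) : 0 ≤ S.discPotential A k a := by
  rw [discPotential_eq]
  exact mul_nonneg (by positivity) (integral_nonneg fun x => by positivity)

theorem ofReal_discPotential (A : Finset ℕ) (k : ℕ) (a : A → ℂ) :
    ENNReal.ofReal ((2 * k + 2) * S.discPotential A k a) =
      mixedNorm (2 * k + 2 : ℕ) 1 1 (fun _ => S.fracField 0 a) ^ (2 * k + 2) := by
  have hk : (0 : ℝ) < 2 * k + 2 := by positivity
  rw [mixedNorm_const_pow _ (by omega), discPotential_eq, ← mul_assoc, mul_one_div_cancel hk.ne',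
    one_mul]
  set w := modeSum (fun n : A => S.discMode n) a with hw
  have hint : Integrable (fun x => ‖w x‖ ^ (2 * k + 2)) discSubtypeMeasure := by
    have := ((w ^ (2 * k + 2)).integrable discSubtypeMeasure).norm
    simpa using this
  rw [ofReal_integral_eq_lintegral_ofReal hint (Filter.Eventually.of_forall fun x => by positivity),
    ← lintegral_subtype_comap measurableSet_ball]
  refine lintegral_congr fun x => ?_
  rw [S.fracField_zero, ENNReal.ofReal_pow (norm_nonneg _), ofReal_norm]

/-- Tails of the potential energy. -/
theorem coeffLaw_lt_discPotential_le (k : ℕ) (v : ℝ≥0) : ∃ C δ : ℝ, 0 < C ∧ 0 < δ ∧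
    ∀ (A : Finset ℕ) (lam : ℝ), 0 < lam → S.coeffLaw v A {a | lam < S.discPotential A k a} ≤
      ENNReal.ofReal (C * Real.exp (-(δ * lam ^ (1 / (2 * k + 2) : ℝ)))) := by
  obtain ⟨C, δ, hC, hδ, h⟩ := S.exists_tail_fracField (v := v) (σ := 0) le_rfl (by norm_num)
    (p := (2 * k + 2 : ℕ)) (q := 1) (by simp) (ENNReal.natCast_ne_top _) (by simp) one_ne_zero
    (by simp) one_pos
  have hk : (0 : ℝ) < 2 * k + 2 := by positivity
  set b : ℝ := 1 / (2 * k + 2) with hb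
  refine ⟨C, δ * (2 * k + 2) ^ b, hC, by positivity, fun A lam hlam => ?_⟩
  have h1 := h A (S.coeffLaw v A) (by simp) (fun a _ => a) measurable_fst (fun _ _ f _ => le_rfl)
    (((2 * k + 2) * lam) ^ b) (by positivity)
  rw [Real.mul_rpow hk.le hlam.le, ← mul_assoc] at h1
  refine (measure_mono fun a ha => ?_).trans h1
  have ha' : (2 * k + 2) * lam < (2 * k + 2) * S.discPotential A k a := by
    have : lam < S.discPotential A k a := ha
    gcongr
  change ENNReal.ofReal _ < _
  by_contra hle
  have hle' := not_lt.1 hle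
  have h2 := pow_le_pow_left₀ bot_le hle' (2 * k + 2)
  rw [← S.ofReal_discPotential, ← ENNReal.ofReal_pow (by positivity),
    ← Real.mul_rpow hk.le hlam.le, ← Real.rpow_natCast, ← Real.rpow_mul (by positivity),
    ENNReal.ofReal_le_ofReal_iff (by positivity)] at h2
  have h3 : b * ((2 * k + 2 : ℕ) : ℝ) = 1 := by rw [hb]; push_cast; field_simp
  rw [h3, Real.rpow_one] at h2
  linarith

/-- The variance v/(π² zₙ²) turns the Gaussian exponent into π²/v times the kinetic energy. The
normalizing constant c is irrelevant, being common to both sides of the comparison. -/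
theorem prod_complexGaussianPDF (v : ℝ≥0) (A : Finset ℕ) : ∃ c : ℝ≥0∞, ∀ a : A → ℂ,
    ∏ n : A, complexGaussianPDF (S.coeffVariance v n) (a n) = c * ENNReal.ofReal
      (Real.exp (-(Real.pi ^ 2 / v * ((1 / 2) * ∑ n : A, S.z n ^ 2 * Complex.normSq (a n))))) := by
  refine ⟨∏ n : A, ENNReal.ofReal ((√(2 * Real.pi * S.coeffVariance v n))⁻¹ ^ 2), fun a => ?_⟩
  simp_rw [complexGaussianPDF_eq]
  rw [Finset.prod_mul_distrib, ← ENNReal.ofReal_prod_of_nonneg fun _ _ => (Real.exp_pos _).le,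
    ← Real.exp_sum, ← mul_assoc (Real.pi ^ 2 / v : ℝ), Finset.mul_sum, ← Finset.sum_neg_distrib]
  congr 4
  ext n
  have := S.z_pos n
  have := Real.pi_pos
  rw [S.coe_coeffVariance]
  by_cases hv : (v : ℝ) = 0
  · simp [hv]
  · field_simp

/-- The Gibbs weight relative to the free measure. -/
def gibbsWeight (v : ℝ≥0) (A : Finset ℕ) (k : ℕ) (a : A → ℂ) : ℝ≥0∞ :=
  ENNReal.ofReal (Real.exp (-(Real.pi ^ 2 / v * S.discPotential A k a)))

theorem continuous_gibbsWeight (v : ℝ≥0) (A : Finset ℕ) (k : ℕ) :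
    Continuous (S.gibbsWeight v A k) :=
  ENNReal.continuous_ofReal.comp (Real.continuous_exp.comp
    (continuous_const.mul (S.continuous_discPotential A k)).neg)

theorem gibbsWeight_le_one (v : ℝ≥0) (A : Finset ℕ) (k : ℕ) (a : A → ℂ) :
    S.gibbsWeight v A k a ≤ 1 := by
  rw [gibbsWeight, ← ENNReal.ofReal_one]
  refine ENNReal.ofReal_le_ofReal (Real.exp_le_one_iff.2 ?_)
  have := S.discPotential_nonneg A k a
  simp only [Left.neg_nonpos_iff]; positivity

/-- The Gibbs measure is subinvariant under the flow. -/
theorem lintegral_flow_gibbsWeight_le {v : ℝ≥0} (hv : v ≠ 0) (A : Finset ℕ) (k : ℕ)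
    {γ : (A → ℂ) → ℝ → A → ℂ} (h0 : ∀ a, γ a 0 = a)
    (hγ : ∀ a s, HasDerivAt (γ a) (S.discField A k (γ a s)) s) {t : ℝ} (ht : 0 ≤ t)
    {f : (A → ℂ) → ℝ≥0∞} (hf : Continuous f) :
    ∫⁻ a, f (γ a t) ∂(S.coeffLaw v A).withDensity (S.gibbsWeight v A k) ≤
      ∫⁻ a, f a ∂S.coeffLaw v A := by
  have hX := S.isMassPreservingField_discField A k
  have hmf : Measurable fun a => f (γ a t) := hf.measurable.comp (hX.measurable_flow h0 hγ ht)
  have hwm : Measurable (S.gibbsWeight v A k) := (S.continuous_gibbsWeight v A k).measurable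
  have hvar : ∀ n : A, S.coeffVariance v n ≠ 0 := fun n => S.coeffVariance_ne_zero hv n
  obtain ⟨c, hc⟩ := S.prod_complexGaussianPDF v A
  set H : (A → ℂ) → ℝ := hamEnergy (fun n : A => S.discMode n) discIntegral (fun n => S.z n) k
    with hH
  -- The inverse temperature π²/v of the Gibbs weight is the one already present in the Gaussian
  -- density, so the product depends on the conserved energy alone.
  have hdens : ∀ a, (∏ n : A, complexGaussianPDF (S.coeffVariance v n) (a n)) *
      S.gibbsWeight v A k a = c * ENNReal.ofReal (Real.exp (-(Real.pi ^ 2 / v * H a))) := by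
    intro a
    rw [hc, gibbsWeight, mul_assoc, ← ENNReal.ofReal_mul (Real.exp_pos _).le, ← Real.exp_add]
    congr 3
    rw [hH, hamEnergy, discPotential]; ring
  have hHγ : ∀ a, H a = H (γ a t) := fun a => by
    have := hamEnergy_eq (fun n : A => S.discMode n) discIntegral (fun n => S.z n) k
      (fun n => S.star_discMode n) discIntegral_star (γ := γ a) (hγ a) t
    rw [h0] at this
    exact this.symm
  have hHc : Continuous H := by
    have h1 : Continuous fun a : A → ℂ => (1 / 2 : ℝ) * ∑ n : A, S.z n ^ 2 * Complex.normSq (a n) :=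
      continuous_const.mul (continuous_finsetSum _ fun n _ =>
        continuous_const.mul (Complex.continuous_normSq.comp (continuous_apply n)))
    exact h1.add (S.continuous_discPotential A k)
  set r : (A → ℂ) → ℝ≥0∞ := fun a => ENNReal.ofReal (Real.exp (-(Real.pi ^ 2 / v * H a))) with hr
  have hrc : Continuous r := ENNReal.continuous_ofReal.comp
    (Real.continuous_exp.comp (continuous_const.mul hHc).neg)
  have hr0 : ∀ a, r a ≠ 0 := fun a => (ENNReal.ofReal_pos.2 (Real.exp_pos _)).ne'
  have hg : Continuous fun a => r a * f a :=
    hrc.ennreal_mul hf (fun a => Or.inl (hr0 a)) fun a => Or.inr ENNReal.ofReal_ne_top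
  have hweight : ∀ h : (A → ℂ) → ℝ≥0∞, Measurable h →
      ∫⁻ a, h a ∂(S.coeffLaw v A).withDensity (S.gibbsWeight v A k) = c * ∫⁻ a, r a * h a := by
    intro h hh
    refine (lintegral_withDensity_eq_lintegral_mul _ hwm hh).trans ?_
    refine (lintegral_pi_complexGaussian hvar (hwm.mul hh)).trans ?_
    have hrh : Measurable fun a => r a * h a := hrc.measurable.mul hh
    rw [← lintegral_const_mul _ hrh]
    refine lintegral_congr fun a => ?_
    rw [Pi.mul_apply, ← mul_assoc, hdens, mul_assoc]
  calc ∫⁻ a, f (γ a t) ∂(S.coeffLaw v A).withDensity (S.gibbsWeight v A k)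
      = c * ∫⁻ a, r (γ a t) * f (γ a t) := by
        rw [hweight _ hmf]
        congr 1
        refine lintegral_congr fun a => ?_
        simp only [hr]
        rw [← hHγ]
    _ ≤ c * ∫⁻ a, r a * f a := by
        gcongr c * ?_
        exact hX.lintegral_flow_le h0 hγ ht hg
    _ = ∫⁻ a, f a ∂(S.coeffLaw v A).withDensity (S.gibbsWeight v A k) :=
        (hweight f hf.measurable).symm
    _ = ∫⁻ a, S.gibbsWeight v A k a * f a ∂S.coeffLaw v A :=
        lintegral_withDensity_eq_lintegral_mul _ hwm hf.measurable
    _ ≤ ∫⁻ a, f a ∂S.coeffLaw v A :=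
        lintegral_mono fun a => mul_le_of_le_one_left' (S.gibbsWeight_le_one v A k a)

end RadialEigensystem

end

noncomputable section

/-! ### Stretched exponential tails of the solutions -/

/-- Lowering the exponent absorbs the rate: aλ^b ≥ λ^c once λ ≥ L, and for λ ≤ L the constant
e^(L^c) suffices. -/
theorem exists_exp_neg_mul_rpow_le {a b c : ℝ} (ha : 0 < a) (hc : 0 < c) (hcb : c < b) :
    ∃ C : ℝ, 0 < C ∧ ∀ lam : ℝ, 0 < lam →
      Real.exp (-(a * lam ^ b)) ≤ C * Real.exp (-(lam ^ c)) := by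
  set L : ℝ := (1 / a) ^ (1 / (b - c)) with hL
  have hL0 : 0 < L := by positivity
  have hbc : 0 < b - c := by linarith
  refine ⟨Real.exp (L ^ c), Real.exp_pos _, fun lam hlam => ?_⟩
  rw [← Real.exp_add, Real.exp_le_exp]
  have h1 : 0 ≤ a * lam ^ b := by positivity
  rcases le_total lam L with h | h
  · have := Real.rpow_le_rpow hlam.le h hc.le
    linarith
  · have h2 : 1 / a ≤ lam ^ (b - c) := by
      have := Real.rpow_le_rpow hL0.le h hbc.le
      rwa [hL, ← Real.rpow_mul (by positivity), one_div_mul_cancel hbc.ne', Real.rpow_one] at this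
    have h3 : lam ^ b = lam ^ (b - c) * lam ^ c := by rw [← Real.rpow_add hlam]; congr 1; ring
    have h4 : lam ^ c ≤ a * lam ^ b := by
      rw [h3, ← mul_assoc]
      have : 1 ≤ a * lam ^ (b - c) := by
        rw [div_le_iff₀ ha] at h2; linarith
      have h5 : 0 < lam ^ c := by positivity
      nlinarith
    have : 0 < L ^ c := by positivity
    linarith

theorem summable_exp_neg_rpow {c : ℝ} (hc : 0 < c) :
    Summable fun n : ℕ => Real.exp (-((n + 1 : ℝ) ^ c)) := by
  set m := ⌈2 / c⌉₊ with hm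
  have hmc : 2 ≤ c * m := by
    have := Nat.le_ceil (2 / c)
    rw [div_le_iff₀ hc] at this
    linarith
  have hs : Summable fun n : ℕ => (m.factorial : ℝ) * (1 / ((n + 1 : ℕ) : ℝ) ^ 2) :=
    ((summable_nat_add_iff 1).2 (Real.summable_one_div_nat_pow.2 one_lt_two)).mul_left _
  refine hs.of_nonneg_of_le (fun n => (Real.exp_pos _).le) fun n => ?_
  have h1 : (1 : ℝ) ≤ n + 1 := le_add_of_nonneg_left n.cast_nonneg
  have hx : 0 < (n + 1 : ℝ) := by linarith
  have h2 := Real.pow_div_factorial_le_exp ((n + 1 : ℝ) ^ c) (by positivity) m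
  have h3 : (n + 1 : ℝ) ^ 2 ≤ ((n + 1 : ℝ) ^ c) ^ m := by
    rw [← Real.rpow_natCast ((n + 1 : ℝ) ^ c), ← Real.rpow_mul hx.le, ← Real.rpow_natCast]
    exact Real.rpow_le_rpow_of_exponent_le h1 (by exact_mod_cast hmc)
  rw [Real.exp_neg, mul_one_div, inv_eq_one_div, div_le_div_iff₀ (Real.exp_pos _) (by positivity)]
  rw [div_le_iff₀ (by positivity)] at h2
  push_cast
  linarith

theorem le_tsum_indicator_natCast_lt (y : ℝ≥0∞) :
    y ≤ ∑' n : ℕ, (Ioi (n : ℝ≥0∞)).indicator 1 y := by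
  have key : ∀ m : ℕ, (∀ n < m, (n : ℝ≥0∞) < y) →
      (m : ℝ≥0∞) ≤ ∑' n : ℕ, (Ioi (n : ℝ≥0∞)).indicator 1 y := by
    intro m hm
    refine le_trans (le_of_eq ?_) (ENNReal.sum_le_tsum (Finset.range m))
    have h1 : ∀ n ∈ Finset.range m, (Ioi (n : ℝ≥0∞)).indicator (1 : ℝ≥0∞ → ℝ≥0∞) y = 1 :=
      fun n hn => indicator_of_mem (mem_Ioi.2 (hm n (Finset.mem_range.1 hn))) _
    rw [Finset.sum_congr rfl h1]
    simp
  by_cases hy : y = ∞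
  · have : ∀ m : ℕ, (m : ℝ≥0∞) ≤ ∑' n : ℕ, (Ioi (n : ℝ≥0∞)).indicator 1 y :=
      fun m => key m fun n _ => by simp [hy]
    refine le_top.trans_eq (ENNReal.eq_top_of_forall_nnreal_le fun r => ?_).symm
    obtain ⟨m, hm⟩ := exists_nat_ge r
    exact le_trans (by exact_mod_cast hm) (this m)
  · have h1 : y ≤ (⌈y.toReal⌉₊ : ℝ≥0∞) := by
      rw [← ENNReal.ofReal_natCast, ← ENNReal.ofReal_toReal hy, ENNReal.toReal_ofReal (by simp)]
      exact ENNReal.ofReal_le_ofReal (Nat.le_ceil _)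
    refine h1.trans (key _ fun n hn => ?_)
    rw [Nat.lt_ceil] at hn
    rw [← ENNReal.ofReal_natCast, ← ENNReal.ofReal_toReal hy]
    exact (ENNReal.ofReal_lt_ofReal_iff_of_nonneg (by positivity)).2 hn

/-- A stretched exponential tail bounds the expectation. -/
theorem lintegral_le_of_tail {Ω : Type*} [MeasurableSpace Ω] (ρ : Measure Ω)
    [IsProbabilityMeasure ρ] {Y : Ω → ℝ≥0∞} (hY : Measurable Y) {C c : ℝ} (hC : 0 ≤ C) (hc : 0 < c)
    (h : ∀ lam : ℝ, 0 < lam →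
      ρ {ω | ENNReal.ofReal lam < Y ω} ≤ ENNReal.ofReal (C * Real.exp (-(lam ^ c)))) :
    ∫⁻ ω, Y ω ∂ρ ≤ ENNReal.ofReal (1 + C * ∑' n : ℕ, Real.exp (-((n + 1 : ℝ) ^ c))) := by
  have hind : ∀ n : ℕ, ∫⁻ ω, (Ioi (n : ℝ≥0∞)).indicator 1 (Y ω) ∂ρ =
      ρ {ω | (n : ℝ≥0∞) < Y ω} := fun n =>
    lintegral_indicator_one (hY (measurableSet_Ioi (a := (n : ℝ≥0∞))))
  refine (lintegral_mono fun ω => le_tsum_indicator_natCast_lt (Y ω)).trans ?_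
  have hmeas : ∀ n : ℕ, Measurable fun ω => (Ioi (n : ℝ≥0∞)).indicator (1 : ℝ≥0∞ → ℝ≥0∞) (Y ω) :=
    fun n => (measurable_one.indicator measurableSet_Ioi).comp hY
  rw [lintegral_tsum fun n => (hmeas n).aemeasurable]
  simp_rw [hind]
  have hE : 0 ≤ ∑' n : ℕ, Real.exp (-((n + 1 : ℝ) ^ c)) := tsum_nonneg fun n => (Real.exp_pos _).le
  -- The term n = 0 is bounded by the total mass 1, as the tail bound is available for positive
  -- thresholds only.
  rw [tsum_eq_zero_add' ENNReal.summable, ENNReal.ofReal_add zero_le_one (mul_nonneg hC hE),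
    ENNReal.ofReal_one, ENNReal.ofReal_mul hC,
    ENNReal.ofReal_tsum_of_nonneg (fun n => (Real.exp_pos _).le) (summable_exp_neg_rpow hc),
    ← ENNReal.tsum_mul_left]
  refine add_le_add prob_le_one (ENNReal.tsum_le_tsum fun n => ?_)
  have h1 := h (n + 1) n.cast_add_one_pos
  have h2 : ENNReal.ofReal ((n : ℝ) + 1) = ((n + 1 : ℕ) : ℝ≥0∞) := by
    rw [← Nat.cast_succ, ENNReal.ofReal_natCast]
  rwa [ENNReal.ofReal_mul hC, h2] at h1

namespace RadialEigensystem

variable (S : RadialEigensystem)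

/-- The tail is transferred from the Gibbs-weighted law to the free law. Where (π²/v)V ≤ K the
weight is at least e^(-K), and K = δ₁λ/2 still leaves e^(-δ₁λ/2); the set where V is larger is
handled by its own tail. -/
theorem exists_tail_flow {v : ℝ≥0} (hv : v ≠ 0) (k : ℕ) {σ : ℝ} (hσ0 : 0 ≤ σ) (hσ : σ < 1 / 2)
    {p q : ℝ≥0∞} (hp0 : p ≠ 0) (hpt : p ≠ ∞) (hpσ : p.toReal * σ < 2) (hq0 : q ≠ 0) (hqt : q ≠ ∞)
    {T : ℝ} (hT : 0 < T) :
    ∃ C c : ℝ, 0 < C ∧ 0 < c ∧ ∀ (A : Finset ℕ) (γ : (A → ℂ) → ℝ → A → ℂ), (∀ a, γ a 0 = a) →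
      (∀ a s, HasDerivAt (γ a) (S.discField A k (γ a s)) s) →
      (Measurable fun a => mixedNorm p q T fun t => S.fracField σ (γ a t)) ∧
      ∀ lam : ℝ, 0 < lam →
        S.coeffLaw v A {a | ENNReal.ofReal lam < mixedNorm p q T fun t => S.fracField σ (γ a t)} ≤
          ENNReal.ofReal (C * Real.exp (-(lam ^ c))) := by
  obtain ⟨C₁, δ₁, hC₁, hδ₁, h₁⟩ := S.exists_tail_fracField (v := v) hσ0 hσ hp0 hpt hpσ hq0 hqt hT
  obtain ⟨C₂, δ₂, hC₂, hδ₂, h₂⟩ := S.coeffLaw_lt_discPotential_le k v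
  have hv0 : (0 : ℝ) < v := NNReal.coe_pos.2 (pos_iff_ne_zero.2 hv)
  set β : ℝ := Real.pi ^ 2 / v with hβ
  have hβ0 : 0 < β := by positivity
  set b : ℝ := 1 / (2 * k + 2) with hb
  have hb0 : 0 < b := by positivity
  -- Any exponent strictly below 1/(2k + 2), the exponent in the tail of V, would do.
  set c : ℝ := 1 / (2 * k + 3) with hc
  have hc0 : 0 < c := by positivity
  have hcb : c < b := by
    rw [hc, hb]; exact one_div_lt_one_div_of_lt (by positivity) (by linarith)
  have hb1 : b < 1 := by
    rw [hb, div_lt_one (by positivity)]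
    have : (0 : ℝ) ≤ k := by positivity
    linarith
  obtain ⟨E₁, hE₁, hE₁'⟩ := exists_exp_neg_mul_rpow_le (a := δ₁ / 2) (b := 1) (c := c)
    (by positivity) hc0 (hcb.trans hb1)
  obtain ⟨E₂, hE₂, hE₂'⟩ := exists_exp_neg_mul_rpow_le (a := δ₂ * (δ₁ / 2 / β) ^ b) (b := b) (c := c)
    (by positivity) hc0 hcb
  refine ⟨C₁ * E₁ + C₂ * E₂, c, by positivity, hc0, fun A γ h0 hγ => ?_⟩
  have hX := S.isMassPreservingField_discField A k
  -- Measurability of the flow is known for t ≥ 0; clamping time makes it jointly measurable on all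
  -- of ℝ without changing the norm.
  set G : (A → ℂ) → ℝ → A → ℂ := fun a t => γ a (max t 0) with hG
  have hGm : Measurable fun z : (A → ℂ) × ℝ => G z.1 z.2 := by
    have h3 := measurable_uncurry_of_continuous_of_measurable (u := fun (t : ℝ) a => G a t)
      (fun a => by
        have hc : Continuous (γ a) := continuous_iff_continuousAt.2 fun s => (hγ a s).continuousAt
        exact hc.comp (by fun_prop))
      (fun t => hX.measurable_flow h0 hγ (le_max_right t 0))
    exact h3.comp measurable_swap
  have hnorm : ∀ a, (mixedNorm p q T fun t => S.fracField σ (γ a t)) =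
      mixedNorm p q T fun t => S.fracField σ (G a t) := fun a =>
    mixedNorm_congr fun t ht x _ => by simp only [hG, max_eq_left ht.1]
  have hYm : Measurable fun a => mixedNorm p q T fun t => S.fracField σ (γ a t) := by
    simp_rw [hnorm]
    refine measurable_mixedNorm hp0 hpt hq0 hqt T (F := fun a t => S.fracField σ (G a t)) ?_
    have h1 : Measurable fun z : (A → ℂ) × ℝ × Plane => (z.1, z.2.1) := by fun_prop
    have h2 : Measurable fun z : (A → ℂ) × ℝ × Plane => G z.1 z.2.1 := hGm.comp h1
    exact S.measurable_fracField σ h2 measurable_snd.snd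
  refine ⟨hYm, fun lam hlam => ?_⟩
  set ν := S.coeffLaw v A with hν
  have hwm : Measurable (S.gibbsWeight v A k) := (S.continuous_gibbsWeight v A k).measurable
  set ρ := ν.withDensity (S.gibbsWeight v A k) with hρ
  have hρ1 : ρ univ ≤ 1 := by
    rw [hρ, withDensity_apply _ MeasurableSet.univ, Measure.restrict_univ]
    refine (lintegral_mono fun a => S.gibbsWeight_le_one v A k a).trans ?_
    simp
  set Y : (A → ℂ) → ℝ≥0∞ := fun a => mixedNorm p q T fun t => S.fracField σ (γ a t) with hY
  set K : ℝ := δ₁ / 2 * lam with hK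
  have hK0 : 0 < K := by positivity
  have hGibbs : ρ {a | ENNReal.ofReal lam < Y a} ≤ ENNReal.ofReal (C₁ * Real.exp (-(δ₁ * lam))) := by
    have h3 := h₁ A ρ hρ1 G hGm (fun t ht f hf => by
      have := S.lintegral_flow_gibbsWeight_le hv A k h0 hγ ht.1 hf
      simpa only [hG, max_eq_left ht.1] using this) lam hlam
    simpa only [hY, hnorm] using h3
  have hpot := h₂ A (K / β) (by positivity)
  have hsub : {a | ENNReal.ofReal lam < Y a} ⊆
      ({a | ENNReal.ofReal lam < Y a} ∩ {a | S.discPotential A k a ≤ K / β}) ∪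
        {a | K / β < S.discPotential A k a} := by
    intro a ha
    rcases le_or_gt (S.discPotential A k a) (K / β) with h | h
    · exact Or.inl ⟨ha, h⟩
    · exact Or.inr h
  have hsmall : ν ({a | ENNReal.ofReal lam < Y a} ∩ {a | S.discPotential A k a ≤ K / β}) ≤
      ENNReal.ofReal (Real.exp K) * ρ {a | ENNReal.ofReal lam < Y a} := by
    set s := {a | ENNReal.ofReal lam < Y a} ∩ {a | S.discPotential A k a ≤ K / β} with hs
    calc ν s = ∫⁻ _ in s, 1 ∂ν := by simp
      _ ≤ ∫⁻ a in s, ENNReal.ofReal (Real.exp K) * S.gibbsWeight v A k a ∂ν := by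
        refine setLIntegral_mono (hwm.const_mul _) fun a ha => ?_
        have h4 : S.discPotential A k a ≤ K / β := ha.2
        rw [gibbsWeight, ← ENNReal.ofReal_mul (Real.exp_pos _).le, ← Real.exp_add,
          ← ENNReal.ofReal_one]
        refine ENNReal.ofReal_le_ofReal (Real.one_le_exp ?_)
        rw [le_div_iff₀ hβ0] at h4
        linarith
      _ = ENNReal.ofReal (Real.exp K) * ∫⁻ a in s, S.gibbsWeight v A k a ∂ν :=
        lintegral_const_mul _ hwm
      _ ≤ ENNReal.ofReal (Real.exp K) * ρ s := by gcongr; exact withDensity_apply_le _ _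
      _ ≤ _ := by gcongr; exact inter_subset_left
  refine (measure_mono hsub).trans ((measure_union_le _ _).trans ?_)
  refine (add_le_add (hsmall.trans (mul_le_mul_right hGibbs _)) hpot).trans ?_
  rw [← ENNReal.ofReal_mul (Real.exp_pos _).le, ← ENNReal.ofReal_add (by positivity) (by positivity)]
  refine ENNReal.ofReal_le_ofReal ?_
  have e1 : Real.exp K * (C₁ * Real.exp (-(δ₁ * lam))) = C₁ * Real.exp (-(δ₁ / 2 * lam ^ (1 : ℝ))) := by
    rw [mul_left_comm, ← Real.exp_add, Real.rpow_one, hK]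
    congr 2; ring
  have e2 : δ₂ * (K / β) ^ b = δ₂ * (δ₁ / 2 / β) ^ b * lam ^ b := by
    rw [mul_assoc, ← Real.mul_rpow (by positivity) hlam.le, hK]
    congr 2; ring
  rw [e1, e2, add_mul, mul_assoc C₁, mul_assoc C₂]
  exact add_le_add (mul_le_mul_of_nonneg_left (hE₁' lam hlam) hC₁.le)
    (mul_le_mul_of_nonneg_left (hE₂' lam hlam) hC₂.le)

theorem coeff_sum_smul_eL2 (A : Finset ℕ) (a : A → ℂ) (n : A) :
    S.coeff (∑ m, a m • S.eL2 m : DiscL2) n = a n := by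
  rw [S.coeff_eq_inner, inner_sum]
  simp only [inner_smul_right, orthonormal_iff_ite.1 S.orthonormal_eL2]
  rw [Finset.sum_eq_single n]
  · simp
  · intro m _ hm
    rw [if_neg fun h => hm (Subtype.ext h.symm), mul_zero]
  · simp

theorem fracLaplacian_eq_fracField (σ : ℝ) {A : Finset ℕ} {f : Plane → ℂ}
    (hf : ∀ m ∉ A, S.coeff f m = 0) {x : Plane} (hx : x ∈ unitDisc) :
    S.fracLaplacian σ f x = S.fracField σ (fun n : A => S.coeff f n) x := by
  rw [fracLaplacian, tsum_eq_sum (s := A) fun m hm => by rw [hf m hm]; ring, fracField,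
    ← Finset.sum_coe_sort]
  refine Finset.sum_congr rfl fun n _ => ?_
  rw [S.fracMode_of_mem σ n hx]
  push_cast
  ring

end RadialEigensystem

end

/-! ### From the coefficients back to the free measure. -/

theorem proposition3p2 (S : RadialEigensystem) (v : ℝ≥0) (hv : 0 < v)
    (α : ℕ) (hα : Even α) (hα0 : 0 < α) (T : ℝ) (hT : 0 < T)
    (σ : ℝ) (hσ0 : 0 ≤ σ) (hσ : σ < 1 / 2)
    (p q : ℝ≥0∞) (hp : 2 ≤ p) (hpσ : p < 2 / ENNReal.ofReal σ) (hq0 : 0 < q) (hq : q < ∞) :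
    ∃ C c : ℝ, 0 < C ∧ 0 < c ∧
      ∀ N : ℕ, 1 ≤ N → ∀ u : DiscL2 → ℝ → Plane → ℂ,
        (∀ φ : DiscL2, S.IsTruncatedSolution α N φ (u φ)) →
        (∀ lam : ℝ, 0 < lam →
          S.freeMeasure v {φ : DiscL2 | ENNReal.ofReal lam <
              mixedNorm p q T (fun t => S.fracLaplacian σ (u φ t))}
            ≤ ENNReal.ofReal (C * Real.exp (-(lam ^ c)))) ∧
        ∫⁻ φ, mixedNorm p q T (fun t => S.fracLaplacian σ (u φ t)) ∂(S.freeMeasure v)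
          ≤ ENNReal.ofReal C := by
  obtain ⟨k, rfl⟩ := hα.two_dvd
  have hp0 : p ≠ 0 := fun h => by simp [h] at hp
  have hpt : p ≠ ∞ := ne_top_of_lt hpσ
  have hpσ' : p.toReal * σ < 2 := by
    -- At σ = 0 the bound 2/σ is ∞ in `ℝ≥0∞`, so the condition on p just says that p is finite.
    rcases hσ0.eq_or_lt with h | h
    · rw [← h]; norm_num
    · rw [ENNReal.lt_div_iff_mul_lt (Or.inl (ENNReal.ofReal_pos.2 h).ne')
        (Or.inl ENNReal.ofReal_ne_top), ← ENNReal.ofReal_toReal hpt,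
        ← ENNReal.ofReal_mul ENNReal.toReal_nonneg, ← ENNReal.ofReal_ofNat,
        ENNReal.ofReal_lt_ofReal_iff two_pos] at hpσ
      exact hpσ
  obtain ⟨C, c, hC, hc, h⟩ := S.exists_tail_flow hv.ne' k hσ0 hσ hp0 hpt hpσ' hq0.ne' hq.ne hT
  set E := ∑' n : ℕ, Real.exp (-((n + 1 : ℝ) ^ c)) with hE
  have hE0 : 0 ≤ E := tsum_nonneg fun n => (Real.exp_pos _).le
  -- One constant dominates both the tail constant C and the expectation bound 1 + C E.
  refine ⟨C + (1 + C * E), c, by positivity, hc, fun N _ u hu => ?_⟩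
  set A := S.modes N with hA
  -- The flow on coefficients comes from the given solutions, started from the finite combination of
  -- modes with coefficients a.
  set γ : (A → ℂ) → ℝ → A → ℂ := fun a t n => S.coeff (u (∑ m, a m • S.eL2 m) t) n with hγdef
  have hγ0 : ∀ a, γ a 0 = a := fun a => funext fun n => by
    simp only [hγdef]
    rw [(hu _).coeff_zero n, S.coeff_sum_smul_eL2]
  have hγ : ∀ a s, HasDerivAt (γ a) (S.discField A k (γ a s)) s := fun a s =>
    (hu _).hasDerivAt_coeff s
  obtain ⟨hYm, htail⟩ := h A γ hγ0 hγ
  set Y : (A → ℂ) → ℝ≥0∞ := fun a => mixedNorm p q T fun t => S.fracField σ (γ a t) with hY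
  set coeffs : DiscL2 → A → ℂ := fun φ n => S.coeff φ n with hcoeffs
  have hcm : Measurable coeffs := measurable_pi_iff.2 fun n => S.measurable_coeff n
  have hlaw : (S.freeMeasure v).map coeffs = S.coeffLaw v A := S.freeMeasure_map_coeff v A
  -- By uniqueness for the ODE the solution depends on φ only through its finitely many low
  -- coefficients, so the norm is a function of a Gaussian vector.
  have hnorm : ∀ φ, (mixedNorm p q T fun t => S.fracLaplacian σ (u φ t)) = Y (coeffs φ) := by
    intro φ
    refine mixedNorm_congr fun t ht x hx => ?_
    rw [S.fracLaplacian_eq_fracField σ (fun m hm => (hu φ).coeff_eq_zero t hm) hx]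
    congr 1
    refine (S.isMassPreservingField_discField A k).eq_of_hasDerivAt
      (γ := fun s (n : A) => S.coeff (u φ s) n) (fun s => (hu φ).hasDerivAt_coeff s)
      (hγ (coeffs φ)) ?_ ht.1
    rw [hγ0]
    exact funext fun n => (hu φ).coeff_zero n
  simp_rw [hnorm]
  constructor
  · intro lam hlam
    have h1 := htail lam hlam
    have hm : MeasurableSet {a | ENNReal.ofReal lam < Y a} := hYm measurableSet_Ioi
    have h2 := Measure.map_apply (μ := S.freeMeasure v) hcm hm
    rw [hlaw] at h2
    refine h2.symm.trans_le (h1.trans (ENNReal.ofReal_le_ofReal ?_))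
    gcongr
    have : 0 ≤ C * E := by positivity
    linarith
  · have h1 := lintegral_le_of_tail (S.coeffLaw v A) hYm hC.le hc htail
    rw [← hlaw, lintegral_map hYm hcm] at h1
    exact h1.trans (ENNReal.ofReal_le_ofReal (by linarith))
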